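/- **Conventions.** Let $A$ be an associative ring with $1$ and an involution $a\mapsto\bar a$; modules are left $A$-modules, and $M^*=\mathrm{Hom}_A(M,A)$ is a left module by $(af)(x)=f(x)\bar a$. A chain complex $C$ (graded by $\mathbb Z$) is finite-dimensional if it is bounded with every $C_r$ finitely generated projective; $C^p=(C_p)^*$. For such $C$ and an arbitrary complex $B$ identify $(C^t\otimes_AC)_k=\prod_{p+q=k}\mathrm{Hom}_A(C^p,C_q)$, with $d_{C^t\otimes C}(\theta)=d\theta+(-1)^q\theta d^*$ on the component $C^p\to C_q$ and $T\theta=(-1)^{pq}\theta^*$; write $\theta(x)(y)\in A$ $(x\in C^p,y\in C^q)$ for the pairing given by $C_q=(C^q)^*$. For $B$ identify $B_i\otimes_AC_p=\mathrm{Hom}_A(C^p,B_i)$, so that an $n$-cycle of $B^t\otimes_AC$ is a chain map $f:B^{n-*}\to C$ recorded by its dual $f^*:C^p\to B_{n-p}$; the differential is $d(b\otimes c)=b\otimes dc+(-1)^p\,db\otimes c$ $(c\in C_p)$. An $n$-chain of $\widehat W^\%C$ is a family $\{\theta_s\in(C^t\otimes_AC)_{n+s}\mid s\in\mathbb Z\}$,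 with $(d\theta)_s=d(\theta_s)+(-1)^{n+s-1}(\theta_{s-1}+(-1)^sT\theta_{s-1})$. $W^\%C$ is the subcomplex with $\theta_s=0$ for $s<0$, and $J$ is its inclusion. An $n$-chain of $W_\%C$ is a family $\{\psi_s\in(C^t\otimes_AC)_{n-s}\mid s\ge0\}$, with $(d\psi)_s=d(\psi_s)+(-1)^{n-s-1}(\psi_{s+1}+(-1)^{s+1}T\psi_{s+1})$. The homology groups are $\widehat Q^n(C)=H_n(\widehat W^\%C)$, $Q^n(C)=H_n(W^\%C)$, $Q_n(C)=H_n(W_\%C)$. Here $1+T:Q_n(C)\to Q^n(C)$ sends $\psi$ to the structure with $0$-component $(1+T)\psi_0$ and all other components $0$, and $H:\widehat Q^{n+1}(C)\to Q_n(C)$ is $(H\theta)_s=\theta_{-s-1}$ $(s\ge0)$. A *chain bundle* $(B,\beta)$ is a chain complex $B$ with morphisms $\beta_s:B_i\to B^j=(B_j)^*$ $(s=-(i+j))$ such that $$(-1)^{j+1}d^*\beta_s+(-1)^s\beta_sd+(-1)^{s-1}(\beta_{s-1}+(-1)^sT\beta_{s-1})=0:B_i\to B^j\qquad(s=1-i-j),$$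 i.e. a cycle of $(\widehat W^\%B^{0-*})_0$. For degree $k$ and $l$ chains $u,v$ of $B^t\otimes_AC$ let $(u\beta v^*)(x)(y)=(-1)^{kq}\beta(u^*x)(v^*y)$ $(x\in C^p,y\in C^q)$. For chain maps $f,f':B^{n-*}\to C$ and a homotopy $g:f\simeq f'$ put $$\widehat f^\%(S^n\beta)=f\beta f^*,\quad (g;f,f')^\%(S^n\beta)=(-1)^nf\beta g^*+g\beta f'^*+T(g\beta g^*),\quad [f,f'](S^n\beta)=-(-1)^nT(f'\beta f^*).$$ An *$n$-dimensional symmetric $(B,\beta)$-structure* $(\phi,\theta,f)$ on $C$ is a cycle $\phi\in(W^\%C)_n$, a chain $\theta\in(\widehat W^\%C)_{n+1}$ and a chain map $f:B^{n-*}\to C$ with $J(\phi)-\widehat f^\%(S^n\beta)=d\theta$. An *equivalence* $(\xi,\eta,g):(\phi,\theta,f)\to(\phi',\theta',f')$ consists of $\xi\in(W^\%C)_{n+1}$ with $d\xi=\phi'-\phi$, a chain $\eta\in(\widehat W^\%C)_{n+2}$ and a chain homotopy $g:f\simeq f'$ with $J(\xi)-(g;f,f')^\%(S^n\beta)-\theta'+\theta=d\eta$.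 Equivalence classes form the abelian group $Q\langle B,\beta\rangle^n(C)$ under $(\phi,\theta,f)+(\phi',\theta',f')=(\phi+\phi',\theta+\theta'+[f,f'](S^n\beta),f+f')$. The group $P\langle B,\beta\rangle^n(C)$ consists of the structures $(\theta,f)=(0,\theta,f)$ modulo the equivalences $(0,\eta,g)$, with the same addition. A chain map $h:C\to C'$ induces $\langle1,0\rangle(h)^\%(\phi,\theta,f)=(h^\%\phi,\widehat h^\%\theta,hf)$. Let $I_\beta:H_n(B^t\otimes_AC)\to\widehat Q^n(C)$, $f\mapsto\widehat f^\%(S^n\beta)$. The bundle is *universal* if $I_\beta$ is an isomorphism for all finite-dimensional $C$ and all $n$, and *zero* if $B=0$. **Theorem.** Let $(B,\beta)$ be a chain bundle over $A$. **(1)** Let $C$ be finite-dimensional and $n\in\mathbb Z$. Consider the morphisms: $Q\langle B,\beta\rangle^n(C)\to Q^n(C)$, $(\phi,\theta,f)\mapsto\phi$; $Q\langle B,\beta\rangle^n(C)\to H_n(B^t\otimes_AC)$ and $P\langle B,\beta\rangle^n(C)\to H_n(B^t\otimes_AC)$, given by $f$; $P\langle B,\beta\rangle^n(C)\to Q\langle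 B,\beta\rangle^n(C)$, $(\theta,f)\mapsto(0,\theta,f)$; $Q_n(C)\to Q\langle B,\beta\rangle^n(C)$, $\psi\mapsto((1+T)\psi,\theta,0)$ with $\theta_s=(-1)^n\psi_{-s-1}$ for $s\le-1$ and $\theta_s=0$ for $s\ge0$; $\widehat Q^{n+1}(C)\to P\langle B,\beta\rangle^n(C)$, $\theta\mapsto((-1)^n\theta,0)$. With $1+T$, $J$, $H$, $I_\beta$ they form a commutative braid of long exact sequences $$\cdots\to Q_n(C)\to Q^n(C)\to\widehat Q^n(C)\to Q_{n-1}(C)\to\cdots,$$ $$\cdots\to P\langle B,\beta\rangle^n(C)\to Q\langle B,\beta\rangle^n(C)\to Q^n(C)\to P\langle B,\beta\rangle^{n-1}(C)\to\cdots,$$ $$\cdots\to Q_n(C)\to Q\langle B,\beta\rangle^n(C)\to H_n(B^t\otimes_AC)\to Q_{n-1}(C)\to\cdots,$$ $$\cdots\to P\langle B,\beta\rangle^n(C)\to H_n(B^t\otimes_AC)\to\widehat Q^n(C)\to P\langle B,\beta\rangle^{n-1}(C)\to\cdots,$$ where $Q^n(C)\to P\langle B,\beta\rangle^{n-1}(C)$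 and $H_n(B^t\otimes_AC)\to Q_{n-1}(C)$ are the composites through $\widehat Q^n(C)$. Moreover there is a long exact sequence $$\cdots\to Q\langle B,\beta\rangle^n(C)\to Q^n(C)\oplus H_n(B^t\otimes_AC)\xrightarrow{(J,-I_\beta)}\widehat Q^n(C)\to Q\langle B,\beta\rangle^{n-1}(C)\to\cdots$$ with last morphism the composite through $P\langle B,\beta\rangle^{n-1}(C)$. **(2)** If $(B,\beta)$ is universal, then for all finite-dimensional $C$ and all $n$ the map $Q\langle B,\beta\rangle^n(C)\to Q^n(C)$ is an isomorphism and $P\langle B,\beta\rangle^n(C)=0$. If $(B,\beta)$ is zero, the maps $Q_n(C)\to Q\langle B,\beta\rangle^n(C)$ and $\widehat Q^{n+1}(C)\to P\langle B,\beta\rangle^n(C)$ are isomorphisms. **(3)** Let $n,r\in\mathbb Z$, $m=n-r$, and let $S^mA$ be $A$ in degree $m$, with generator $1\in(S^mA)^m=A^*$. Evaluation $\phi\mapsto\phi_{n-2r}(1)(1)$ is an isomorphism $Q^n(S^mA)\cong H^{n-2r}(\mathbb Z_2;A,(-1)^m)$. Here, for $\epsilon=\pm1$, $H^k(\mathbb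 Z_2;A,\epsilon)$ is $\{a\mid a=\epsilon\bar a\}$ if $k=0$, $\{a\mid a=(-1)^k\epsilon\bar a\}/\{x+(-1)^k\epsilon\bar x\}$ if $k>0$, and $0$ if $k<0$. An element $c\in A$ acts on $Q\langle B,\beta\rangle^n(S^mA)$ through the endomorphism of $S^mA$ given by right multiplication by $\bar c$. * If $2r<n$, then $(\phi,\theta,f)\mapsto f^*(1)$ is an isomorphism $Q\langle B,\beta\rangle^n(S^mA)\cong H_r(B)$, compatible with the actions of $A$. The map to $Q^n(S^mA)$ is $b\mapsto\beta_{-2r}(b)(b)$. * If $2r\ge n$, then $(\phi,\theta,f)\mapsto((-1)^{nm}\theta_{n-2r-1}(1)(1),f^*(1))$ is a bijection of $Q\langle B,\beta\rangle^n(S^mA)$ with $X/\!\sim$. Here $X$ is the set of pairs $(a,b)\in A\oplus B_r$ with $db=0$ and, if $2r>n$, also $a+(-1)^r\bar a+\beta_{-2r}(b)(b)=0$; and $\sim$ is the equivalence relation with $(a,b)\sim(a',b')$ if there exist $x\in A$, $y\in B_{r+1}$ such that $b'-b=dy$ and $$a'-a=x+(-1)^{r+1}\bar x-\beta_{-2r-1}(y)(b)-(-1)^r\beta_{-2r-1}(b')(y)+(-1)^r\beta_{-2r-2}(y)(y).$$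 The addition is $(a,b)+(a',b')=(a+a'-\beta_{-2r}(b)(b'),b+b')$, and $c\in A$ acts by $(a,b)\mapsto(ca\bar c,cb)$. The map to $Q^n(S^mA)$ is $(a,b)\mapsto a+(-1)^r\bar a+\beta_{-2r}(b)(b)$ if $2r=n$, and $0$ if $2r>n$. **(4)** Let $(\phi,\theta,f)$ be an $n$-dimensional symmetric $(B,\beta)$-structure on a finite-dimensional $C$. Regard a cocycle $z\in C^m$ ($m=n-r$) as a chain map $z:C\to S^mA$. Then $z\mapsto\langle1,0\rangle(z)^\%(\phi,\theta,f)$ induces a well-defined map, the Wu class $$v_r:H^{n-r}(C)\to Q\langle B,\beta\rangle^n(S^{n-r}A),$$ which commutes with the actions of $A$ and is additive if $2r\ne n$. Its composite with the map to $Q^n(S^{n-r}A)=H^{n-2r}(\mathbb Z_2;A,(-1)^{n-r})$ is $z\mapsto\phi_{n-2r}(z)(z)$. Under the identifications of (3), $$v_r(z)=f^*(z)\ \text{ if }2r<n,\qquad v_r(z)=\big((-1)^{n(n-r)}\theta_{n-2r-1}(z)(z),\,f^*(z)\big)\ \text{ if }2r\ge n.$$ If $2r=n$, then $v_r(z+z')=v_r(z)+v_r(z')+(\phi_0(z)(z'),0)$.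 -/

import Mathlib

open CategoryTheory

universe u
set_option linter.unusedSectionVars false

namespace ChainBundles

/-- The sign `(-1)^k`. -/
def sgn (k : ℤ) : ℤ := (k.negOnePow : ℤ)

theorem sgn_eq_ite (k : ℤ) : sgn k = if Even k then 1 else -1 := by
  unfold sgn
  split_ifs with h
  · simp [Int.negOnePow_even k h]
  · simp [Int.negOnePow_odd k (Int.not_even_iff_odd.mp h)]

theorem sgn_cases (k : ℤ) : sgn k = 1 ∨ sgn k = -1 := by
  rw [sgn_eq_ite]; split_ifs <;> simp

theorem sgn_mul_self (k : ℤ) : sgn k * sgn k = 1 := by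
  rcases sgn_cases k with h | h <;> simp [h]

theorem sgn_add_one (k : ℤ) : sgn (k + 1) = -sgn k := by
  simp only [sgn_eq_ite, Int.even_add_one]; split_ifs <;> simp_all

theorem sgn_add_two (k : ℤ) : sgn (k + 2) = sgn k := by
  have : k + 2 = k + 1 + 1 := by ring
  rw [this, sgn_add_one, sgn_add_one, neg_neg]

/-! ### Duality over a ring with involution -/

section Dual

variable (A : Type u) [Ring A]

/-- The dual `M^* = Hom_A(M, A)` of a left `A`-module `M`, made into a left `A`-module by
`(a f)(x) = f(x) * star a`. -/
def StarDual (M : Type u) [AddCommGroup M] [Module A M] : Type u := M →ₗ[A] A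

namespace StarDual

variable {A}
variable {M N : Type u} [AddCommGroup M] [Module A M] [AddCommGroup N] [Module A N]

instance : AddCommGroup (StarDual A M) := inferInstanceAs (AddCommGroup (M →ₗ[A] A))

instance : FunLike (StarDual A M) M A := inferInstanceAs (FunLike (M →ₗ[A] A) M A)

instance : LinearMapClass (StarDual A M) A M A :=
  inferInstanceAs (LinearMapClass (M →ₗ[A] A) A M A)

/-- A linear functional as an element of the dual. -/
def of (f : M →ₗ[A] A) : StarDual A M := f

@[simp] theorem of_apply (f : M →ₗ[A] A) (x : M) : of f x = f x := rfl

@[ext] theorem ext {f g : StarDual A M} (h : ∀ x, f x = g x) : f = g := DFunLike.ext f g h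

@[simp] theorem add_apply (f g : StarDual A M) (x : M) : (f + g) x = f x + g x := rfl

@[simp] theorem zero_apply (x : M) : (0 : StarDual A M) x = 0 := rfl

@[simp] theorem neg_apply (f : StarDual A M) (x : M) : (-f) x = -f x := rfl

@[simp] theorem sub_apply (f g : StarDual A M) (x : M) : (f - g) x = f x - g x := rfl

@[simp] theorem zsmul_apply (k : ℤ) (f : StarDual A M) (x : M) : (k • f) x = k • f x := rfl

variable [StarRing A]

instance : SMul A (StarDual A M) where
  smul a f := of
    { toFun := fun x => f x * star a
      map_add' := fun x y => by rw [map_add, add_mul]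
      map_smul' := fun b x => by
        rw [map_smul, smul_eq_mul, smul_eq_mul, RingHom.id_apply, mul_assoc] }

@[simp] theorem smul_apply (a : A) (f : StarDual A M) (x : M) : (a • f) x = f x * star a := rfl

instance : Module A (StarDual A M) where
  one_smul f := by ext x; simp
  mul_smul a b f := by ext x; simp [mul_assoc]
  smul_zero a := by ext x; simp
  smul_add a f g := by ext x; simp [add_mul]
  add_smul a b f := by ext x; simp [mul_add]
  zero_smul f := by ext x; simp

/-- The dual `f^* : N^* → M^*` of a module morphism `f : M → N`. -/
def map (f : M →ₗ[A] N) : StarDual A N →ₗ[A] StarDual A M where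
  toFun g := of ((show N →ₗ[A] A from g) ∘ₗ f)
  map_add' _ _ := rfl
  map_smul' _ _ := rfl

@[simp] theorem map_apply (f : M →ₗ[A] N) (g : StarDual A N) (x : M) : map f g x = g (f x) := rfl

/-- The dual `φ^* : N → M^*` of `φ : M → N^*`, with `N^{**} = N`: `φ^*(y)(x) = star (φ(x)(y))`. -/
def flip (φ : M →ₗ[A] StarDual A N) : N →ₗ[A] StarDual A M where
  toFun y := of
    { toFun := fun x => star (φ x y)
      map_add' := fun x x' => by simp
      map_smul' := fun a x => by simp }
  map_add' y y' := by ext x; simp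
  map_smul' a y := by ext x; simp

@[simp] theorem flip_apply (φ : M →ₗ[A] StarDual A N) (y : N) (x : M) :
    flip φ y x = star (φ x y) := rfl

end StarDual

end Dual

section Complexes

variable {A : Type u} [Ring A] [StarRing A]

/-- A finite-dimensional chain complex: a bounded complex of f.g. projective modules. -/
def FiniteDim (C : ChainComplex (ModuleCat.{u} A) ℤ) : Prop :=
  (∀ p, Module.Finite A (C.X p) ∧ Module.Projective A (C.X p)) ∧
    ∃ a b : ℤ, ∀ p, p < a ∨ b < p → Subsingleton (C.X p)

variable (B C : ChainComplex (ModuleCat.{u} A) ℤ)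

/-- The cochain module `C^p = (C_p)^*`. -/
abbrev Co (p : ℤ) : Type u := StarDual A (C.X p)

/-- The dual differential `d^* : C^p → C^q` (zero unless `q = p + 1`). -/
def dDual (p q : ℤ) : Co C p →ₗ[A] Co C q := StarDual.map (C.d q p).hom

@[simp] theorem dDual_apply (p q : ℤ) (f : Co C p) (x : C.X q) :
    dDual C p q f x = f ((C.d q p).hom x) := rfl

theorem d_d (p q r : ℤ) (x : C.X p) : (C.d q r).hom ((C.d p q).hom x) = 0 := by
  rw [← LinearMap.comp_apply, ← ModuleCat.hom_comp, C.d_comp_d]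
  rfl

@[simp] theorem dDual_dDual (p q r : ℤ) (f : Co C p) : dDual C q r (dDual C p q f) = 0 := by
  ext x; simp [d_d]

/-- The underlying group of the `n`-chains of `Ŵ^%C = Hom_{ℤ[ℤ₂]}(Ŵ, C^t ⊗_A C)`, for every `n`.
For finite-dimensional `C`, `(C^t ⊗_A C)_k = Hom_A(C^{-*}, C)_k = ∏_{p+q=k} Hom_A(C^p, C_q)`,
with `C_q = (C^q)^*`. An `n`-chain `{θ_s ∈ (C^t ⊗_A C)_{n+s} | s ∈ ℤ}` is recorded as the family of
all `θ p q : C^p → (C^q)^*`; the component `θ p q` belongs to `θ_s` for `s = p + q - n`. -/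
abbrev Fam : Type u := ∀ p q : ℤ, Co C p →ₗ[A] StarDual A (Co C q)

variable {C}

theorem Fam.ext' {θ θ' : Fam C} (h : ∀ p q (x : Co C p) (y : Co C q), θ p q x y = θ' p q x y) :
    θ = θ' := by
  funext p q; ext x y : 2; exact h p q x y

/-- The differential of `C^t ⊗_A C`: `dθ + (-1)^q θ d^*` on `C^p`, with values in `C_q`. -/
def tensorD : Fam C →+ Fam C where
  toFun θ p q := StarDual.map (dDual C q (q + 1)) ∘ₗ θ p (q + 1) +
    sgn q • (θ (p + 1) q ∘ₗ dDual C p (p + 1))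
  map_zero' := by
    apply Fam.ext'; intros; simp
  map_add' θ θ' := by
    apply Fam.ext'; intros; simp; abel

/-- The transposition involution `T θ = (-1)^{pq} θ^*`. -/
def transT : Fam C →+ Fam C where
  toFun θ p q := sgn (p * q) • StarDual.flip (θ q p)
  map_zero' := by
    apply Fam.ext'; intros; simp
  map_add' θ θ' := by
    apply Fam.ext'; intros; simp

/-- The differential `(Ŵ^%C)_n → (Ŵ^%C)_{n-1}`,
`(dθ)_s = d(θ_s) + (-1)^{n+s-1}(θ_{s-1} + (-1)^s T θ_{s-1})`, at the component `p + q = n - 1 + s`. -/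
def tateD (n : ℤ) : Fam C →+ Fam C where
  toFun θ p q := tensorD θ p q +
    sgn (p + q) • (θ p q + sgn (p + q - n + 1) • transT θ p q)
  map_zero' := by
    apply Fam.ext'; intros; simp
  map_add' θ θ' := by
    apply Fam.ext'; intros; simp; abel

/-- Auxiliary operator with `tateD n = opE - (-1)^n T`. -/
def opE : Fam C →+ Fam C where
  toFun θ p q := tensorD θ p q + sgn (p + q) • θ p q
  map_zero' := by
    apply Fam.ext'; intros; simp
  map_add' θ θ' := by
    apply Fam.ext'; intros; simp; abel

theorem tensorD_apply (θ : Fam C) (p q : ℤ) (x : Co C p) (y : Co C q) :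
    tensorD θ p q x y = θ p (q + 1) x (dDual C q (q + 1) y) +
      sgn q • θ (p + 1) q (dDual C p (p + 1) x) y := rfl

theorem transT_apply (θ : Fam C) (p q : ℤ) (x : Co C p) (y : Co C q) :
    transT θ p q x y = sgn (p * q) • star (θ q p y x) := rfl

theorem opE_apply (θ : Fam C) (p q : ℤ) (x : Co C p) (y : Co C q) :
    opE θ p q x y = θ p (q + 1) x (dDual C q (q + 1) y) +
      sgn q • θ (p + 1) q (dDual C p (p + 1) x) y + sgn (p + q) • θ p q x y := rfl

theorem tateD_eq (n : ℤ) (θ : Fam C) : tateD n θ = opE θ - sgn n • transT θ := by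
  apply Fam.ext'
  intro p q x y
  have h : sgn (p + q) * sgn (p + q - n + 1) = - sgn n := by
    simp only [sgn_eq_ite, Int.even_add, Int.even_sub]
    by_cases h1 : Even p <;> by_cases h2 : Even q <;> by_cases h3 : Even n <;> simp [h1, h2, h3]
  change tensorD θ p q x y + sgn (p + q) • (θ p q x y + sgn (p + q - n + 1) • transT θ p q x y) =
    tensorD θ p q x y + sgn (p + q) • θ p q x y - sgn n • transT θ p q x y
  rw [smul_add, smul_smul, h, neg_smul]
  abel

theorem transT_transT (θ : Fam C) : transT (transT θ) = θ := by
  apply Fam.ext'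
  intro p q x y
  rw [transT_apply, transT_apply, star_zsmul, star_star, smul_smul, mul_comm q p, sgn_mul_self,
    one_smul]

theorem transT_opE (θ : Fam C) : transT (opE θ) = opE (transT θ) := by
  apply Fam.ext'
  intro p q x y
  simp only [transT_apply, opE_apply, star_add, star_zsmul, smul_add, smul_smul]
  have e1 : sgn (p * q) * sgn p = sgn (p * (q + 1)) := by
    simp only [sgn_eq_ite, Int.even_add, Int.even_mul]
    by_cases h1 : Even p <;> by_cases h2 : Even q <;> simp [h1, h2]
  have e2 : sgn q * sgn ((p + 1) * q) = sgn (p * q) := by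
    simp only [sgn_eq_ite, Int.even_add, Int.even_mul]
    by_cases h1 : Even p <;> by_cases h2 : Even q <;> simp [h1, h2]
  rw [e1, e2, add_comm q p, mul_comm (sgn (p * q)) (sgn (p + q))]
  abel

theorem opE_opE (θ : Fam C) : opE (opE θ) = θ := by
  apply Fam.ext'
  intro p q x y
  simp only [opE_apply, dDual_dDual, map_zero, StarDual.zero_apply, smul_add, smul_smul]
  have e1 : sgn q * sgn (p + 1 + q) = - sgn (p + q) * sgn q := by
    rw [show p + 1 + q = p + q + 1 by ring, sgn_add_one]; ring
  rw [e1, ← add_assoc p q 1, sgn_add_one, sgn_add_one, sgn_mul_self]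
  simp only [smul_zero, neg_smul, neg_mul]
  rw [sgn_mul_self, one_smul]
  abel

theorem tateD_tateD (n : ℤ) (θ : Fam C) : tateD n (tateD (n + 1) θ) = 0 := by
  simp only [tateD_eq, map_sub, map_zsmul, transT_opE, opE_opE, transT_transT, smul_sub, smul_smul,
    sgn_add_one]
  rcases sgn_cases n with h | h <;> simp [h] <;> abel

end Complexes

section Bundles

variable {A : Type u} [Ring A] [StarRing A]

variable (B C : ChainComplex (ModuleCat.{u} A) ℤ)

/-- The `n`-chains of `B^t ⊗_A C`, for `C` finite-dimensional: `B_i ⊗_A C_p` is identified with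
`Hom_A(C^p, B_i)` by `b ⊗ c ↦ (h ↦ star (h c) • b)`. For finite-dimensional `B` a chain
`f ∈ Hom_A(B^{-*}, C)_n = (B^t ⊗_A C)_n` is recorded by the components `f^* : C^p → B_i`,
`p + i = n`, of its dual. -/
abbrev Cross (n : ℤ) : Type u := ∀ t : {t : ℤ × ℤ // t.1 + t.2 = n}, Co C t.1.1 →ₗ[A] B.X t.1.2

variable {B C}

/-- The differential `d(b ⊗ c) = b ⊗ d(c) + (-1)^p d(b) ⊗ c` of `B^t ⊗_A C`, where `c ∈ C_p`. -/
def crossD {n m : ℤ} (h : m + 1 = n) : Cross B C n →+ Cross B C m where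
  toFun f t :=
    f ⟨(t.1.1 + 1, t.1.2), by have := t.2; dsimp only; omega⟩ ∘ₗ dDual C t.1.1 (t.1.1 + 1) +
    sgn t.1.1 • ((B.d (t.1.2 + 1) t.1.2).hom ∘ₗ
      f ⟨(t.1.1, t.1.2 + 1), by have := t.2; dsimp only; omega⟩)
  map_zero' := by funext t; ext x; simp
  map_add' f g := by funext t; ext x; simp; abel

variable (B) in
/-- A bundle over `B`: a cycle `β ∈ (Ŵ^% B^{0-*})_0`, that is morphisms
`β_s ∈ Hom_A(B_i, B^j)`, `s = -(i + j)`, such that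
`(-1)^{j+1} d^* β_s + (-1)^s β_s d + (-1)^{s-1}(β_{s-1} + (-1)^s T β_{s-1}) = 0` from `B_i` to `B^j`
for `s = 1 - i - j`. The complex `B` need not be finite-dimensional. -/
structure Bundle where
  /-- The component `B_i → B^j = (B_j)^*` of `β_s`, `s = -(i + j)`. -/
  β : ∀ i j : ℤ, B.X i →ₗ[A] StarDual A (B.X j)
  cycle : ∀ (i j : ℤ) (x : B.X i) (y : B.X j),
    sgn (j + 1) • β i (j - 1) x ((B.d j (j - 1)).hom y) +
      sgn (1 - i - j) • β (i - 1) j ((B.d i (i - 1)).hom x) y +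
      sgn (-i - j) • (β i j x y + sgn (1 - i - j) • sgn (i * j) • star (β j i y x)) = 0

theorem Bundle.cycle' (β : Bundle B) {i j i' j' : ℤ} (hi : i' + 1 = i) (hj : j' + 1 = j)
    (x : B.X i) (y : B.X j) :
    sgn (i * j) • star (β.β j i y x) =
      sgn (j + 1) • β.β i j' x ((B.d j j').hom y) -
      sgn (i + j) • β.β i' j ((B.d i i').hom x) y + sgn (i + j) • β.β i j x y := by
  obtain rfl : i' = i - 1 := by omega
  obtain rfl : j' = j - 1 := by omega
  have h := β.cycle i j x y
  have e1 : sgn (1 - i - j) = - sgn (i + j) := by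
    simp only [sgn_eq_ite, Int.even_add, Int.even_sub]
    by_cases h1 : Even i <;> by_cases h2 : Even j <;> simp [h1, h2]
  have e2 : sgn (- i - j) = sgn (i + j) := by
    simp only [sgn_eq_ite, Int.even_add, Int.even_sub, even_neg]
  rw [e1, e2, smul_add, smul_smul, mul_neg, sgn_mul_self, neg_smul, neg_smul, one_smul] at h
  rw [← sub_eq_zero, ← neg_eq_zero, ← h]
  abel

/-- The composite `f β g^*`, where `u` and `v` are the duals of `f` and `g`: on `C^p × C^q` it is
`(-1)^{kq} β(u x)(v y)` for `u` of degree `k`. -/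
def mu (β : Bundle B) {k l : ℤ} (u : Cross B C k) (v : Cross B C l) : Fam C := fun p q =>
  sgn (k * q) • (StarDual.map (v ⟨(q, l - q), add_sub_cancel _ _⟩) ∘ₗ
    β.β (k - p) (l - q) ∘ₗ u ⟨(p, k - p), add_sub_cancel _ _⟩)

theorem mu_apply (β : Bundle B) {k l : ℤ} (u : Cross B C k) (v : Cross B C l) (p q i j : ℤ)
    (hi : p + i = k) (hj : q + j = l) (x : Co C p) (y : Co C q) :
    mu β u v p q x y = sgn (k * q) • β.β i j (u ⟨(p, i), hi⟩ x) (v ⟨(q, j), hj⟩ y) := by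
  obtain rfl : i = k - p := by omega
  obtain rfl : j = l - q := by omega
  rfl

theorem crossD_apply {n m : ℤ} (h : m + 1 = n) (f : Cross B C n) (p i : ℤ) (hpi : p + i = m)
    (x : Co C p) :
    crossD h f ⟨(p, i), hpi⟩ x = f ⟨(p + 1, i), by omega⟩ (dDual C p (p + 1) x) +
      sgn p • (B.d (i + 1) i).hom (f ⟨(p, i + 1), by omega⟩ x) := rfl

theorem mu_add_left (β : Bundle B) {k l : ℤ} (u u' : Cross B C k) (v : Cross B C l) :
    mu β (u + u') v = mu β u v + mu β u' v := by
  apply Fam.ext'; intro p q x y; simp [mu]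

theorem mu_add_right (β : Bundle B) {k l : ℤ} (u : Cross B C k) (v v' : Cross B C l) :
    mu β u (v + v') = mu β u v + mu β u v' := by
  apply Fam.ext'; intro p q x y; simp [mu]

theorem mu_neg_left (β : Bundle B) {k l : ℤ} (u : Cross B C k) (v : Cross B C l) :
    mu β (-u) v = -mu β u v := by
  apply Fam.ext'; intro p q x y; simp [mu]

theorem mu_neg_right (β : Bundle B) {k l : ℤ} (u : Cross B C k) (v : Cross B C l) :
    mu β u (-v) = -mu β u v := by
  apply Fam.ext'; intro p q x y; simp [mu]

theorem mu_sub_left (β : Bundle B) {k l : ℤ} (u u' : Cross B C k) (v : Cross B C l) :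
    mu β (u - u') v = mu β u v - mu β u' v := by
  rw [sub_eq_add_neg, mu_add_left, mu_neg_left, sub_eq_add_neg]

theorem mu_sub_right (β : Bundle B) {k l : ℤ} (u : Cross B C k) (v v' : Cross B C l) :
    mu β u (v - v') = mu β u v - mu β u v' := by
  rw [sub_eq_add_neg, mu_add_right, mu_neg_right, sub_eq_add_neg]

@[simp] theorem mu_zero_left (β : Bundle B) {k l : ℤ} (v : Cross B C l) :
    mu β (0 : Cross B C k) v = 0 := by
  apply Fam.ext'; intro p q x y; simp [mu]

@[simp] theorem mu_zero_right (β : Bundle B) {k l : ℤ} (u : Cross B C k) :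
    mu β u (0 : Cross B C l) = 0 := by
  apply Fam.ext'; intro p q x y; simp [mu]

theorem opE_mu (β : Bundle B) {k l k' l' : ℤ} (hk : k' + 1 = k) (hl : l' + 1 = l)
    (u : Cross B C k) (v : Cross B C l) :
    opE (mu β u v) = mu β (crossD hk u) v + sgn k • mu β u (crossD hl v) +
      sgn (k + l + k * l) • transT (mu β v u) := by
  subst hk hl
  apply Fam.ext'
  intro p q x y
  obtain ⟨i, rfl⟩ : ∃ i, k' = p + i := ⟨k' - p, by ring⟩
  obtain ⟨j, rfl⟩ : ∃ j, l' = q + j := ⟨l' - q, by ring⟩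
  simp only [opE_apply, Pi.add_apply, Pi.smul_apply, LinearMap.add_apply, LinearMap.smul_apply,
    StarDual.add_apply, StarDual.zsmul_apply, transT_apply]
  rw [mu_apply β u v p (q + 1) (i + 1) j (by ring) (by ring),
    mu_apply β u v (p + 1) q i (j + 1) (by ring) (by ring),
    mu_apply β u v p q (i + 1) (j + 1) (by ring) (by ring),
    mu_apply β _ v p q i (j + 1) (by ring) (by ring),
    mu_apply β u _ p q (i + 1) j (by ring) (by ring),
    mu_apply β v u q p (j + 1) (i + 1) (by ring) (by ring), crossD_apply, crossD_apply]
  have h := β.cycle' (i := i + 1) (j := j + 1) rfl rfl (u ⟨(p, i + 1), by ring⟩ x)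
    (v ⟨(q, j + 1), by ring⟩ y)
  have h' := congrArg (fun z => sgn ((i + 1) * (j + 1)) • z) h
  simp only [smul_smul, sgn_mul_self, one_smul] at h'
  rw [star_zsmul, h']
  simp only [map_add, map_zsmul, StarDual.add_apply, StarDual.zsmul_apply, smul_add, smul_sub,
    smul_smul]
  generalize β.β (i + 1) j _ _ = b1
  generalize β.β (i + 1) j _ _ = b2
  generalize β.β i (j + 1) _ _ = b3
  generalize β.β i (j + 1) _ _ = b4
  generalize β.β (i + 1) (j + 1) _ _ = b5
  simp only [sgn_eq_ite, Int.even_add, Int.even_mul]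
  by_cases h1 : Even p <;> by_cases h2 : Even q <;> by_cases h3 : Even i <;>
    by_cases h4 : Even j <;> simp [h1, h2, h3, h4] <;> abel

/-- `f̂^%(S^n β)` for `f : B^{n-*} → C`: the family `(f β_{s-n} f^*)_s`, up to sign. -/
def pull (β : Bundle B) {n : ℤ} (f : Cross B C n) : Fam C := mu β f f

/-- `(g; f, f')^%(S^n β)` for a chain homotopy `g : f ≃ f' : B^{n-*} → C`. -/
def pullHtpy (β : Bundle B) {n : ℤ} (g : Cross B C (n + 1)) (f f' : Cross B C n) : Fam C :=
  sgn n • mu β f g + mu β g f' + transT (mu β g g)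

/-- `[f, f'](S^n β)`, a chain with boundary `f̂^%(S^n β) + f̂'^%(S^n β) - (f + f')^%(S^n β)`. -/
def pullSum (β : Bundle B) {n : ℤ} (f f' : Cross B C n) : Fam C :=
  -(sgn n • transT (mu β f' f))

theorem tateD_pull (β : Bundle B) {n m : ℤ} (h : m + 1 = n) (f : Cross B C n)
    (hf : crossD h f = 0) : tateD n (pull β f) = 0 := by
  rw [tateD_eq, pull, opE_mu β h h, hf]
  have : sgn (n + n + n * n) = sgn n := by
    simp only [sgn_eq_ite, Int.even_add, Int.even_mul]; simp
  rw [this]; simp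

theorem tateD_pullHtpy (β : Bundle B) {n m : ℤ} (h : m + 1 = n) (g : Cross B C (n + 1))
    (f f' : Cross B C n) (hf : crossD h f = 0) (hf' : crossD h f' = 0)
    (hg : crossD rfl g = f' - f) :
    tateD (n + 1) (pullHtpy β g f f') = pull β f' - pull β f := by
  have e1 : sgn (n + (n + 1) + n * (n + 1)) = -1 := by
    simp only [sgn_eq_ite, Int.even_add, Int.even_mul]; by_cases h : Even n <;> simp [h]
  have e2 : sgn (n + 1 + n + (n + 1) * n) = -1 := by
    simp only [sgn_eq_ite, Int.even_add, Int.even_mul]; by_cases h : Even n <;> simp [h]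
  have e3 : sgn (n + 1 + (n + 1) + (n + 1) * (n + 1)) = - sgn n := by
    simp only [sgn_eq_ite, Int.even_add, Int.even_mul]; by_cases h : Even n <;> simp [h]
  simp only [tateD_eq, pullHtpy, pull, map_add, map_zsmul, ← transT_opE, opE_mu β h (rfl : n + 1 = n + 1),
    opE_mu β (rfl : n + 1 = n + 1) h, opE_mu β (rfl : n + 1 = n + 1) (rfl : n + 1 = n + 1), hf, hf',
    hg, e1, e2, e3, mu_zero_left, mu_zero_right, transT_transT, mu_sub_left, mu_sub_right, sgn_add_one,
    map_sub]
  rcases sgn_cases n with hn | hn <;> simp [hn] <;> abel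

theorem tateD_pullSum (β : Bundle B) {n m : ℤ} (h : m + 1 = n) (f f' : Cross B C n)
    (hf : crossD h f = 0) (hf' : crossD h f' = 0) :
    tateD (n + 1) (pullSum β f f') = pull β f + pull β f' - pull β (f + f') := by
  have e : sgn (n + n + n * n) = sgn n := by
    simp only [sgn_eq_ite, Int.even_add, Int.even_mul]; simp
  simp only [tateD_eq, pullSum, pull, map_neg, map_zsmul, ← transT_opE, opE_mu β h h, hf, hf', e,
    mu_zero_left, mu_zero_right, transT_transT, mu_add_left, mu_add_right, sgn_add_one, smul_zero,
    zero_add]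
  rcases sgn_cases n with hn | hn <;> simp [hn] <;> abel

theorem crossD_crossD {n m k : ℤ} (h : m + 1 = n) (h' : k + 1 = m) (f : Cross B C n) :
    crossD h' (crossD h f) = 0 := by
  funext ⟨⟨p, i⟩, hpi⟩
  ext x
  refine (crossD_apply h' _ p i hpi x).trans ?_
  rw [crossD_apply h f (p + 1) i (by dsimp only at hpi; omega),
    crossD_apply h f p (i + 1) (by dsimp only at hpi; omega)]
  simp only [dDual_dDual, map_zero, zero_add, map_add, map_zsmul, d_d, smul_zero,
    add_zero, sgn_add_one, neg_smul]
  simp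

end Bundles

section Structures0

variable {A : Type u} [Ring A] [StarRing A]

variable {B C : ChainComplex (ModuleCat.{u} A) ℤ}

theorem pullHtpy_zero (β : Bundle B) {n : ℤ} (f f' : Cross B C n) :
    pullHtpy β 0 f f' = 0 := by
  simp [pullHtpy]

theorem tateD_mu (β : Bundle B) {n : ℤ} (g g' : Cross B C (n + 1)) :
    tateD (n + 2) (mu β g g') = mu β (crossD rfl g) g' - sgn n • mu β g (crossD rfl g') -
      sgn n • transT (mu β g' g) - sgn n • transT (mu β g g') := by
  have e3 : sgn (n + 1 + (n + 1) + (n + 1) * (n + 1)) = - sgn n := by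
    simp only [sgn_eq_ite, Int.even_add, Int.even_mul]; by_cases h : Even n <;> simp [h]
  rw [tateD_eq, opE_mu β (rfl : n + 1 = n + 1) (rfl : n + 1 = n + 1), e3, sgn_add_two, sgn_add_one,
    neg_smul, neg_smul]
  abel

theorem pullHtpy_trans (β : Bundle B) {n : ℤ} (g g' : Cross B C (n + 1)) (f f' f'' : Cross B C n)
    (hg : crossD rfl g = f' - f) (hg' : crossD rfl g' = f'' - f') :
    pullHtpy β (g + g') f f'' = pullHtpy β g f f' + pullHtpy β g' f' f'' +
      tateD (n + 2) (-(sgn n • mu β g g')) := by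
  rw [map_neg, map_zsmul, tateD_mu, hg, hg']
  simp only [pullHtpy, mu_add_left, mu_add_right, mu_sub_left, mu_sub_right, map_add]
  rcases sgn_cases n with h | h <;> simp [h] <;> abel

theorem pullHtpy_add (β : Bundle B) {n m : ℤ} (h : m + 1 = n) (g g' : Cross B C (n + 1))
    (f f' k k' : Cross B C n)
    (hf : crossD h f = 0) (hk' : crossD h k' = 0)
    (hg : crossD rfl g = f' - f) (hg' : crossD rfl g' = k' - k) :
    pullHtpy β g f f' + pullHtpy β g' k k' - pullHtpy β (g + g') (f + k) (f' + k') -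
      pullSum β f' k' + pullSum β f k =
    tateD (n + 2) (transT (mu β k' g) + sgn n • transT (mu β g' f) + sgn n • mu β g' g) := by
  have e1 : sgn (n + (n + 1) + n * (n + 1)) = -1 := by
    simp only [sgn_eq_ite, Int.even_add, Int.even_mul]; by_cases h : Even n <;> simp [h]
  have e2 : sgn (n + 1 + n + (n + 1) * n) = -1 := by
    simp only [sgn_eq_ite, Int.even_add, Int.even_mul]; by_cases h : Even n <;> simp [h]
  have a1 : tateD (n + 2) (transT (mu β k' g)) = sgn n • transT (mu β k' (f' - f)) -
      mu β g k' - sgn n • mu β k' g := by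
    rw [tateD_eq, ← transT_opE, opE_mu β h (rfl : n + 1 = n + 1), hk', e1, hg, sgn_add_two]
    simp only [mu_zero_left, zero_add, map_add, map_neg, map_zsmul, transT_transT, neg_smul,
      one_smul]
    abel
  have a2 : tateD (n + 2) (transT (mu β g' f)) = transT (mu β (k' - k) f) -
      mu β f g' - sgn n • mu β g' f := by
    rw [tateD_eq, ← transT_opE, opE_mu β (rfl : n + 1 = n + 1) h, hf, e2, hg', sgn_add_two]
    simp only [mu_zero_right, smul_zero, add_zero, map_add, map_neg, transT_transT, neg_smul,
      one_smul]
    abel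
  rw [map_add, map_add, map_zsmul, map_zsmul, tateD_mu, a1, a2, hg, hg']
  simp only [pullHtpy, pullSum, mu_add_left, mu_add_right, mu_sub_left, mu_sub_right, map_add,
    map_sub]
  rcases sgn_cases n with h | h <;> simp [h] <;> abel

theorem pullSum_comm (β : Bundle B) {n m : ℤ} (h : m + 1 = n) (f k : Cross B C n)
    (hf : crossD h f = 0) (hk : crossD h k = 0) :
    pullSum β f k - pullSum β k f = tateD (n + 2) (-mu β f k) := by
  have e : sgn (n + n + n * n) = sgn n := by
    simp only [sgn_eq_ite, Int.even_add, Int.even_mul]; simp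
  rw [map_neg, tateD_eq, opE_mu β h h, hf, hk, e, sgn_add_two]
  simp only [pullSum, mu_zero_left, mu_zero_right, smul_zero]
  abel

theorem pullSum_add_left (β : Bundle B) {n : ℤ} (f f' k : Cross B C n) :
    pullSum β (f + f') k = pullSum β f k + pullSum β f' k := by
  simp [pullSum, mu_add_right]; abel

theorem pullSum_add_right (β : Bundle B) {n : ℤ} (f k k' : Cross B C n) :
    pullSum β f (k + k') = pullSum β f k + pullSum β f k' := by
  simp [pullSum, mu_add_left]; abel

theorem pullSum_neg_left (β : Bundle B) {n : ℤ} (f k : Cross B C n) :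
    pullSum β (-f) k = -pullSum β f k := by
  simp [pullSum, mu_neg_right]

@[simp] theorem pullSum_zero_left (β : Bundle B) {n : ℤ} (k : Cross B C n) :
    pullSum β 0 k = 0 := by
  simp [pullSum]

@[simp] theorem pullSum_zero_right (β : Bundle B) {n : ℤ} (k : Cross B C n) :
    pullSum β k 0 = 0 := by
  simp [pullSum]

/-! ### The groups `Q^n(C)`, `Q_n(C)`, `Q̂^n(C)` and `H_n(B^t ⊗_A C)` -/

section Groups

variable (B C) (n : ℤ)

/-- The homology group `Z / (Z ∩ D)` of cycles modulo boundaries. -/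
abbrev SubQuot {G : Type*} [AddCommGroup G] (Z D : AddSubgroup G) : Type _ :=
  Z ⧸ D.addSubgroupOf Z

instance {G : Type*} [AddCommGroup G] (Z D : AddSubgroup G) : AddCommGroup (SubQuot Z D) :=
  QuotientAddGroup.Quotient.addCommGroup _

/-- The homology class of a cycle. -/
def SubQuot.mk {G : Type*} [AddCommGroup G] {Z : AddSubgroup G} (D : AddSubgroup G) (z : G)
    (hz : z ∈ Z) : SubQuot Z D := QuotientAddGroup.mk ⟨z, hz⟩

/-- The morphism of homology groups induced by a morphism of chain groups. -/
def SubQuot.map {G G' : Type*} [AddCommGroup G] [AddCommGroup G'] {Z D : AddSubgroup G}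
    {Z' D' : AddSubgroup G'} (f : G →+ G') (hZ : ∀ z ∈ Z, f z ∈ Z') (hD : ∀ z ∈ D, f z ∈ D') :
    SubQuot Z D →+ SubQuot Z' D' :=
  QuotientAddGroup.map _ _ ((f.comp Z.subtype).codRestrict Z' fun z => hZ z z.2)
    fun z hz => hD z hz

theorem SubQuot.map_mk {G G' : Type*} [AddCommGroup G] [AddCommGroup G'] {Z D : AddSubgroup G}
    {Z' D' : AddSubgroup G'} (f : G →+ G') (hZ : ∀ z ∈ Z, f z ∈ Z') (hD : ∀ z ∈ D, f z ∈ D')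
    (z : G) (hz : z ∈ Z) : SubQuot.map f hZ hD (SubQuot.mk D z hz) = SubQuot.mk D' (f z) (hZ z hz) :=
  rfl

theorem SubQuot.mk_eq_mk {G : Type*} [AddCommGroup G] {Z D : AddSubgroup G} {z z' : G}
    {hz : z ∈ Z} {hz' : z' ∈ Z} : SubQuot.mk D z hz = SubQuot.mk D z' hz' ↔ z' - z ∈ D := by
  unfold SubQuot.mk
  rw [QuotientAddGroup.eq, AddSubgroup.mem_addSubgroupOf]
  simp [add_comm, sub_eq_add_neg]

theorem SubQuot.mk_surj {G : Type*} [AddCommGroup G] {Z D : AddSubgroup G} (a : SubQuot Z D) :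
    ∃ z hz, a = SubQuot.mk D z hz := by
  obtain ⟨⟨z, hz⟩, rfl⟩ := QuotientAddGroup.mk_surjective a
  exact ⟨z, hz, rfl⟩

/-- Cycles of `(Ŵ^%C)_n`: `n`-dimensional hyperquadratic structures on `C`. -/
def tateCycles : AddSubgroup (Fam C) := (tateD n).ker

/-- Boundaries in `(Ŵ^%C)_n`. -/
def tateBoundaries : AddSubgroup (Fam C) := (tateD (n + 1)).range

/-- `(W^%C)_n ⊆ (Ŵ^%C)_n` (the inclusion is `J`): chains `φ` with `φ_s = 0` for `s < 0`, where `φ_s`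
consists of the components with `p + q = n + s`. -/
def symChains : AddSubgroup (Fam C) where
  carrier := {φ | ∀ p q, p + q < n → φ p q = 0}
  zero_mem' := fun _ _ _ => rfl
  add_mem' := fun ha hb p q h => by simp [ha p q h, hb p q h]
  neg_mem' := fun ha p q h => by simp [ha p q h]

/-- Cycles of `(W^%C)_n`: `n`-dimensional symmetric structures on `C`. -/
def symCycles : AddSubgroup (Fam C) := symChains C n ⊓ (tateD n).ker

/-- Boundaries in `(W^%C)_n`. -/
def symBoundaries : AddSubgroup (Fam C) := (symChains C (n + 1)).map (tateD (n + 1))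

/-- `(W_%C)_n`: chains `{ψ_s | s ≥ 0}`, where `ψ_s ∈ (C^t ⊗_A C)_{n-s}` consists of the components
with `p + q = n - s`. -/
def quadChains : AddSubgroup (Fam C) where
  carrier := {ψ | ∀ p q, n < p + q → ψ p q = 0}
  zero_mem' := fun _ _ _ => rfl
  add_mem' := fun ha hb p q h => by simp [ha p q h, hb p q h]
  neg_mem' := fun ha p q h => by simp [ha p q h]

variable {C}

/-- Truncation to the components with `p + q ≤ k`. -/
def trunc (k : ℤ) : Fam C →+ Fam C where
  toFun θ p q := if p + q ≤ k then θ p q else 0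
  map_zero' := by funext p q; simp
  map_add' θ θ' := by
    funext p q
    simp only [Pi.add_apply]
    split_ifs <;> simp

/-- The differential `(W_%C)_n → (W_%C)_{n-1}`,
`(dψ)_s = d(ψ_s) + (-1)^{n-s-1}(ψ_{s+1} + (-1)^{s+1} T ψ_{s+1})` for `s ≥ 0`, at the component
`p + q = n - 1 - s`. -/
def quadD : Fam C →+ Fam C where
  toFun ψ p q := if p + q ≤ n - 1 then
    tensorD ψ p q + sgn (p + q) • (ψ p q + sgn (n - p - q) • transT ψ p q) else 0
  map_zero' := by funext p q; simp
  map_add' θ θ' := by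
    funext p q
    simp only [Pi.add_apply]
    split_ifs
    · simp only [map_add, Pi.add_apply, smul_add]; abel
    · simp

variable (C)

/-- Cycles of `(W_%C)_n`: `n`-dimensional quadratic structures on `C`. -/
def quadCycles : AddSubgroup (Fam C) := quadChains C n ⊓ (quadD n).ker

/-- Boundaries in `(W_%C)_n`. -/
def quadBoundaries : AddSubgroup (Fam C) := (quadChains C (n + 1)).map (quadD (n + 1))

/-- Cycles of `(B^t ⊗_A C)_n`, that is (duals of) chain maps `f : B^{n-*} → C`. -/
def crossCycles : AddSubgroup (Cross B C n) := (crossD (sub_add_cancel n 1)).ker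

/-- Boundaries in `(B^t ⊗_A C)_n`. -/
def crossBoundaries : AddSubgroup (Cross B C n) := (crossD (rfl : n + 1 = n + 1)).range

/-- The hyperquadratic structure group `Q̂^n(C)`. -/
abbrev QTate : Type u := SubQuot (tateCycles C n) (tateBoundaries C n)

/-- The symmetric structure group `Q^n(C)`. -/
abbrev QSym : Type u := SubQuot (symCycles C n) (symBoundaries C n)

/-- The quadratic structure group `Q_n(C)`. -/
abbrev QQuad : Type u := SubQuot (quadCycles C n) (quadBoundaries C n)

/-- The homology group `H_n(B^t ⊗_A C)`. -/
abbrev HCross : Type u := SubQuot (crossCycles B C n) (crossBoundaries B C n)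

end Groups

/-! ### The symmetric `(B, β)`-structure groups -/

section Structures

/-- An `n`-dimensional symmetric `(B, β)`-structure `(φ, θ, f)` on `C`: a symmetric structure `φ`,
a chain `θ ∈ (Ŵ^%C)_{n+1}` and a chain map `f : B^{n-*} → C` with `J(φ) - f̂^%(S^n β) = dθ`. -/
@[ext] structure BStr (β : Bundle B) (C : ChainComplex (ModuleCat.{u} A) ℤ) (n : ℤ) where
  φ : Fam C
  θ : Fam C
  f : Cross B C n
  hφ : φ ∈ symCycles C n
  hf : f ∈ crossCycles B C n
  hθ : φ - pull β f = tateD (n + 1) θ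

variable {β : Bundle B} {n : ℤ}

namespace BStr

/-- An equivalence `(ξ, η, g) : (φ, θ, f) → (φ', θ', f')` exists. -/
def Rel (a b : BStr β C n) : Prop :=
  ∃ (ξ η : Fam C) (g : Cross B C (n + 1)), ξ ∈ symChains C (n + 1) ∧
    b.φ - a.φ = tateD (n + 1) ξ ∧ crossD rfl g = b.f - a.f ∧
    ξ - pullHtpy β g a.f b.f - b.θ + a.θ = tateD (n + 2) η

theorem Rel.refl (a : BStr β C n) : a.Rel a :=
  ⟨0, 0, 0, zero_mem _, by simp, by simp, by simp [pullHtpy_zero]⟩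

theorem Rel.symm {a b : BStr β C n} (h : a.Rel b) : b.Rel a := by
  obtain ⟨ξ, η, g, hξ, h1, h2, h3⟩ := h
  have h2' : crossD rfl (-g) = a.f - b.f := by rw [map_neg, h2]; abel
  have ht := pullHtpy_trans β g (-g) a.f b.f a.f h2 h2'
  rw [add_neg_cancel, pullHtpy_zero] at ht
  refine ⟨-ξ, -η + -(sgn n • mu β g (-g)), -g, neg_mem hξ, by rw [map_neg, ← h1]; abel, h2', ?_⟩
  rw [map_add, map_neg _ η, ← h3]
  have : pullHtpy β (-g) b.f a.f = -pullHtpy β g a.f b.f -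
      tateD (n + 2) (-(sgn n • mu β g (-g))) := by
    rw [eq_comm, ← sub_eq_zero, ← neg_eq_zero, ht]; abel
  rw [this]; abel

theorem Rel.trans {a b c : BStr β C n} (h : a.Rel b) (h' : b.Rel c) : a.Rel c := by
  obtain ⟨ξ, η, g, hξ, h1, h2, h3⟩ := h
  obtain ⟨ξ', η', g', hξ', h1', h2', h3'⟩ := h'
  refine ⟨ξ + ξ', η + η' - -(sgn n • mu β g g'), g + g', add_mem hξ hξ',
    by rw [map_add, ← h1, ← h1']; abel, by rw [map_add, h2, h2']; abel, ?_⟩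
  rw [pullHtpy_trans β g g' a.f b.f c.f h2 h2', map_sub, map_add, ← h3, ← h3']
  abel

instance : Setoid (BStr β C n) := ⟨Rel, Rel.refl, Rel.symm, Rel.trans⟩

instance : Zero (BStr β C n) where
  zero :=
    { φ := 0, θ := 0, f := 0, hφ := zero_mem _, hf := zero_mem _, hθ := by simp [pull] }

/-- `(φ, θ, f) + (φ', θ', f') = (φ + φ', θ + θ' + [f, f'](S^n β), f + f')`. -/
instance : Add (BStr β C n) where
  add a b :=
    { φ := a.φ + b.φ, θ := a.θ + b.θ + pullSum β a.f b.f, f := a.f + b.f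
      hφ := add_mem a.hφ b.hφ, hf := add_mem a.hf b.hf
      hθ := by
        rw [map_add, map_add, tateD_pullSum β _ a.f b.f a.hf b.hf, ← a.hθ, ← b.hθ]; abel }

instance : Neg (BStr β C n) where
  neg a :=
    { φ := -a.φ, θ := -a.θ + pullSum β a.f a.f, f := -a.f
      hφ := neg_mem a.hφ, hf := neg_mem a.hf
      hθ := by
        have h := tateD_pullSum β _ a.f (-a.f) a.hf (neg_mem a.hf)
        have e : pullSum β a.f (-a.f) = -pullSum β a.f a.f := by
          simp [pullSum, mu_neg_left]
        have e' : pull β (-a.f) = pull β a.f := by simp [pull, mu_neg_left, mu_neg_right]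
        have e0 : pull β (0 : Cross B C n) = 0 := by simp [pull]
        rw [e, add_neg_cancel, e', e0, sub_zero, map_neg] at h
        rw [map_add, map_neg, ← a.hθ, ← neg_neg (tateD (n + 1) (pullSum β a.f a.f)), h, e']
        abel }

theorem add_φ (a b : BStr β C n) : (a + b).φ = a.φ + b.φ := rfl
theorem add_θ (a b : BStr β C n) : (a + b).θ = a.θ + b.θ + pullSum β a.f b.f := rfl
theorem add_f (a b : BStr β C n) : (a + b).f = a.f + b.f := rfl
theorem neg_φ (a : BStr β C n) : (-a).φ = -a.φ := rfl
theorem neg_θ (a : BStr β C n) : (-a).θ = -a.θ + pullSum β a.f a.f := rfl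
theorem neg_f (a : BStr β C n) : (-a).f = -a.f := rfl
theorem zero_φ : (0 : BStr β C n).φ = 0 := rfl
theorem zero_θ : (0 : BStr β C n).θ = 0 := rfl
theorem zero_f : (0 : BStr β C n).f = 0 := rfl

theorem Rel.add {a b a' b' : BStr β C n} (h : a.Rel b) (h' : a'.Rel b') :
    (a + a').Rel (b + b') := by
  obtain ⟨ξ, η, g, hξ, h1, h2, h3⟩ := h
  obtain ⟨ξ', η', g', hξ', h1', h2', h3'⟩ := h'
  have h4 := pullHtpy_add β (sub_add_cancel n 1) g g' a.f b.f a'.f b'.f a.hf b'.hf h2 h2'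
  refine ⟨ξ + ξ', η + η' + (transT (mu β b'.f g) + sgn n • transT (mu β g' a.f) + sgn n • mu β g' g),
    g + g', add_mem hξ hξ', by rw [map_add, ← h1, ← h1', add_φ, add_φ]; abel,
    by rw [map_add, h2, h2', add_f, add_f]; abel, ?_⟩
  rw [map_add, ← h4, map_add, ← h3, ← h3', add_θ, add_θ, add_f, add_f]
  abel

theorem add_assoc' (x y z : BStr β C n) : x + y + z = x + (y + z) := by
  refine BStr.ext (add_assoc _ _ _) ?_ (add_assoc _ _ _)
  simp only [add_θ, add_f, pullSum_add_left, pullSum_add_right]; abel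

theorem zero_add' (x : BStr β C n) : 0 + x = x := by
  refine BStr.ext (zero_add _) ?_ (zero_add _)
  simp [add_θ, zero_f, zero_θ]

theorem add_zero' (x : BStr β C n) : x + 0 = x := by
  refine BStr.ext (add_zero _) ?_ (add_zero _)
  simp [add_θ, zero_f, zero_θ]

theorem neg_add' (x : BStr β C n) : -x + x = 0 := by
  refine BStr.ext (neg_add_cancel _) ?_ (neg_add_cancel _)
  simp only [add_θ, neg_f, neg_θ, zero_θ, pullSum_neg_left]; abel

theorem add_neg' (x : BStr β C n) : x + -x = 0 := by
  refine BStr.ext (add_neg_cancel _) ?_ (add_neg_cancel _)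
  have e : pullSum β x.f (-x.f) = -pullSum β x.f x.f := by simp [pullSum, mu_neg_left]
  simp only [add_θ, neg_f, neg_θ, zero_θ, e]; abel

theorem Rel.neg {a b : BStr β C n} (h : a.Rel b) : (-a).Rel (-b) := by
  have h1 : (-a + b + -b).Rel (-a + a + -b) :=
    ((Rel.refl (-a)).add h.symm).add (Rel.refl (-b))
  rwa [add_assoc', add_neg', add_zero', neg_add', zero_add'] at h1

end BStr

/-- The `n`-dimensional symmetric `(B, β)`-structure group `Q⟨B, β⟩^n(C)`. -/
def QB (β : Bundle B) (C : ChainComplex (ModuleCat.{u} A) ℤ) (n : ℤ) : Type u :=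
  Quotient (inferInstance : Setoid (BStr β C n))

/-- The equivalence class of a symmetric `(B, β)`-structure. -/
def QB.mk (a : BStr β C n) : QB β C n := Quotient.mk _ a

theorem QB.mk_eq_mk {a b : BStr β C n} : QB.mk a = QB.mk b ↔ a.Rel b := Quotient.eq

theorem QB.mk_surj (x : QB β C n) : ∃ a, QB.mk a = x := Quotient.exists_rep x

namespace QB

instance : Add (QB β C n) := ⟨Quotient.map₂ (· + ·) fun _ _ h _ _ h' => BStr.Rel.add h h'⟩

instance : Zero (QB β C n) := ⟨mk 0⟩

instance : Neg (QB β C n) := ⟨Quotient.map (- ·) fun _ _ h => BStr.Rel.neg h⟩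

instance : AddCommGroup (QB β C n) where
  add_assoc := by rintro ⟨x⟩ ⟨y⟩ ⟨z⟩; exact congrArg mk (BStr.add_assoc' x y z)
  zero_add := by rintro ⟨x⟩; exact congrArg mk (BStr.zero_add' x)
  add_zero := by rintro ⟨x⟩; exact congrArg mk (BStr.add_zero' x)
  neg_add_cancel := by rintro ⟨x⟩; exact congrArg mk (BStr.neg_add' x)
  add_comm := by
    rintro ⟨x⟩ ⟨y⟩
    refine Quotient.sound ⟨0, -mu β x.f y.f, 0, zero_mem _, ?_, ?_, ?_⟩
    · simp [BStr.add_φ, add_comm]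
    · simp [BStr.add_f, add_comm]
    · rw [← pullSum_comm β (sub_add_cancel n 1) x.f y.f x.hf y.hf, pullHtpy_zero]
      simp only [BStr.add_θ]; abel
  nsmul := nsmulRec
  zsmul := zsmulRec

theorem mk_add (a b : BStr β C n) : mk (a + b) = mk a + mk b := rfl

theorem mk_zero : mk (0 : BStr β C n) = 0 := rfl

end QB

/-- A symmetric `(B, β)`-structure `(0, θ, f)` with `φ = 0`. -/
@[ext] structure PStr (β : Bundle B) (C : ChainComplex (ModuleCat.{u} A) ℤ) (n : ℤ) where
  θ : Fam C
  f : Cross B C n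
  hf : f ∈ crossCycles B C n
  hθ : 0 - pull β f = tateD (n + 1) θ

namespace PStr

/-- The symmetric `(B, β)`-structure `(0, θ, f)`. -/
def toBStr (a : PStr β C n) : BStr β C n := ⟨0, a.θ, a.f, zero_mem _, a.hf, a.hθ⟩

/-- An equivalence `(0, η, g) : (0, θ, f) → (0, θ', f')` exists. -/
def Rel (a b : PStr β C n) : Prop :=
  ∃ (η : Fam C) (g : Cross B C (n + 1)), crossD rfl g = b.f - a.f ∧
    0 - pullHtpy β g a.f b.f - b.θ + a.θ = tateD (n + 2) η

theorem Rel.refl (a : PStr β C n) : a.Rel a := ⟨0, 0, by simp, by simp [pullHtpy_zero]⟩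

theorem Rel.symm {a b : PStr β C n} (h : a.Rel b) : b.Rel a := by
  obtain ⟨η, g, h2, h3⟩ := h
  have h2' : crossD rfl (-g) = a.f - b.f := by rw [map_neg, h2]; abel
  have ht := pullHtpy_trans β g (-g) a.f b.f a.f h2 h2'
  rw [add_neg_cancel, pullHtpy_zero] at ht
  refine ⟨-η + -(sgn n • mu β g (-g)), -g, h2', ?_⟩
  rw [map_add, map_neg _ η, ← h3]
  have : pullHtpy β (-g) b.f a.f = -pullHtpy β g a.f b.f -
      tateD (n + 2) (-(sgn n • mu β g (-g))) := by
    rw [eq_comm, ← sub_eq_zero, ← neg_eq_zero, ht]; abel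
  rw [this]; abel

theorem Rel.trans {a b c : PStr β C n} (h : a.Rel b) (h' : b.Rel c) : a.Rel c := by
  obtain ⟨η, g, h2, h3⟩ := h
  obtain ⟨η', g', h2', h3'⟩ := h'
  refine ⟨η + η' - -(sgn n • mu β g g'), g + g', by rw [map_add, h2, h2']; abel, ?_⟩
  rw [pullHtpy_trans β g g' a.f b.f c.f h2 h2', map_sub, map_add, ← h3, ← h3']
  abel

instance : Setoid (PStr β C n) := ⟨Rel, Rel.refl, Rel.symm, Rel.trans⟩

instance : Zero (PStr β C n) where
  zero := { θ := 0, f := 0, hf := zero_mem _, hθ := by simp [pull] }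

/-- `(θ, f) + (θ', f') = (θ + θ' + [f, f'](S^n β), f + f')`. -/
instance : Add (PStr β C n) where
  add a b :=
    { θ := a.θ + b.θ + pullSum β a.f b.f, f := a.f + b.f
      hf := add_mem a.hf b.hf
      hθ := by
        have h := (a.toBStr + b.toBStr).hθ
        simpa only [BStr.add_φ, BStr.add_θ, BStr.add_f, toBStr, add_zero] using h }

instance : Neg (PStr β C n) where
  neg a :=
    { θ := -a.θ + pullSum β a.f a.f, f := -a.f
      hf := neg_mem a.hf
      hθ := by
        have h := (-a.toBStr).hθ
        simpa only [BStr.neg_φ, BStr.neg_θ, BStr.neg_f, toBStr, neg_zero] using h }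

theorem add_θ (a b : PStr β C n) : (a + b).θ = a.θ + b.θ + pullSum β a.f b.f := rfl
theorem add_f (a b : PStr β C n) : (a + b).f = a.f + b.f := rfl
theorem neg_θ (a : PStr β C n) : (-a).θ = -a.θ + pullSum β a.f a.f := rfl
theorem neg_f (a : PStr β C n) : (-a).f = -a.f := rfl
theorem zero_θ : (0 : PStr β C n).θ = 0 := rfl
theorem zero_f : (0 : PStr β C n).f = 0 := rfl

theorem Rel.add {a b a' b' : PStr β C n} (h : a.Rel b) (h' : a'.Rel b') :
    (a + a').Rel (b + b') := by
  obtain ⟨η, g, h2, h3⟩ := h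
  obtain ⟨η', g', h2', h3'⟩ := h'
  have h4 := pullHtpy_add β (sub_add_cancel n 1) g g' a.f b.f a'.f b'.f a.hf b'.hf h2 h2'
  refine ⟨η + η' + (transT (mu β b'.f g) + sgn n • transT (mu β g' a.f) + sgn n • mu β g' g),
    g + g', by rw [map_add, h2, h2', add_f, add_f]; abel, ?_⟩
  rw [map_add, ← h4, map_add, ← h3, ← h3', add_θ, add_θ, add_f, add_f]
  abel

theorem add_assoc' (x y z : PStr β C n) : x + y + z = x + (y + z) := by
  refine PStr.ext ?_ (add_assoc _ _ _)
  simp only [add_θ, add_f, pullSum_add_left, pullSum_add_right]; abel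

theorem zero_add' (x : PStr β C n) : 0 + x = x := by
  refine PStr.ext ?_ (zero_add _)
  simp [add_θ, zero_f, zero_θ]

theorem add_zero' (x : PStr β C n) : x + 0 = x := by
  refine PStr.ext ?_ (add_zero _)
  simp [add_θ, zero_f, zero_θ]

theorem neg_add' (x : PStr β C n) : -x + x = 0 := by
  refine PStr.ext ?_ (neg_add_cancel _)
  simp only [add_θ, neg_f, neg_θ, zero_θ, pullSum_neg_left]; abel

theorem add_neg' (x : PStr β C n) : x + -x = 0 := by
  refine PStr.ext ?_ (add_neg_cancel _)
  have e : pullSum β x.f (-x.f) = -pullSum β x.f x.f := by simp [pullSum, mu_neg_left]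
  simp only [add_θ, neg_f, neg_θ, zero_θ, e]; abel

theorem Rel.neg {a b : PStr β C n} (h : a.Rel b) : (-a).Rel (-b) := by
  have h1 : (-a + b + -b).Rel (-a + a + -b) :=
    ((Rel.refl (-a)).add h.symm).add (Rel.refl (-b))
  rwa [add_assoc', add_neg', add_zero', neg_add', zero_add'] at h1

end PStr

/-- The group `P⟨B, β⟩^n(C)`. -/
def PB (β : Bundle B) (C : ChainComplex (ModuleCat.{u} A) ℤ) (n : ℤ) : Type u :=
  Quotient (inferInstance : Setoid (PStr β C n))

/-- The class of `(θ, f)` in `P⟨B, β⟩^n(C)`. -/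
def PB.mk (a : PStr β C n) : PB β C n := Quotient.mk _ a

namespace PB

theorem mk_eq_mk {a b : PStr β C n} : PB.mk a = PB.mk b ↔ a.Rel b := Quotient.eq

theorem mk_surj (x : PB β C n) : ∃ a, PB.mk a = x := Quotient.exists_rep x

instance : Add (PB β C n) := ⟨Quotient.map₂ (· + ·) fun _ _ h _ _ h' => PStr.Rel.add h h'⟩

instance : Zero (PB β C n) := ⟨mk 0⟩

instance : Neg (PB β C n) := ⟨Quotient.map (- ·) fun _ _ h => PStr.Rel.neg h⟩

instance : AddCommGroup (PB β C n) where
  add_assoc := by rintro ⟨x⟩ ⟨y⟩ ⟨z⟩; exact congrArg mk (PStr.add_assoc' x y z)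
  zero_add := by rintro ⟨x⟩; exact congrArg mk (PStr.zero_add' x)
  add_zero := by rintro ⟨x⟩; exact congrArg mk (PStr.add_zero' x)
  neg_add_cancel := by rintro ⟨x⟩; exact congrArg mk (PStr.neg_add' x)
  add_comm := by
    rintro ⟨x⟩ ⟨y⟩
    refine Quotient.sound ⟨-mu β x.f y.f, 0, ?_, ?_⟩
    · simp [PStr.add_f, add_comm]
    · rw [← pullSum_comm β (sub_add_cancel n 1) x.f y.f x.hf y.hf, pullHtpy_zero]
      simp only [PStr.add_θ]; abel
  nsmul := nsmulRec
  zsmul := zsmulRec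

theorem mk_add (a b : PStr β C n) : mk (a + b) = mk a + mk b := rfl

theorem mk_zero : mk (0 : PStr β C n) = 0 := rfl

end PB

end Structures

/-! ### The morphisms of the braid -/

section Morphisms

theorem trunc_apply (k : ℤ) (θ : Fam C) (p q : ℤ) :
    trunc k θ p q = if p + q ≤ k then θ p q else 0 := rfl

theorem quadD_eq (n : ℤ) (ψ : Fam C) : quadD n ψ = trunc (n - 1) (tateD (n + 1) ψ) := by
  funext p q
  have h1 : sgn (n - p - q) = sgn (p + q - (n + 1) + 1) := by
    simp only [sgn_eq_ite, Int.even_add, Int.even_sub]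
    by_cases h1 : Even p <;> by_cases h2 : Even q <;> by_cases h3 : Even n <;> simp [h1, h2, h3]
  change (if p + q ≤ n - 1 then
    tensorD ψ p q + sgn (p + q) • (ψ p q + sgn (n - p - q) • transT ψ p q) else 0) = _
  rw [h1]
  rfl

theorem tateD_congr (n : ℤ) {θ θ' : Fam C} {p q : ℤ} (h0 : θ p q = θ' p q) (h0' : θ q p = θ' q p)
    (h1 : θ p (q + 1) = θ' p (q + 1)) (h2 : θ (p + 1) q = θ' (p + 1) q) :
    tateD n θ p q = tateD n θ' p q := by
  rw [tateD_eq, tateD_eq]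
  ext x y
  change opE θ p q x y - sgn n • transT θ p q x y = opE θ' p q x y - sgn n • transT θ' p q x y
  simp only [opE_apply, transT_apply, h0, h0', h1, h2]

theorem trunc_tateD (k m : ℤ) (θ : Fam C) :
    trunc k (tateD m (trunc (k + 1) θ)) = trunc k (tateD m θ) := by
  funext p q
  rw [trunc_apply, trunc_apply]
  split_ifs with h
  · apply tateD_congr <;> rw [trunc_apply, if_pos (by omega)]
  · rfl

theorem trunc_mem (n : ℤ) (θ : Fam C) : trunc n θ ∈ quadChains C n := fun p q h => by
  rw [trunc_apply, if_neg (by omega)]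

theorem trunc_eq_self {n : ℤ} {ψ : Fam C} (h : ψ ∈ quadChains C n) : trunc n ψ = ψ := by
  funext p q
  rw [trunc_apply]
  split_ifs with hpq
  · rfl
  · exact (h p q (by omega)).symm

theorem quadD_trunc (n : ℤ) (θ : Fam C) : quadD n (trunc n θ) = trunc (n - 1) (tateD (n + 1) θ) := by
  have := trunc_tateD (n - 1) (n + 1) θ
  rw [sub_add_cancel] at this
  rw [quadD_eq, this]

theorem quadD_quadD (n : ℤ) (ψ : Fam C) : quadD n (quadD (n + 1) ψ) = 0 := by
  rw [quadD_eq (n + 1), add_sub_cancel_right, quadD_trunc, tateD_tateD, map_zero]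

theorem sub_trunc_mem (n : ℤ) (θ : Fam C) : θ - trunc n θ ∈ symChains C (n + 1) := fun p q h => by
  change θ p q - trunc n θ p q = 0
  rw [trunc_apply, if_pos (by omega), sub_self]

/-- The chain map `1 + T : (W_%C)_n → (W^%C)_n`, `((1+T)ψ)_0 = ψ_0 + Tψ_0`, `((1+T)ψ)_s = 0` for
`s ≠ 0`. -/
def symmetrizeChain (n : ℤ) : Fam C →+ Fam C where
  toFun ψ p q := if p + q = n then ψ p q + transT ψ p q else 0
  map_zero' := by funext p q; simp
  map_add' ψ ψ' := by
    funext p q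
    simp only [Pi.add_apply, map_add]
    split_ifs
    · abel
    · simp

theorem symmetrizeChain_eq {n : ℤ} {ψ : Fam C} (h : ψ ∈ quadCycles C n) :
    symmetrizeChain n ψ = sgn n • tateD (n + 1) ψ := by
  obtain ⟨h1, h2⟩ := h
  have h2' : quadD n ψ = 0 := h2
  rw [quadD_eq] at h2'
  funext p q
  change (if p + q = n then ψ p q + transT ψ p q else 0) = sgn n • tateD (n + 1) ψ p q
  split_ifs with hpq
  · rw [tateD_eq]
    ext x y
    change ψ p q x y + transT ψ p q x y =
      sgn n • (opE ψ p q x y - sgn (n + 1) • transT ψ p q x y)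
    rw [opE_apply, h1 p (q + 1) (by omega), h1 (p + 1) q (by omega), hpq, sgn_add_one]
    rcases sgn_cases n with h | h <;> simp [h, add_comm]
  · by_cases hlt : p + q ≤ n - 1
    · have := congrFun (congrFun h2' p) q
      rw [trunc_apply, if_pos hlt] at this
      rw [this]; simp
    · have : tateD (n + 1) ψ p q = tateD (n + 1) 0 p q :=
        tateD_congr _ (h1 p q (by omega)) (h1 q p (by omega)) (h1 p (q + 1) (by omega))
          (h1 (p + 1) q (by omega))
      rw [this]; simp

theorem symmetrizeChain_mem {n : ℤ} {ψ : Fam C} (h : ψ ∈ quadCycles C n) :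
    symmetrizeChain n ψ ∈ symCycles C n := by
  refine ⟨fun p q hpq => ?_, ?_⟩
  · change (if p + q = n then ψ p q + transT ψ p q else 0) = 0
    rw [if_neg (by omega)]
  · change tateD n (symmetrizeChain n ψ) = 0
    rw [symmetrizeChain_eq h, map_zsmul, tateD_tateD, smul_zero]

/-- A quadratic boundary: `dχ = (n-th truncation of the hyperquadratic boundary)`. -/
theorem quadBoundary_spec {n : ℤ} (χ : Fam C) :
    quadD (n + 1) χ = trunc n (tateD (n + 2) χ) := by
  rw [quadD_eq, add_sub_cancel_right, add_assoc]; rfl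

theorem quadBoundary_mem {n : ℤ} (χ : Fam C) : quadD (n + 1) χ ∈ quadCycles C n := by
  refine ⟨?_, quadD_quadD n χ⟩
  rw [quadBoundary_spec]; exact trunc_mem n _

theorem symmetrize_boundary {n : ℤ} (χ : Fam C) :
    symmetrizeChain n (quadD (n + 1) χ) =
      tateD (n + 1) (sgn n • (quadD (n + 1) χ - tateD (n + 2) χ)) := by
  have h : tateD (n + 1) (tateD (n + 2) χ) = 0 := by
    have := tateD_tateD (n + 1) χ
    rwa [add_assoc] at this
  rw [symmetrizeChain_eq (quadBoundary_mem χ), map_zsmul, map_sub, h, sub_zero]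

theorem symmetrize_boundary_mem {n : ℤ} (χ : Fam C) :
    sgn n • (quadD (n + 1) χ - tateD (n + 2) χ) ∈ symChains C (n + 1) := by
  rw [quadBoundary_spec, ← neg_sub]
  exact zsmul_mem (neg_mem (sub_trunc_mem n _)) _

variable (C) in
/-- `1 + T : Q_n(C) → Q^n(C)`. -/
def symmetrize (n : ℤ) : QQuad C n →+ QSym C n :=
  SubQuot.map (symmetrizeChain n) (fun _ h => symmetrizeChain_mem h) (by
    rintro _ ⟨χ, -, rfl⟩
    exact ⟨_, symmetrize_boundary_mem χ, (symmetrize_boundary χ).symm⟩)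

variable (C) in
/-- `J : Q^n(C) → Q̂^n(C)`. -/
def mapJ (n : ℤ) : QSym C n →+ QTate C n :=
  SubQuot.map (AddMonoidHom.id _) (fun _ h => h.2) (by
    rintro _ ⟨ξ, -, rfl⟩
    exact ⟨ξ, rfl⟩)

variable (C) in
/-- `H : Q̂^{n+1}(C) → Q_n(C)`, `(Hθ)_s = θ_{-s-1}` for `s ≥ 0`. -/
def mapH (n : ℤ) : QTate C (n + 1) →+ QQuad C n :=
  SubQuot.map (trunc n) (fun θ h => ⟨trunc_mem n θ, by
    have h' : tateD (n + 1) θ = 0 := h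
    change quadD n (trunc n θ) = 0
    rw [quadD_trunc, h', map_zero]⟩) (by
    rintro _ ⟨θ, rfl⟩
    refine ⟨trunc (n + 1) θ, trunc_mem _ θ, ?_⟩
    rw [quadD_trunc, add_sub_cancel_right])

variable {β : Bundle B} {n : ℤ}

variable (β C n) in
/-- The forgetful map `s : Q⟨B, β⟩^n(C) → Q^n(C)`, `(φ, θ, f) ↦ φ`. -/
def QB.toSym : QB β C n →+ QSym C n :=
  AddMonoidHom.mk' (Quotient.lift (fun a => SubQuot.mk _ a.φ a.hφ) (by
    rintro a b ⟨ξ, η, g, hξ, h1, -, -⟩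
    exact SubQuot.mk_eq_mk.2 ⟨ξ, hξ, h1.symm⟩)) (by
    rintro ⟨a⟩ ⟨b⟩; rfl)

variable (β C n) in
/-- The forgetful map `Q⟨B, β⟩^n(C) → H_n(B^t ⊗_A C)`, `(φ, θ, f) ↦ f`. -/
def QB.toCross : QB β C n →+ HCross B C n :=
  AddMonoidHom.mk' (Quotient.lift (fun a => SubQuot.mk _ a.f a.hf) (by
    rintro a b ⟨ξ, η, g, -, -, h2, -⟩
    exact SubQuot.mk_eq_mk.2 ⟨g, h2⟩)) (by
    rintro ⟨a⟩ ⟨b⟩; rfl)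

variable (β C n) in
/-- The map `P⟨B, β⟩^n(C) → Q⟨B, β⟩^n(C)`, `(θ, f) ↦ (0, θ, f)`. -/
def PB.toQB : PB β C n →+ QB β C n :=
  AddMonoidHom.mk' (Quotient.lift (fun a => QB.mk a.toBStr) (by
    rintro a b ⟨η, g, h2, h3⟩
    exact QB.mk_eq_mk.2 ⟨0, η, g, zero_mem _, by simp [PStr.toBStr], h2, h3⟩)) (by
    rintro ⟨a⟩ ⟨b⟩
    refine congrArg QB.mk (BStr.ext ?_ rfl rfl)
    exact (add_zero (0 : Fam C)).symm)

variable (β C n) in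
/-- The map `P⟨B, β⟩^n(C) → H_n(B^t ⊗_A C)`, `(θ, f) ↦ f`. -/
def PB.toCross : PB β C n →+ HCross B C n :=
  AddMonoidHom.mk' (Quotient.lift (fun a => SubQuot.mk _ a.f a.hf) (by
    rintro a b ⟨η, g, h2, -⟩
    exact SubQuot.mk_eq_mk.2 ⟨g, h2⟩)) (by
    rintro ⟨a⟩ ⟨b⟩; rfl)

/-- The symmetric `(B, β)`-structure `((1 + T)ψ, θ, 0)` of a quadratic structure `ψ`, with
`θ_s = (-1)^n ψ_{-s-1}` for `s ≤ -1` and `θ_s = 0` for `s ≥ 0`. -/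
def BStr.ofQuad (β : Bundle B) (ψ : Fam C) (h : ψ ∈ quadCycles C n) : BStr β C n where
  φ := symmetrizeChain n ψ
  θ := sgn n • ψ
  f := 0
  hφ := symmetrizeChain_mem h
  hf := zero_mem _
  hθ := by rw [symmetrizeChain_eq h, map_zsmul]; simp [pull]

variable (β C n) in
/-- The map `Q_n(C) → Q⟨B, β⟩^n(C)`, `ψ ↦ ((1 + T)ψ, θ, 0)`. -/
def QB.ofQuad : QQuad C n →+ QB β C n :=
  QuotientAddGroup.lift _
    (AddMonoidHom.mk' (fun ψ : quadCycles C n => QB.mk (BStr.ofQuad β ψ.1 ψ.2)) (by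
      intro ψ ψ'
      refine congrArg QB.mk (BStr.ext (map_add _ _ _) ?_ (add_zero 0).symm)
      rw [BStr.add_θ]
      simp [BStr.ofQuad])) (by
    rintro ⟨_, hψ⟩ ⟨χ, hχ, rfl⟩
    rw [AddMonoidHom.mem_ker]
    refine QB.mk_eq_mk.2 (BStr.Rel.symm ⟨sgn n • (quadD (n + 1) χ - tateD (n + 2) χ), -(sgn n • χ), 0,
      symmetrize_boundary_mem χ, ?_, ?_, ?_⟩)
    · rw [← symmetrize_boundary]; simp [BStr.ofQuad, BStr.zero_φ]
    · simp [BStr.ofQuad, BStr.zero_f]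
    · simp only [pullHtpy_zero, BStr.ofQuad, BStr.zero_θ, map_neg, map_zsmul, smul_sub]
      abel)

/-- The pair `((-1)^n θ, 0)`, for a cycle `θ ∈ (Ŵ^%C)_{n+1}`. -/
def PStr.ofTate (β : Bundle B) (θ : Fam C) (h : θ ∈ tateCycles C (n + 1)) : PStr β C n where
  θ := sgn n • θ
  f := 0
  hf := zero_mem _
  hθ := by
    have h' : tateD (n + 1) θ = 0 := h
    rw [map_zsmul, h']; simp [pull]

variable (β C n) in
/-- The map `Q̂^{n+1}(C) → P⟨B, β⟩^n(C)`, `θ ↦ ((-1)^n θ, 0)`. -/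
def PB.ofTate : QTate C (n + 1) →+ PB β C n :=
  QuotientAddGroup.lift _
    (AddMonoidHom.mk' (fun θ : tateCycles C (n + 1) => PB.mk (PStr.ofTate β θ.1 θ.2)) (by
      intro ψ ψ'
      refine congrArg PB.mk (PStr.ext ?_ (add_zero 0).symm)
      rw [PStr.add_θ]
      simp [PStr.ofTate])) (by
    rintro ⟨_, hψ⟩ ⟨χ, rfl⟩
    rw [AddMonoidHom.mem_ker]
    refine PB.mk_eq_mk.2 (PStr.Rel.symm ⟨-(sgn n • χ), 0, ?_, ?_⟩)
    · simp [PStr.ofTate, PStr.zero_f]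
    · simp only [pullHtpy_zero, PStr.ofTate, PStr.zero_θ, map_neg, map_zsmul,
        add_assoc]
      norm_num)

theorem pull_mem (β : Bundle B) {f : Cross B C n} (h : f ∈ crossCycles B C n) :
    pull β f ∈ tateCycles C n := tateD_pull β _ f h

variable (β C n) in
/-- `I_β : H_n(B^t ⊗_A C) → Q̂^n(C)`, `f ↦ f̂^%(S^n β)`. -/
def mapI : HCross B C n →+ QTate C n :=
  QuotientAddGroup.lift _
    (AddMonoidHom.mk' (fun f : crossCycles B C n => SubQuot.mk (tateBoundaries C n) (pull β f.1)
        (pull_mem β f.2)) (by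
      intro f f'
      refine SubQuot.mk_eq_mk (hz' := add_mem (pull_mem β f.2) (pull_mem β f'.2)) |>.2
        ⟨pullSum β f.1 f'.1, ?_⟩
      exact tateD_pullSum β _ f.1 f'.1 f.2 f'.2)) (by
    rintro ⟨_, hf⟩ ⟨g, rfl⟩
    rw [AddMonoidHom.mem_ker]
    refine (SubQuot.mk_eq_mk (hz' := zero_mem _)).2 ⟨-pullHtpy β g 0 (crossD rfl g), ?_⟩
    rw [map_neg, tateD_pullHtpy β (sub_add_cancel n 1) g 0 _ (map_zero _) hf (by simp)]
    simp [pull])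

/-- A universal bundle: `I_β : H_n(B^t ⊗_A C) → Q̂^n(C)` is an isomorphism for every
finite-dimensional `C` and every `n`. -/
def IsUniversal (β : Bundle B) : Prop :=
  ∀ C : ChainComplex (ModuleCat.{u} A) ℤ, FiniteDim C → ∀ n, Function.Bijective (mapI C β n)

end Morphisms

/-! ### Functoriality in `C`, spheres, Wu classes -/

section Push

variable {C' : ChainComplex (ModuleCat.{u} A) ℤ} (h : C ⟶ C')

/-- The dual `h^* : C'^p → C^p` of a chain map. -/
def coMap (p : ℤ) : Co C' p →ₗ[A] Co C p := StarDual.map (h.f p).hom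

theorem coMap_apply (p : ℤ) (y : Co C' p) (x : C.X p) : coMap h p y x = y ((h.f p).hom x) := rfl

theorem coMap_dDual (p q : ℤ) (y : Co C' p) :
    coMap h q (dDual C' p q y) = dDual C p q (coMap h p y) := by
  ext x
  change y ((C'.d q p).hom ((h.f q).hom x)) = y ((h.f p).hom ((C.d q p).hom x))
  rw [← LinearMap.comp_apply, ← LinearMap.comp_apply, ← ModuleCat.hom_comp, ← ModuleCat.hom_comp,
    h.comm]

/-- The chain map `h^%`, `(h^% θ)_s = h θ_s h^*`. -/
def pushFam : Fam C →+ Fam C' where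
  toFun θ p q := StarDual.map (coMap h q) ∘ₗ θ p q ∘ₗ coMap h p
  map_zero' := by apply Fam.ext'; intros; simp
  map_add' θ θ' := by apply Fam.ext'; intros; simp

theorem pushFam_apply (θ : Fam C) (p q : ℤ) (x : Co C' p) (y : Co C' q) :
    pushFam h θ p q x y = θ p q (coMap h p x) (coMap h q y) := rfl

/-- The composite `h f` of `f : B^{n-*} → C` with `h : C → C'`. -/
def pushCross {n : ℤ} : Cross B C n →+ Cross B C' n where
  toFun f t := f t ∘ₗ coMap h t.1.1
  map_zero' := rfl
  map_add' _ _ := rfl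

theorem tateD_pushFam (n : ℤ) (θ : Fam C) : tateD n (pushFam h θ) = pushFam h (tateD n θ) := by
  rw [tateD_eq, tateD_eq]
  apply Fam.ext'
  intro p q x y
  change opE (pushFam h θ) p q x y - sgn n • transT (pushFam h θ) p q x y =
    opE θ p q (coMap h p x) (coMap h q y) - sgn n • transT θ p q (coMap h p x) (coMap h q y)
  simp only [opE_apply, transT_apply, pushFam_apply, coMap_dDual]

theorem crossD_pushCross {n m : ℤ} (hm : m + 1 = n) (f : Cross B C n) :
    crossD hm (pushCross h f) = pushCross h (crossD hm f) := by
  funext ⟨⟨p, i⟩, hpi⟩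
  ext x
  refine (crossD_apply hm (pushCross h f) p i hpi x).trans ?_
  refine Eq.trans ?_ (crossD_apply hm f p i hpi (coMap h p x)).symm
  rw [← coMap_dDual]
  rfl

theorem mu_pushCross (β : Bundle B) {k l : ℤ} (f : Cross B C k) (f' : Cross B C l) :
    mu β (pushCross h f) (pushCross h f') = pushFam h (mu β f f') := rfl

theorem transT_pushFam (θ : Fam C) : transT (pushFam h θ) = pushFam h (transT θ) := rfl

theorem pushFam_symChains {n : ℤ} {φ : Fam C} (hφ : φ ∈ symChains C n) :
    pushFam h φ ∈ symChains C' n := fun p q hpq => by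
  ext x y
  rw [pushFam_apply, hφ p q hpq]; rfl

theorem pushFam_symCycles {n : ℤ} {φ : Fam C} (hφ : φ ∈ symCycles C n) :
    pushFam h φ ∈ symCycles C' n := by
  refine ⟨pushFam_symChains h hφ.1, ?_⟩
  have : tateD n φ = 0 := hφ.2
  change tateD n (pushFam h φ) = 0
  rw [tateD_pushFam, this, map_zero]

/-- `h^% : Q^n(C) → Q^n(C')`. -/
def QSym.push (n : ℤ) : QSym C n →+ QSym C' n :=
  SubQuot.map (pushFam h) (fun _ hφ => pushFam_symCycles h hφ) (by
    rintro _ ⟨ξ, hξ, rfl⟩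
    exact ⟨pushFam h ξ, pushFam_symChains h hξ, tateD_pushFam h _ _⟩)

variable {β : Bundle B} {n : ℤ}

/-- The pushforward `⟨1, 0⟩(h)^%(φ, θ, f) = (h^% φ, ĥ^% θ, h f)`. -/
def BStr.push (a : BStr β C n) : BStr β C' n where
  φ := pushFam h a.φ
  θ := pushFam h a.θ
  f := pushCross h a.f
  hφ := pushFam_symCycles h a.hφ
  hf := by
    have : crossD (sub_add_cancel n 1) a.f = 0 := a.hf
    rw [crossCycles, AddMonoidHom.mem_ker, crossD_pushCross, this, map_zero]
  hθ := by rw [tateD_pushFam, ← a.hθ, map_sub]; rfl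

/-- The pushforward morphism `⟨1, 0⟩(h)^% : Q⟨B, β⟩^n(C) → Q⟨B, β⟩^n(C')`. -/
def QB.push : QB β C n →+ QB β C' n :=
  AddMonoidHom.mk' (Quotient.lift (fun a => QB.mk (a.push h)) (by
    rintro a b ⟨ξ, η, g, hξ, h1, h2, h3⟩
    refine QB.mk_eq_mk.2 ⟨pushFam h ξ, pushFam h η, pushCross h g, pushFam_symChains h hξ, ?_, ?_, ?_⟩
    · rw [tateD_pushFam, ← h1, map_sub]; rfl
    · rw [crossD_pushCross, h2, map_sub]; rfl
    · rw [tateD_pushFam, ← h3, map_add, map_sub, map_sub]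
      simp only [pullHtpy, BStr.push, mu_pushCross, transT_pushFam, map_add, map_zsmul])) (by
    rintro ⟨a⟩ ⟨b⟩
    refine congrArg QB.mk (BStr.ext (map_add _ _ _) ?_ (map_add _ _ _))
    change pushFam h (a.θ + b.θ + pullSum β a.f b.f) =
      pushFam h a.θ + pushFam h b.θ + pullSum β (pushCross h a.f) (pushCross h b.f)
    simp only [pullSum, mu_pushCross, transT_pushFam, map_add, map_neg, map_zsmul])

end Push

section Sphere

variable (A) in
/-- The complex `S^m A`, with `A` concentrated in degree `m`. -/
noncomputable def sphere (m : ℤ) : ChainComplex (ModuleCat.{u} A) ℤ :=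
  (HomologicalComplex.single (ModuleCat.{u} A) (ComplexShape.down ℤ) m).obj (ModuleCat.of A A)

variable (A) in
/-- The canonical generator `1 ∈ A^* = (S^m A)^m`, the identity map of `A`. -/
noncomputable def sphereOne (m : ℤ) : Co (sphere A m) m :=
  StarDual.of (HomologicalComplex.singleObjXSelf (ComplexShape.down ℤ) m (ModuleCat.of A A)).hom.hom

/-- Cocycles in `C^m`. -/
abbrev cocycles (C : ChainComplex (ModuleCat.{u} A) ℤ) (m : ℤ) : Submodule A (Co C m) :=
  LinearMap.ker (dDual C m (m + 1))

/-- The cohomology module `H^m(C)`. -/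
abbrev Cohomology (C : ChainComplex (ModuleCat.{u} A) ℤ) (m : ℤ) : Type u :=
  cocycles C m ⧸ (LinearMap.range (dDual C (m - 1) m)).comap (cocycles C m).subtype

/-- The chain map `C → S^m A` given by a cocycle `z : C_m → A`. -/
noncomputable def toSphere {m : ℤ} (z : cocycles C m) : C ⟶ sphere A m :=
  HomologicalComplex.mkHomToSingle (ModuleCat.ofHom (show C.X m →ₗ[A] A from z.1)) (by
    intro i hi
    obtain rfl : m + 1 = i := hi
    ext x
    exact DFunLike.congr_fun z.2 x)

/-- The chain map `S^m A → S^m A` given by right multiplication by `a`. -/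
noncomputable def sphereMul (m : ℤ) (a : A) : sphere A m ⟶ sphere A m :=
  (HomologicalComplex.single (ModuleCat.{u} A) (ComplexShape.down ℤ) m).map
    (ModuleCat.ofHom (LinearMap.toSpanSingleton A A a))

/-- For `e = ±1` and `T_e a = e ā`: the elements `a ∈ A` with `a = (-1)^k T_e a`, and only `0` for
`k < 0`. -/
def z2Cocycles (A : Type u) [Ring A] [StarRing A] (e k : ℤ) : AddSubgroup A where
  carrier := {a | (k < 0 → a = 0) ∧ a = (sgn k * e) • star a}
  zero_mem' := by simp
  add_mem' := by
    rintro a b ⟨h1, h2⟩ ⟨h3, h4⟩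
    refine ⟨fun h => by rw [h1 h, h3 h, add_zero], ?_⟩
    rw [star_add, smul_add, ← h2, ← h4]
  neg_mem' := by
    rintro a ⟨h1, h2⟩
    refine ⟨fun h => by rw [h1 h, neg_zero], ?_⟩
    rw [star_neg, smul_neg, ← h2]

/-- The elements `x + (-1)^k T_e x`, and only `0` for `k ≤ 0`. -/
def z2Boundaries (A : Type u) [Ring A] [StarRing A] (e k : ℤ) : AddSubgroup A where
  carrier := {a | (k ≤ 0 → a = 0) ∧ ∃ x : A, a = x + (sgn k * e) • star x}
  zero_mem' := ⟨fun _ => rfl, 0, by simp⟩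
  add_mem' := by
    rintro a b ⟨h1, x, rfl⟩ ⟨h3, y, rfl⟩
    refine ⟨fun h => by rw [h1 h, h3 h, add_zero], x + y, ?_⟩
    rw [star_add, smul_add]; abel
  neg_mem' := by
    rintro a ⟨h1, x, rfl⟩
    refine ⟨fun h => by rw [h1 h, neg_zero], -x, ?_⟩
    rw [star_neg, smul_neg]; abel

/-- The `ℤ₂`-cohomology group `H^k(ℤ₂; A, e)`, for `e = ±1`: `ker(1 - T_e)` for `k = 0`,
`ker(1 - (-1)^k T_e) / im(1 + (-1)^k T_e)` for `k ≥ 1`, and `0` for `k < 0`. -/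
abbrev Z2Coh (A : Type u) [Ring A] [StarRing A] (e k : ℤ) : Type u :=
  SubQuot (z2Cocycles A e k) (z2Boundaries A e k)

/-- The pairs `(a, b) ∈ A ⊕ B_r` with `db = 0` and, if `2r > n`,
`a + (-1)^r ā + β_{-2r}(b)(b) = 0`. -/
def SpherePair (β : Bundle B) (n r : ℤ) : Type u :=
  {w : A × B.X r // (B.d r (r - 1)).hom w.2 = 0 ∧
    (n < 2 * r → w.1 + sgn r • star w.1 + β.β r r w.2 w.2 = 0)}

/-- `(a, b) ∼ (a', b')` if there are `x ∈ A`, `y ∈ B_{r+1}` with `b' - b = dy` and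
`a' - a = x + (-1)^{r+1} x̄ - β_{-2r-1}(y)(b) - (-1)^r β_{-2r-1}(b')(y) + (-1)^r β_{-2r-2}(y)(y)`. -/
def SphereRel (β : Bundle B) (n r : ℤ) (w w' : SpherePair β n r) : Prop :=
  ∃ (x : A) (y : B.X (r + 1)),
    w'.1.1 - w.1.1 = x + sgn (r + 1) • star x - β.β (r + 1) r y w.1.2 -
      sgn r • β.β r (r + 1) w'.1.2 y + sgn r • β.β (r + 1) (r + 1) y y ∧
    w'.1.2 - w.1.2 = (B.d (r + 1) r).hom y

/-- The Wu class `v_r(φ, θ, f)(z) = ⟨1, 0⟩(z)^%(φ, θ, f) ∈ Q⟨B, β⟩^n(S^m A)`, `m = n - r`, of a cocycle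
`z ∈ C^m`, regarded as a chain map `z : C → S^m A`. -/
noncomputable def BStr.wu {β : Bundle B} {n : ℤ} (σ : BStr β C n) {m : ℤ} (z : cocycles C m) :
    QB β (sphere A m) n :=
  QB.push (toSphere z) (QB.mk σ)

end Sphere

end Structures0

end ChainBundles

open ChainBundles

/-! The hyperquadratic chains of every degree form one group of families, and the differential in
degree `n` is `E - (-1)^n T` with commuting involutions `E` and `T`. Truncation to the components
with `p + q ≤ n` has the symmetric chains of degree `n + 1` as kernel, so the quadratic complex is
the shifted quotient of the hyperquadratic complex by the symmetric one. This gives the sequence of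
`Q_n`, `Q^n` and the hyperquadratic groups.

A `(B, β)`-structure is a point of the homotopy pullback of `J` and `I_β`: a symmetric cycle, a
chain map, and a chain `θ` joining their hyperquadratic images. `P⟨B, β⟩` is the homotopy fibre of
`I_β`, and `Q_n` is that of `J`. The other sequences follow from the weak pullback property
`exists_toSym_toCross`, from the removal of a null-homologous chain map in `BStr.exists_rel_zero`,
and from `exists_of_toQB_ofTate_eq_zero`, which finds the classes that die in `Q⟨B, β⟩`. The
delicate point is that `f ↦ fβf^*` is quadratic. A homotopy `g` from `0` to `0` contributes
`T(gβg^*)`, whereas `I_β` is given by `gβg^*`. The two agree in homology up to any sign, because `T`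
acts there as the identity and `2 = 0` (`exists_tateD_eq_transT_sub`, `exists_tateD_eq_two`). The
universal and zero bundles are then formal.

On `S^m A` a family is one element of `A` and a chain of `B^t ⊗ S^m A` is one element of `B`. If `2r
< n`, every hyperquadratic chain of degree `n + 1` is symmetric, so `ξ` absorbs `θ` and only the
class of `b = f^*(1)` remains. If `2r ≥ n`, then `ξ = 0`, and an equivalence of structures is an
equivalence of pairs `(a, b)` (`BStr.rel_iff_sphereRel`).

For Wu classes the substance is invariance under coboundaries, which combines three components of
the structure equation (`wu_algebra`), and the defect of additivity, which is the cross term of `θ`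
rewritten through `φ` (`BStr.spherePair_add_rel`). -/

namespace ChainBundles

/-! ### Transposition, signs and homotopies in hyperquadratic homology -/

section Braid

variable {A : Type u} [Ring A] [StarRing A]
variable {B C : ChainComplex (ModuleCat.{u} A) ℤ} {β : Bundle B} {n : ℤ}

/-- The components of a family with `p + q + m` even. -/
def parityPart (m : ℤ) : Fam C →+ Fam C where
  toFun θ p q := if Even (p + q + m) then θ p q else 0
  map_zero' := by funext p q; simp
  map_add' θ θ' := by
    funext p q
    simp only [Pi.add_apply]
    split_ifs <;> simp

theorem parityPart_apply (m : ℤ) (θ : Fam C) (p q : ℤ) :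
    parityPart m θ p q = if Even (p + q + m) then θ p q else 0 := rfl

/-- On a hyperquadratic cycle the transposition is homologous to the identity. -/
theorem exists_tateD_eq_transT_sub {m : ℤ} {θ : Fam C} (h : tateD m θ = 0) :
    ∃ η, tateD (m + 1) η = transT θ - θ := by
  -- The differential of `C^t ⊗ C` changes the parity of `p + q`, while `T` and the sign
  -- `(-1)^{p+q}` preserve it. On the retained parity the boundary sees only the latter two terms,
  -- on the other only the former; there the cycle condition evaluates it.
  refine ⟨sgn m • parityPart (m + 1) θ, ?_⟩
  rw [map_zsmul, tateD_eq, sgn_add_one, neg_smul, sub_neg_eq_add]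
  apply Fam.ext'
  intro p q x y
  have h' : opE θ p q x y - sgn m • transT θ p q x y = 0 := by
    rw [tateD_eq] at h
    exact DFunLike.congr_fun (DFunLike.congr_fun (congrFun (congrFun h p) q) x) y
  change sgn m • (opE (parityPart (m + 1) θ) p q x y +
    sgn m • transT (parityPart (m + 1) θ) p q x y) = transT θ p q x y - θ p q x y
  rw [sub_eq_zero, opE_apply] at h'
  simp only [opE_apply, transT_apply, parityPart_apply] at h' ⊢
  have e1 : p + (q + 1) + (m + 1) = p + q + m + 1 + 1 := by ring
  have e2 : p + 1 + q + (m + 1) = p + q + m + 1 + 1 := by ring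
  have e3 : q + p + (m + 1) = p + q + m + 1 := by ring
  have e4 : p + q + (m + 1) = p + q + m + 1 := by ring
  simp only [e1, e2, e3, e4, Int.even_add_one (n := p + q + m + 1)]
  by_cases hp : Even (p + q + m + 1)
  · have hs : sgn (p + q) = - sgn m := by
      simp only [sgn_eq_ite, Int.even_add] at hp ⊢
      by_cases h1 : Even p <;> by_cases h2 : Even q <;> by_cases h3 : Even m <;>
        simp [h1, h2, h3] at hp ⊢
    simp only [hp, not_true_eq_false, if_true, if_false, LinearMap.zero_apply,
      StarDual.zero_apply, smul_zero, zero_add, hs, smul_add, neg_smul, smul_neg]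
    rcases sgn_cases m with hm | hm <;> simp [hm] <;> abel
  · have hs : sgn (p + q) = sgn m := by
      simp only [sgn_eq_ite, Int.even_add] at hp ⊢
      by_cases h1 : Even p <;> by_cases h2 : Even q <;> by_cases h3 : Even m <;>
        simp [h1, h2, h3] at hp ⊢
    rw [hs] at h'
    simp only [hp, not_false_eq_true, if_true, if_false, LinearMap.zero_apply,
      StarDual.zero_apply, smul_zero, add_zero, star_zero]
    rw [eq_sub_of_add_eq h']
    rcases sgn_cases m with hm | hm <;> simp [hm, sub_eq_add_neg]

/-- Twice a hyperquadratic cycle is a boundary. -/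
theorem exists_tateD_eq_two {m : ℤ} {θ : Fam C} (h : tateD m θ = 0) :
    ∃ η, tateD (m + 1) η = θ + θ := by
  -- With `ε = (-1)^m` the cycle condition is `Eθ = εTθ`, so `(E + εT)(εTθ) = εTEθ + θ = 2θ`.
  refine ⟨sgn m • transT θ, ?_⟩
  rw [tateD_eq, sub_eq_zero] at h
  rw [map_zsmul, tateD_eq, ← transT_opE, h, map_zsmul, transT_transT, sgn_add_one]
  rcases sgn_cases m with h | h <;> simp [h]

/-- The boundary of a homotopy term based at `0`, up to a boundary and any sign. -/
theorem exists_tateD_pullHtpy_zero {g : Cross B C (n + 1)} (hg : crossD rfl g = 0) (k : ℤ) :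
    ∃ η, tateD (n + 2) η = pullHtpy β g 0 0 - sgn k • pull β g := by
  -- Between zero maps only `T(gβg^*)` survives in the homotopy term. It is homologous to `gβg^*`,
  -- and a change of sign costs a double, which bounds.
  have hc : tateD (n + 1) (pull β g) = 0 := tateD_pull β rfl g hg
  obtain ⟨η, hη⟩ := exists_tateD_eq_transT_sub hc
  obtain ⟨η', hη'⟩ := exists_tateD_eq_two hc
  rw [show n + 1 + 1 = n + 2 by ring] at hη hη'
  rcases sgn_cases k with h | h
  · refine ⟨η, ?_⟩
    rw [hη, h]; simp [pullHtpy, pull]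
  · refine ⟨η + η', ?_⟩
    rw [map_add, hη, hη', h]; simp [pullHtpy, pull]

theorem crossCycles_iff {m : ℤ} (h : m + 1 = n) {f : Cross B C n} :
    f ∈ crossCycles B C n ↔ crossD h f = 0 := by
  obtain rfl : m = n - 1 := by omega
  rfl

theorem mem_tateCycles {θ : Fam C} : θ ∈ tateCycles C n ↔ tateD n θ = 0 := Iff.rfl

theorem mem_symCycles {θ : Fam C} : θ ∈ symCycles C n ↔ θ ∈ symChains C n ∧ tateD n θ = 0 :=
  Iff.rfl

theorem SubQuot.mk_eq_zero {G : Type*} [AddCommGroup G] {Z D : AddSubgroup G} {z : G}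
    {hz : z ∈ Z} : SubQuot.mk D z hz = 0 ↔ z ∈ D := by
  change SubQuot.mk D z hz = SubQuot.mk D 0 (zero_mem _) ↔ _
  rw [SubQuot.mk_eq_mk, zero_sub, neg_mem_iff]

theorem QB.mk_eq_zero {a : BStr β C n} : QB.mk a = 0 ↔ (0 : BStr β C n).Rel a :=
  eq_comm.trans (QB.mk_eq_mk (a := 0))

theorem PB.mk_eq_zero {a : PStr β C n} : PB.mk a = 0 ↔ (0 : PStr β C n).Rel a :=
  eq_comm.trans (PB.mk_eq_mk (a := 0))

/-- The condition on `ξ` in an equivalence follows from the condition on `η`. -/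
theorem BStr.Rel.of_htpy {a b : BStr β C n} {ξ η : Fam C} {g : Cross B C (n + 1)}
    (hξ : ξ ∈ symChains C (n + 1)) (hg : crossD rfl g = b.f - a.f)
    (h : ξ - pullHtpy β g a.f b.f - b.θ + a.θ = tateD (n + 2) η) : a.Rel b := by
  refine ⟨ξ, η, g, hξ, ?_, hg, h⟩
  -- Differentiating the equation for `η` leaves the condition on `dξ`, since the homotopy term
  -- bounds the difference of the two pulled back cycles.
  have h0 : tateD (n + 1) (tateD (n + 2) η) = 0 := by
    have := tateD_tateD (n + 1) η
    rwa [add_assoc] at this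
  rw [← h, map_add, map_sub, map_sub,
    tateD_pullHtpy β (sub_add_cancel n 1) g a.f b.f a.hf b.hf hg, ← a.hθ, ← b.hθ] at h0
  rw [← sub_eq_zero, ← neg_eq_zero, ← h0]
  abel

theorem tateD_tateD' (n : ℤ) (θ : Fam C) : tateD (n + 1) (tateD (n + 2) θ) = 0 := by
  have := tateD_tateD (n + 1) θ
  rwa [add_assoc] at this

/-! ### Truncation and the sequence of quadratic, symmetric and hyperquadratic groups -/

theorem mem_tateBoundaries {θ : Fam C} :
    θ ∈ tateBoundaries C (n + 1) ↔ ∃ η, tateD (n + 2) η = θ := by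
  rw [show n + 2 = n + 1 + 1 by ring]; rfl

/-- The bounding chain may be an arbitrary family, because the components of its boundary with `p +
q ≤ n` depend only on its components with `p + q ≤ n + 1`. -/
theorem mem_quadBoundaries {ψ : Fam C} :
    ψ ∈ quadBoundaries C n ↔ ∃ χ, trunc n (tateD (n + 2) χ) = ψ := by
  constructor
  · rintro ⟨χ, -, rfl⟩
    exact ⟨χ, (quadBoundary_spec χ).symm⟩
  · rintro ⟨χ, rfl⟩
    refine ⟨trunc (n + 1) χ, trunc_mem _ _, ?_⟩
    rw [quadD_trunc, add_sub_cancel_right, add_assoc]; rfl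

/-- With `mem_symChains_of_trunc` this identifies the kernel of the truncation, the source of the
long exact sequence. -/
theorem trunc_eq_zero_of_mem {φ : Fam C} (h : φ ∈ symChains C (n + 1)) : trunc n φ = 0 := by
  funext p q
  rw [trunc_apply]
  split_ifs with hpq
  · exact h p q (by omega)
  · rfl

theorem mem_symChains_of_trunc {φ : Fam C} (h : trunc n φ = 0) : φ ∈ symChains C (n + 1) := by
  have := sub_trunc_mem n φ
  rwa [h, sub_zero] at this

theorem sgn_smul_sgn_smul {G : Type*} [AddCommGroup G] (k : ℤ) (x : G) :
    sgn k • sgn k • x = x := by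
  rw [smul_smul, sgn_mul_self, one_smul]

/-- The truncation of a hyperquadratic chain with symmetric boundary is a quadratic cycle. -/
theorem trunc_mem_quadCycles {φ θ : Fam C} (hφ : φ ∈ symChains C n) (h : φ = tateD (n + 1) θ) :
    sgn n • trunc n θ ∈ quadCycles C n := by
  refine zsmul_mem ?_ _
  refine ⟨trunc_mem n θ, ?_⟩
  change quadD n (trunc n θ) = 0
  rw [quadD_trunc, ← h]
  exact trunc_eq_zero_of_mem (by rwa [sub_add_cancel])

theorem symmetrizeChain_trunc {φ θ : Fam C} (hφ : φ ∈ symChains C n) (h : φ = tateD (n + 1) θ) :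
    symmetrizeChain n (sgn n • trunc n θ) = tateD (n + 1) (trunc n θ) := by
  rw [symmetrizeChain_eq (trunc_mem_quadCycles hφ h), map_zsmul, sgn_smul_sgn_smul]

/-- If `φ = dθ`, split `θ` at `p + q = n`. The lower part is, up to sign, a quadratic cycle whose
symmetrization is its own hyperquadratic boundary; the upper part is a symmetric chain bounding what
is left of `φ`. -/
theorem exact_symmetrize_mapJ : Function.Exact (symmetrize C n) (mapJ C n) := by
  intro x
  constructor
  · obtain ⟨φ, hφ, rfl⟩ := SubQuot.mk_surj x
    intro h
    obtain ⟨θ, hθ⟩ := SubQuot.mk_eq_zero.1 h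
    replace hθ : φ = tateD (n + 1) θ := hθ.symm
    refine ⟨SubQuot.mk _ _ (trunc_mem_quadCycles hφ.1 hθ), ?_⟩
    refine SubQuot.mk_eq_mk.2 ⟨θ - trunc n θ, sub_trunc_mem n θ, ?_⟩
    change _ = φ - symmetrizeChain n (sgn n • trunc n θ)
    rw [symmetrizeChain_trunc hφ.1 hθ, map_sub, ← hθ]
  · rintro ⟨y, rfl⟩
    obtain ⟨ψ, hψ, rfl⟩ := SubQuot.mk_surj y
    exact SubQuot.mk_eq_zero.2 ⟨sgn n • ψ, by rw [map_zsmul]; exact (symmetrizeChain_eq hψ).symm⟩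

theorem exact_mapJ_mapH : Function.Exact (mapJ C (n + 1)) (mapH C n) := by
  intro x
  constructor
  · obtain ⟨θ, hθ, rfl⟩ := SubQuot.mk_surj x
    intro h
    obtain ⟨χ, hχ⟩ := mem_quadBoundaries.1 (SubQuot.mk_eq_zero.1 h)
    have hθ0 : tateD (n + 1) θ = 0 := hθ
    -- Subtracting the full boundary of `χ` clears all components with `p + q ≤ n`, so the corrected
    -- cycle is symmetric.
    refine ⟨SubQuot.mk _ (θ - tateD (n + 2) χ) ⟨mem_symChains_of_trunc ?_, ?_⟩, ?_⟩
    · rw [map_sub, hχ]; exact sub_self _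
    · change tateD (n + 1) _ = 0
      rw [map_sub, tateD_tateD', hθ0, sub_zero]
    · refine SubQuot.mk_eq_mk.2 (mem_tateBoundaries.2 ⟨χ, ?_⟩)
      simp
  · rintro ⟨y, rfl⟩
    obtain ⟨φ, hφ, rfl⟩ := SubQuot.mk_surj y
    refine SubQuot.mk_eq_zero.2 ?_
    change trunc n φ ∈ _
    rw [trunc_eq_zero_of_mem hφ.1]
    exact zero_mem _

/-- On quadratic cycles `(1 + T)ψ` is `(-1)^n dψ` in the hyperquadratic complex. A symmetric `ξ`
bounding it makes `ψ - (-1)^n ξ` a hyperquadratic cycle, and `ξ` is invisible to the truncation. -/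
theorem exact_mapH_symmetrize : Function.Exact (mapH C n) (symmetrize C n) := by
  intro x
  constructor
  · obtain ⟨ψ, hψ, rfl⟩ := SubQuot.mk_surj x
    intro h
    obtain ⟨ξ, hξ, h⟩ := SubQuot.mk_eq_zero.1 h
    change tateD (n + 1) ξ = symmetrizeChain n ψ at h
    rw [symmetrizeChain_eq hψ] at h
    refine ⟨SubQuot.mk _ (ψ - sgn n • ξ) ?_, ?_⟩
    · rw [mem_tateCycles, map_sub, map_zsmul, h, sgn_smul_sgn_smul, sub_self]
    · refine (SubQuot.map_mk _ _ _ _ _).trans ?_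
      congr 1
      rw [map_sub, map_zsmul, trunc_eq_self hψ.1, trunc_eq_zero_of_mem hξ, smul_zero, sub_zero]
  · rintro ⟨y, rfl⟩
    obtain ⟨θ, hθ, rfl⟩ := SubQuot.mk_surj y
    have hθ0 : tateD (n + 1) θ = 0 := hθ
    refine SubQuot.mk_eq_zero.2 ⟨sgn n • (trunc n θ - θ), ?_, ?_⟩
    · rw [← neg_sub]
      exact zsmul_mem (neg_mem (sub_trunc_mem n θ)) _
    · have hq : trunc n θ ∈ quadCycles C n :=
        ⟨trunc_mem n θ, by
          change quadD n (trunc n θ) = 0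
          rw [quadD_trunc, hθ0, map_zero]⟩
      change _ = symmetrizeChain n (trunc n θ)
      rw [symmetrizeChain_eq hq, map_zsmul, map_sub, hθ0, sub_zero]

/-! ### Commutativity and exactness of the braid -/

theorem toSym_comp_ofQuad : (QB.toSym C β n).comp (QB.ofQuad C β n) = symmetrize C n := by
  refine DFunLike.ext _ _ fun x => ?_
  obtain ⟨ψ, hψ, rfl⟩ := SubQuot.mk_surj x
  rfl

/-- The chain `θ` of a structure is itself the required homology. -/
theorem mapJ_comp_toSym :
    (mapJ C n).comp (QB.toSym C β n) = (mapI C β n).comp (QB.toCross C β n) := by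
  refine DFunLike.ext _ _ fun x => ?_
  obtain ⟨a, rfl⟩ := QB.mk_surj x
  refine SubQuot.mk_eq_mk.2 ⟨-a.θ, ?_⟩
  rw [map_neg, ← a.hθ, neg_sub]; rfl

theorem toCross_comp_toQB : (QB.toCross C β n).comp (PB.toQB C β n) = PB.toCross C β n := by
  refine DFunLike.ext _ _ fun x => ?_
  obtain ⟨a, rfl⟩ := PB.mk_surj x
  rfl

/-- Both composites have `f = 0` and differ in `θ` by components with `p + q > n`. These form a
symmetric chain, which serves as the `ξ` of an equivalence. -/
theorem toQB_comp_ofTate :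
    (PB.toQB C β n).comp (PB.ofTate C β n) = (QB.ofQuad C β n).comp (mapH C n) := by
  refine DFunLike.ext _ _ fun x => ?_
  obtain ⟨θ, hθ, rfl⟩ := SubQuot.mk_surj x
  refine QB.mk_eq_mk.2 (BStr.Rel.of_htpy (ξ := -(sgn n • (θ - trunc n θ))) (η := 0) (g := 0)
    (neg_mem (zsmul_mem (sub_trunc_mem n θ) _)) ?_ ?_)
  · rw [map_zero]; exact (sub_self (0 : Cross B C n)).symm
  · rw [pullHtpy_zero, map_zero]
    change -(sgn n • (θ - trunc n θ)) - 0 - sgn n • trunc n θ + sgn n • θ = 0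
    rw [smul_sub]; abel

/-- A symmetric chain `ξ` bounding `φ` can be moved into `θ`, leaving a structure whose symmetric
part is `0`. -/
theorem exact_toQB_toSym : Function.Exact (PB.toQB C β n) (QB.toSym C β n) := by
  intro x
  constructor
  · obtain ⟨a, rfl⟩ := QB.mk_surj x
    intro h
    obtain ⟨ξ, hξ, h⟩ := SubQuot.mk_eq_zero.1 h
    refine ⟨PB.mk ⟨a.θ - ξ, a.f, a.hf, ?_⟩, ?_⟩
    · rw [map_sub, ← a.hθ, h]; abel
    · refine QB.mk_eq_mk.2 (BStr.Rel.of_htpy (ξ := ξ) (η := 0) (g := 0) hξ ?_ ?_)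
      · rw [map_zero]; exact (sub_self a.f).symm
      · rw [pullHtpy_zero, map_zero]
        change ξ - 0 - a.θ + (a.θ - ξ) = 0
        abel
  · rintro ⟨y, rfl⟩
    obtain ⟨a, rfl⟩ := PB.mk_surj y
    exact SubQuot.mk_eq_zero.2 (zero_mem _)

/-- A hyperquadratic class dies in `P⟨B, β⟩^n(C)` exactly when it comes from `I_β`. -/
theorem exact_mapI_ofTate : Function.Exact (mapI C β (n + 1)) (PB.ofTate C β n) := by
  intro x
  constructor
  · obtain ⟨θ, hθ, rfl⟩ := SubQuot.mk_surj x
    intro h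
    obtain ⟨η, g, hg, h⟩ := (PB.mk_eq_zero (a := PStr.ofTate β θ hθ)).1 h
    change crossD rfl g = 0 - 0 at hg
    change 0 - pullHtpy β g 0 0 - sgn n • θ + 0 = _ at h
    rw [sub_zero] at hg
    refine ⟨SubQuot.mk _ g ((crossCycles_iff rfl).2 hg), ?_⟩
    -- The sign `(-1)^{n+1}` makes the homotopy term match the factor `(-1)^n` on `θ`, so that the
    -- two boundaries add up to a multiple of `gβg^* - θ`.
    obtain ⟨η', hη'⟩ := exists_tateD_pullHtpy_zero (β := β) hg (n + 1)
    refine SubQuot.mk_eq_mk.2 (mem_tateBoundaries.2 ⟨-(sgn n • (η + η')), ?_⟩)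
    rw [map_neg, map_zsmul, map_add, ← h, hη', sgn_add_one]
    rcases sgn_cases n with h | h <;> simp [h]
    all_goals abel
  · rintro ⟨y, rfl⟩
    obtain ⟨g, hg, rfl⟩ := SubQuot.mk_surj y
    have hg' : crossD rfl g = 0 := (crossCycles_iff rfl).1 hg
    obtain ⟨η', hη'⟩ := exists_tateD_pullHtpy_zero (β := β) hg' (n + 1)
    refine (PB.mk_eq_zero (a := PStr.ofTate β (pull β g) (pull_mem β hg))).2 ⟨-η', g, ?_, ?_⟩
    · rw [hg']; exact (sub_self (0 : Cross B C n)).symm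
    · change 0 - pullHtpy β g 0 0 - sgn n • pull β g + 0 = _
      rw [map_neg, hη', sgn_add_one, neg_smul]
      abel

theorem exact_toCross_mapI : Function.Exact (PB.toCross C β n) (mapI C β n) := by
  intro x
  constructor
  · obtain ⟨f, hf, rfl⟩ := SubQuot.mk_surj x
    intro h
    obtain ⟨θ, hθ⟩ := (SubQuot.mk_eq_zero (z := pull β f) (hz := pull_mem β hf)).1 h
    exact ⟨PB.mk ⟨-θ, f, hf, by rw [map_neg, hθ, zero_sub]⟩, rfl⟩
  · rintro ⟨y, rfl⟩
    obtain ⟨a, rfl⟩ := PB.mk_surj y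
    refine (SubQuot.mk_eq_zero (z := pull β a.f) (hz := pull_mem β a.hf)).2 ⟨-a.θ, ?_⟩
    rw [map_neg, ← a.hθ, zero_sub, neg_neg]

/-- A structure with null-homologous chain map is equivalent to one with chain map `0`. -/
theorem BStr.exists_rel_zero (a : BStr β C n) {g : Cross B C (n + 1)} (hg : crossD rfl g = a.f) :
    ∃ (θ : Fam C) (h : a.φ - pull β (0 : Cross B C n) = tateD (n + 1) θ),
      (⟨a.φ, θ, 0, a.hφ, zero_mem _, h⟩ : BStr β C n).Rel a := by
  refine ⟨a.θ + pullHtpy β g 0 a.f, ?_, ?_⟩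
  · rw [map_add, ← a.hθ, tateD_pullHtpy β (sub_add_cancel n 1) g 0 a.f (map_zero _) a.hf
      (by rw [hg, sub_zero])]
    abel
  · refine BStr.Rel.of_htpy (ξ := 0) (η := 0) (g := g) (zero_mem _) ?_ ?_
    · change _ = a.f - 0
      rw [hg, sub_zero]
    · rw [map_zero]
      change 0 - pullHtpy β g 0 a.f - a.θ + (a.θ + pullHtpy β g 0 a.f) = 0
      abel

theorem PStr.exists_rel_zero (a : PStr β C n) {g : Cross B C (n + 1)} (hg : crossD rfl g = a.f) :
    ∃ (θ : Fam C) (h : 0 - pull β (0 : Cross B C n) = tateD (n + 1) θ),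
      (⟨θ, 0, zero_mem _, h⟩ : PStr β C n).Rel a := by
  refine ⟨a.θ + pullHtpy β g 0 a.f, ?_, ⟨0, g, ?_, ?_⟩⟩
  · rw [map_add, ← a.hθ, tateD_pullHtpy β (sub_add_cancel n 1) g 0 a.f (map_zero _) a.hf
      (by rw [hg, sub_zero])]
    abel
  · change _ = a.f - 0
    rw [hg, sub_zero]
  · rw [map_zero]
    change 0 - pullHtpy β g 0 a.f - a.θ + (a.θ + pullHtpy β g 0 a.f) = 0
    abel

@[simp] theorem pull_zero : pull β (0 : Cross B C n) = 0 := by simp [pull]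

theorem exact_ofTate_toCross : Function.Exact (PB.ofTate C β n) (PB.toCross C β n) := by
  intro x
  constructor
  · obtain ⟨a, rfl⟩ := PB.mk_surj x
    intro h
    obtain ⟨g, hg⟩ := SubQuot.mk_eq_zero.1 h
    obtain ⟨θ, hθ, hr⟩ := a.exists_rel_zero hg
    have hθ' : tateD (n + 1) (sgn n • θ) = 0 := by
      rw [map_zsmul, ← hθ, pull_zero, sub_zero, smul_zero]
    refine ⟨SubQuot.mk _ (sgn n • θ) hθ', ?_⟩
    rw [← PB.mk_eq_mk.2 hr]
    exact congrArg PB.mk (PStr.ext (sgn_smul_sgn_smul n θ) rfl)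
  · rintro ⟨y, rfl⟩
    obtain ⟨θ, hθ, rfl⟩ := SubQuot.mk_surj y
    exact SubQuot.mk_eq_zero.2 (zero_mem _)

/-- Once the chain map is `0`, the structure equation reads `φ = dθ`. The argument for
`exact_symmetrize_mapJ` then applies, with the upper part of `θ` used as `ξ`. -/
theorem exact_ofQuad_toCross : Function.Exact (QB.ofQuad C β n) (QB.toCross C β n) := by
  intro x
  constructor
  · obtain ⟨a, rfl⟩ := QB.mk_surj x
    intro h
    obtain ⟨g, hg⟩ := SubQuot.mk_eq_zero.1 h
    obtain ⟨θ, hθ, hr⟩ := a.exists_rel_zero hg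
    have hθ' : a.φ = tateD (n + 1) θ := by rw [← hθ, pull_zero, sub_zero]
    have hq := trunc_mem_quadCycles a.hφ.1 hθ'
    refine ⟨SubQuot.mk _ _ hq, ?_⟩
    rw [← QB.mk_eq_mk.2 hr]
    refine (QB.mk_eq_mk (a := BStr.ofQuad β _ hq)).2
      (BStr.Rel.of_htpy (ξ := θ - trunc n θ) (η := 0) (g := 0) (sub_trunc_mem n θ) ?_ ?_)
    · rw [map_zero]; exact (sub_self (0 : Cross B C n)).symm
    · rw [pullHtpy_zero, map_zero]
      change θ - trunc n θ - 0 - θ + sgn n • sgn n • trunc n θ = 0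
      rw [sgn_smul_sgn_smul]; abel
  · rintro ⟨y, rfl⟩
    obtain ⟨θ, hθ, rfl⟩ := SubQuot.mk_surj y
    exact SubQuot.mk_eq_zero.2 (zero_mem _)

/-- The square of `Q⟨B, β⟩^n(C)` over `Q^n(C)` and `H_n(B^t ⊗_A C)` is a weak pullback. -/
theorem exists_toSym_toCross {x : QSym C n} {y : HCross B C n} (h : mapJ C n x = mapI C β n y) :
    ∃ w, QB.toSym C β n w = x ∧ QB.toCross C β n w = y := by
  obtain ⟨φ, hφ, rfl⟩ := SubQuot.mk_surj x
  obtain ⟨f, hf, rfl⟩ := SubQuot.mk_surj y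
  obtain ⟨θ, hθ⟩ := (SubQuot.mk_eq_mk (hz := hφ.2) (hz' := pull_mem β hf)).1 h
  exact ⟨QB.mk ⟨φ, -θ, f, hφ, hf, by rw [map_neg, hθ]; abel⟩, rfl, rfl⟩

theorem mapJ_toSym (w : QB β C n) :
    mapJ C n (QB.toSym C β n w) = mapI C β n (QB.toCross C β n w) :=
  DFunLike.congr_fun mapJ_comp_toSym w

/-- A symmetric class lifts as soon as its image under `J` lies in the image of `I_β`, and
`exact_mapI_ofTate` detects this in `P⟨B, β⟩`. -/
theorem exact_toSym_ofTate_mapJ :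
    Function.Exact (QB.toSym C β (n + 1)) ((PB.ofTate C β n).comp (mapJ C (n + 1))) := by
  intro x
  constructor
  · intro h
    obtain ⟨y, hy⟩ := (exact_mapI_ofTate _).1 h
    obtain ⟨w, hw, -⟩ := exists_toSym_toCross hy.symm
    exact ⟨w, hw⟩
  · rintro ⟨w, rfl⟩
    rw [AddMonoidHom.comp_apply, mapJ_toSym]
    exact exact_mapI_ofTate.apply_apply_eq_zero _

theorem exact_toCross_mapH_mapI :
    Function.Exact (QB.toCross C β (n + 1)) ((mapH C n).comp (mapI C β (n + 1))) := by
  intro x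
  constructor
  · intro h
    obtain ⟨y, hy⟩ := (exact_mapJ_mapH _).1 h
    obtain ⟨w, -, hw⟩ := exists_toSym_toCross hy
    exact ⟨w, hw⟩
  · rintro ⟨w, rfl⟩
    rw [AddMonoidHom.comp_apply, ← mapJ_toSym]
    exact exact_mapJ_mapH.apply_apply_eq_zero _

theorem toQB_ofTate (x : QTate C (n + 1)) :
    PB.toQB C β n (PB.ofTate C β n x) = QB.ofQuad C β n (mapH C n x) :=
  DFunLike.congr_fun toQB_comp_ofTate x

theorem toCross_toQB (x : PB β C n) :
    QB.toCross C β n (PB.toQB C β n x) = PB.toCross C β n x :=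
  DFunLike.congr_fun toCross_comp_toQB x

theorem toSym_ofQuad (x : QQuad C n) :
    QB.toSym C β n (QB.ofQuad C β n x) = symmetrize C n x :=
  DFunLike.congr_fun toSym_comp_ofQuad x

/-- A class of `Q̂^{n+1}(C)` with trivial image in `Q⟨B, β⟩^n(C)` is a difference of classes coming
from `Q^{n+1}(C)` and `H_{n+1}(B^t ⊗_A C)`. -/
theorem exists_of_toQB_ofTate_eq_zero {z : QTate C (n + 1)}
    (h : PB.toQB C β n (PB.ofTate C β n z) = 0) :
    ∃ x y, mapJ C (n + 1) x - mapI C β (n + 1) y = z := by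
  obtain ⟨θ, hθ, rfl⟩ := SubQuot.mk_surj z
  obtain ⟨ξ, η, g, hξ, h1, hg, h⟩ := (QB.mk_eq_zero (a := (PStr.ofTate β θ hθ).toBStr)).1 h
  change 0 - 0 = _ at h1
  change crossD rfl g = 0 - 0 at hg
  change ξ - pullHtpy β g 0 0 - sgn n • θ + 0 = _ at h
  rw [sub_zero] at hg h1
  -- Both ends have symmetric part and chain map `0`, so `ξ` and `g` are cycles. They give the two
  -- classes whose difference is sought, with the sign of the `gβg^*` term now chosen as `(-1)^n`.
  obtain ⟨η', hη'⟩ := exists_tateD_pullHtpy_zero (β := β) hg n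
  have hξc : ξ ∈ symCycles C (n + 1) := ⟨hξ, h1.symm⟩
  have hξt : ξ ∈ tateCycles C (n + 1) := h1.symm
  refine ⟨SubQuot.mk _ (sgn n • ξ) (zsmul_mem hξc _),
    SubQuot.mk _ g ((crossCycles_iff rfl).2 hg), ?_⟩
  refine (SubQuot.mk_eq_mk (z := sgn n • ξ - pull β g)
    (hz := sub_mem (zsmul_mem hξt _) (pull_mem β ((crossCycles_iff rfl).2 hg)))).2
    (mem_tateBoundaries.2 ⟨-(sgn n • (η + η')), ?_⟩)
  rw [map_neg, map_zsmul, map_add, ← h, hη']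
  rcases sgn_cases n with h | h <;> simp [h]
  all_goals abel

theorem ofTate_mapI (y : HCross B C (n + 1)) :
    PB.ofTate C β n (mapI C β (n + 1) y) = 0 := exact_mapI_ofTate.apply_apply_eq_zero _

theorem mapH_mapJ (x : QSym C (n + 1)) :
    mapH C n (mapJ C (n + 1) x) = 0 := exact_mapJ_mapH.apply_apply_eq_zero _

/-- An element of the kernel has null-homologous chain map, hence comes from a hyperquadratic class.
That class is a difference of images of `J` and `I_β`, and the second vanishes in `P⟨B, β⟩`. -/
theorem exact_ofTate_mapJ_toQB :
    Function.Exact ((PB.ofTate C β n).comp (mapJ C (n + 1))) (PB.toQB C β n) := by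
  intro x
  constructor
  · intro h
    have h' : PB.toCross C β n x = 0 := by rw [← toCross_toQB, h, map_zero]
    obtain ⟨z, rfl⟩ := (exact_ofTate_toCross _).1 h'
    obtain ⟨x, y, rfl⟩ := exists_of_toQB_ofTate_eq_zero h
    exact ⟨x, by rw [map_sub, ofTate_mapI, sub_zero]; rfl⟩
  · rintro ⟨x, rfl⟩
    rw [AddMonoidHom.comp_apply, toQB_ofTate, mapH_mapJ, map_zero]

theorem exact_mapH_mapI_ofQuad :
    Function.Exact ((mapH C n).comp (mapI C β (n + 1))) (QB.ofQuad C β n) := by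
  intro x
  constructor
  · intro h
    have h' : symmetrize C n x = 0 := by rw [← toSym_ofQuad (β := β), h, map_zero]
    obtain ⟨z, rfl⟩ := (exact_mapH_symmetrize _).1 h'
    rw [← toQB_ofTate] at h
    obtain ⟨x, y, rfl⟩ := exists_of_toQB_ofTate_eq_zero h
    exact ⟨-y, by rw [AddMonoidHom.comp_apply, map_sub, mapH_mapJ, zero_sub, map_neg, map_neg]⟩
  · rintro ⟨x, rfl⟩
    rw [AddMonoidHom.comp_apply, ← toQB_ofTate, ofTate_mapI, map_zero]

theorem exact_prod_coprod :
    Function.Exact ((QB.toSym C β n).prod (QB.toCross C β n))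
      ((mapJ C n).coprod (-(mapI C β n))) := by
  rintro ⟨x, y⟩
  rw [AddMonoidHom.coprod_apply, AddMonoidHom.neg_apply, ← sub_eq_add_neg, sub_eq_zero]
  constructor
  · intro h
    obtain ⟨w, hx, hy⟩ := exists_toSym_toCross h
    exact ⟨w, Prod.ext hx hy⟩
  · rintro ⟨w, hw⟩
    obtain ⟨rfl, rfl⟩ := Prod.mk.inj hw
    exact mapJ_toSym w

theorem exact_coprod_toQB_ofTate :
    Function.Exact ((mapJ C (n + 1)).coprod (-(mapI C β (n + 1))))
      ((PB.toQB C β n).comp (PB.ofTate C β n)) := by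
  intro z
  constructor
  · intro h
    obtain ⟨x, y, rfl⟩ := exists_of_toQB_ofTate_eq_zero h
    exact ⟨(x, y), by simp [sub_eq_add_neg]⟩
  · rintro ⟨⟨x, y⟩, rfl⟩
    rw [AddMonoidHom.coprod_apply, AddMonoidHom.neg_apply, map_add, map_neg,
      AddMonoidHom.comp_apply, toQB_ofTate, mapH_mapJ, map_zero, AddMonoidHom.comp_apply,
      ofTate_mapI, map_zero, neg_zero, add_zero]

theorem exact_toQB_ofTate_prod :
    Function.Exact ((PB.toQB C β n).comp (PB.ofTate C β n))
      ((QB.toSym C β n).prod (QB.toCross C β n)) := by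
  intro w
  constructor
  · intro h
    obtain ⟨h1, h2⟩ := Prod.mk.inj h
    obtain ⟨x, rfl⟩ := (exact_toQB_toSym _).1 h1
    rw [toCross_toQB] at h2
    obtain ⟨z, rfl⟩ := (exact_ofTate_toCross _).1 h2
    exact ⟨z, rfl⟩
  · rintro ⟨z, rfl⟩
    refine Prod.ext (exact_toQB_toSym.apply_apply_eq_zero _) ?_
    exact (toCross_toQB _).trans (exact_ofTate_toCross.apply_apply_eq_zero _)

/-! ### Universal and zero bundles -/

theorem IsUniversal.subsingleton_PB (hβ : IsUniversal β) (hC : FiniteDim C) (n : ℤ) :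
    Subsingleton (PB β C n) := by
  refine ⟨fun x y => ?_⟩
  have key : ∀ x : PB β C n, x = 0 := fun x => by
    -- Injectivity of `I_β` in degree `n` kills the chain map, and surjectivity in degree `n + 1`
    -- kills the remaining hyperquadratic class.
    have h : PB.toCross C β n x = 0 := (hβ C hC n).1 (by
      rw [exact_toCross_mapI.apply_apply_eq_zero, map_zero])
    obtain ⟨z, rfl⟩ := (exact_ofTate_toCross _).1 h
    obtain ⟨y, rfl⟩ := (hβ C hC (n + 1)).2 z
    exact ofTate_mapI y
  rw [key x, key y]

theorem IsUniversal.bijective_toSym (hβ : IsUniversal β) (hC : FiniteDim C) (n : ℤ) :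
    Function.Bijective (QB.toSym C β n) := by
  constructor
  · rw [injective_iff_map_eq_zero]
    intro x hx
    obtain ⟨y, rfl⟩ := (exact_toQB_toSym _).1 hx
    have := hβ.subsingleton_PB hC n
    rw [Subsingleton.elim y 0, map_zero]
  -- The obstruction to lifting lies in `P⟨B, β⟩` one degree lower, which also vanishes.
  · obtain ⟨n, rfl⟩ : ∃ k, n = k + 1 := ⟨n - 1, by ring⟩
    intro x
    have := hβ.subsingleton_PB hC n
    exact (exact_toSym_ofTate_mapJ x).1 (Subsingleton.elim _ _)

theorem subsingleton_HCross (hB : ∀ i, Subsingleton (B.X i)) (n : ℤ) :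
    Subsingleton (HCross B C n) := by
  have : Subsingleton (Cross B C n) := ⟨fun f f' => by
    funext t; ext x; exact (hB _).elim _ _⟩
  refine ⟨fun x y => ?_⟩
  obtain ⟨f, hf, rfl⟩ := SubQuot.mk_surj x
  obtain ⟨f', hf', rfl⟩ := SubQuot.mk_surj y
  congr 1
  exact Subsingleton.elim _ _

theorem bijective_ofQuad (hB : ∀ i, Subsingleton (B.X i)) (n : ℤ) :
    Function.Bijective (QB.ofQuad C β n) := by
  have := subsingleton_HCross (C := C) hB
  constructor
  · rw [injective_iff_map_eq_zero]
    intro x hx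
    obtain ⟨y, rfl⟩ := (exact_mapH_mapI_ofQuad _).1 hx
    rw [Subsingleton.elim y 0, map_zero]
  · exact fun x => (exact_ofQuad_toCross x).1 (Subsingleton.elim _ _)

theorem bijective_ofTate (hB : ∀ i, Subsingleton (B.X i)) (n : ℤ) :
    Function.Bijective (PB.ofTate C β n) := by
  have := subsingleton_HCross (C := C) hB
  constructor
  · rw [injective_iff_map_eq_zero]
    intro x hx
    obtain ⟨y, rfl⟩ := (exact_mapI_ofTate _).1 hx
    rw [Subsingleton.elim y 0, map_zero]
  · exact fun x => (exact_ofTate_toCross x).1 (Subsingleton.elim _ _)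

end Braid

/-! ### Sign arithmetic -/

section Signs

theorem sgn_add (k l : ℤ) : sgn (k + l) = sgn k * sgn l := by
  simp only [sgn_eq_ite, Int.even_add]
  by_cases h1 : Even k <;> by_cases h2 : Even l <;> simp [h1, h2]

theorem sgn_mul_self_index (k : ℤ) : sgn (k * k) = sgn k := by
  simp only [sgn_eq_ite, Int.even_mul, or_self]

theorem sgn_sub (k l : ℤ) : sgn (k - l) = sgn k * sgn l := by
  simp only [sgn_eq_ite, Int.even_sub]
  by_cases h1 : Even k <;> by_cases h2 : Even l <;> simp [h1, h2]

@[simp] theorem sgn_two_mul (k : ℤ) : sgn (2 * k) = 1 := by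
  simp [sgn_eq_ite]

end Signs

/-! ### Structures on the sphere evaluated at its generator -/

section SphereEval

variable {A : Type u} [Ring A] [StarRing A]

variable (A) in
/-- The identification of the degree `m` part of `S^m A` with `A`. -/
noncomputable def sphereEquiv (m : ℤ) : (sphere A m).X m ≃ₗ[A] A :=
  (HomologicalComplex.singleObjXSelf (ComplexShape.down ℤ) m (ModuleCat.of A A)).toLinearEquiv

theorem sphereOne_apply (m : ℤ) (x : (sphere A m).X m) : sphereOne A m x = sphereEquiv A m x := rfl

variable (A) in
/-- The generator `1 ∈ A` of `S^m A` in degree `m`, extended by `0` to the other degrees. -/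
noncomputable def sphereGen (m : ℤ) : ∀ p, (sphere A m).X p :=
  Pi.single m ((sphereEquiv A m).symm 1)

theorem sphereOne_sphereGen (m : ℤ) : sphereOne A m (sphereGen A m m) = 1 := by
  rw [sphereGen, Pi.single_eq_same, sphereOne_apply, LinearEquiv.apply_symm_apply]

theorem sphereOne_injective (m : ℤ) : Function.Injective (sphereOne A m) :=
  (sphereEquiv A m).injective

theorem eq_smul_sphereGen (m : ℤ) (x : (sphere A m).X m) :
    x = sphereOne A m x • sphereGen A m m := by
  apply sphereOne_injective
  rw [map_smul, sphereOne_sphereGen, smul_eq_mul, mul_one]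

theorem sphere_subsingleton {m p : ℤ} (h : p ≠ m) : Subsingleton ((sphere A m).X p) :=
  ModuleCat.subsingleton_of_isZero
    (HomologicalComplex.isZero_single_obj_X (ComplexShape.down ℤ) m (ModuleCat.of A A) p h)

theorem co_sphere_eq_zero {m p : ℤ} (h : p ≠ m) (y : Co (sphere A m) p) : y = 0 := by
  have := sphere_subsingleton (A := A) h
  ext x
  rw [Subsingleton.elim x 0, map_zero, map_zero]

theorem co_sphere_eq_smul (m : ℤ) (y : Co (sphere A m) m) :
    y = star (y (sphereGen A m m)) • sphereOne A m := by
  ext x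
  rw [StarDual.smul_apply, star_star]
  conv_lhs => rw [eq_smul_sphereGen m x, map_smul, smul_eq_mul]

theorem dDual_sphere (m p q : ℤ) (y : Co (sphere A m) p) : dDual (sphere A m) p q y = 0 := by
  ext x
  have : (sphere A m).d q p = 0 :=
    HomologicalComplex.single_obj_d (ComplexShape.down ℤ) m (ModuleCat.of A A) q p
  rw [dDual_apply, this]
  exact map_zero y

/-- The family on `S^m A` with a given value at the generator. -/
noncomputable def famOf (m : ℤ) (a : A) : Fam (sphere A m) := fun p q =>
  { toFun := fun x => StarDual.of
      { toFun := fun y => star (y (sphereGen A m q)) * a * x (sphereGen A m p)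
        map_add' := fun y y' => by rw [StarDual.add_apply, star_add, add_mul, add_mul]
        map_smul' := fun c y => by
          rw [StarDual.smul_apply, star_mul, star_star, RingHom.id_apply, smul_eq_mul, mul_assoc,
            mul_assoc, mul_assoc] }
    map_add' := fun x x' => by
      ext y
      change _ * (x + x') _ = _ * x _ + _ * x' _
      rw [StarDual.add_apply, mul_add]
    map_smul' := fun c x => by
      ext y
      change _ * (c • x) _ = (_ * x _) * star c
      rw [StarDual.smul_apply, mul_assoc, mul_assoc, mul_assoc] }

theorem famOf_apply (m : ℤ) (a : A) (p q : ℤ) (x : Co (sphere A m) p) (y : Co (sphere A m) q) :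
    famOf m a p q x y = star (y (sphereGen A m q)) * a * x (sphereGen A m p) := rfl

/-- Families on `S^m A` are determined by their value at the generator, an arbitrary element. -/
noncomputable def famEval (m : ℤ) : Fam (sphere A m) ≃+ A where
  toFun θ := θ m m (sphereOne A m) (sphereOne A m)
  invFun a := famOf m a
  left_inv θ := by
    apply Fam.ext'
    intro p q x y
    rw [famOf_apply]
    by_cases hp : p = m
    · by_cases hq : q = m
      · obtain rfl : m = p := hp.symm
        obtain rfl : m = q := hq.symm
        conv_rhs => rw [co_sphere_eq_smul m x, co_sphere_eq_smul m y]
        rw [map_smul, map_smul, StarDual.smul_apply, smul_eq_mul, star_star, mul_assoc]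
      · rw [co_sphere_eq_zero hq y]; simp
    · rw [co_sphere_eq_zero hp x]; simp
  right_inv a := by
    change famOf m a m m (sphereOne A m) (sphereOne A m) = a
    rw [famOf_apply, sphereOne_sphereGen, star_one, one_mul, mul_one]
  map_add' _ _ := rfl

theorem famEval_apply (m : ℤ) (θ : Fam (sphere A m)) :
    famEval m θ = θ m m (sphereOne A m) (sphereOne A m) := rfl

theorem famEval_eq_zero (m : ℤ) {θ : Fam (sphere A m)} : famEval m θ = 0 ↔ θ = 0 :=
  map_eq_zero_iff (famEval m) (famEval m).injective

theorem famEval_transT (m : ℤ) (θ : Fam (sphere A m)) :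
    famEval m (transT θ) = sgn m • star (famEval m θ) := by
  rw [famEval_apply, transT_apply, sgn_mul_self_index]; rfl

/-- The differentials of `S^m A` vanish and `(-1)^{m+m} = 1`, so only the identity and the
transposition contribute. -/
theorem famEval_tateD (m k : ℤ) (θ : Fam (sphere A m)) :
    famEval m (tateD k θ) = famEval m θ - sgn (k + m) • star (famEval m θ) := by
  rw [tateD_eq, map_sub, map_zsmul, famEval_transT, smul_smul, ← sgn_add]
  congr 1
  rw [famEval_apply, opE_apply, dDual_sphere, ← two_mul, sgn_two_mul]
  simp [famEval_apply]

/-- The only nonzero component has `p = q = m`, so the support condition concerns just `2m`. -/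
theorem mem_symChains_sphere {m k : ℤ} {θ : Fam (sphere A m)} :
    θ ∈ symChains (sphere A m) k ↔ (2 * m < k → famEval m θ = 0) := by
  constructor
  · intro h hm
    rw [famEval_apply, h m m (by omega)]; rfl
  · intro h p q hpq
    by_cases hp : p = m
    · by_cases hq : q = m
      · obtain rfl : m = p := hp.symm
        obtain rfl : m = q := hq.symm
        rw [(famEval_eq_zero m).1 (h (by omega))]; rfl
      · ext x y; rw [co_sphere_eq_zero hq y]; simp
    · ext x y; rw [co_sphere_eq_zero hp x]; simp

theorem SubQuot.map_bijective {G G' : Type*} [AddCommGroup G] [AddCommGroup G']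
    {Z D : AddSubgroup G} {Z' D' : AddSubgroup G'} (e : G ≃+ G') (hZ : ∀ z, z ∈ Z ↔ e z ∈ Z')
    (hD : ∀ z, z ∈ D ↔ e z ∈ D') :
    Function.Bijective (SubQuot.map (Z := Z) (D := D) (Z' := Z') (D' := D') (e : G →+ G')
      (fun z h => (hZ z).1 h) (fun z h => (hD z).1 h)) := by
  constructor
  · rw [injective_iff_map_eq_zero]
    intro x hx
    obtain ⟨z, hz, rfl⟩ := SubQuot.mk_surj x
    exact SubQuot.mk_eq_zero.2 ((hD z).2 (SubQuot.mk_eq_zero.1 hx))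
  · intro y
    obtain ⟨z, hz, rfl⟩ := SubQuot.mk_surj y
    obtain ⟨w, rfl⟩ := e.surjective z
    exact ⟨SubQuot.mk D w ((hZ w).2 hz), rfl⟩

/-- The surviving component has index `s = 2m - n = n - 2r`, which is why this is the cohomological
degree. -/
theorem mem_symCycles_sphere {n r m : ℤ} (hm : m + r = n) (θ : Fam (sphere A m)) :
    θ ∈ symCycles (sphere A m) n ↔ famEval m θ ∈ z2Cocycles A (sgn m) (n - 2 * r) := by
  have e : sgn (n - 2 * r) * sgn m = sgn (n + m) := by
    rw [sgn_sub, sgn_two_mul, mul_one, sgn_add]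
  rw [mem_symCycles, mem_symChains_sphere, ← famEval_eq_zero m (θ := tateD n θ),
    famEval_tateD, sub_eq_zero, ← e]
  subst hm
  change _ ↔ (_ → _) ∧ _
  rw [show 2 * m < m + r ↔ m + r - 2 * r < 0 by constructor <;> intro <;> omega]

/-- A bounding symmetric chain has degree `n + 1` and so vanishes already when `2m ≤ n`. This shift
by one is why nothing is divided out in `ℤ₂`-cohomology of degree `0`. -/
theorem mem_symBoundaries_sphere {n r m : ℤ} (hm : m + r = n) (θ : Fam (sphere A m)) :
    θ ∈ symBoundaries (sphere A m) n ↔ famEval m θ ∈ z2Boundaries A (sgn m) (n - 2 * r) := by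
  have e : sgn (n - 2 * r) * sgn m = - sgn (n + 1 + m) := by
    rw [sgn_sub, sgn_two_mul, mul_one, sgn_add, sgn_add_one]; ring
  constructor
  · rintro ⟨ξ, hξ, rfl⟩
    refine ⟨fun h => ?_, famEval m ξ, ?_⟩
    · rw [famEval_tateD, mem_symChains_sphere.1 hξ (by omega)]; simp
    · rw [famEval_tateD, e, neg_smul, sub_eq_add_neg]
  · rintro ⟨h0, x, hx⟩
    by_cases h : n - 2 * r ≤ 0
    · rw [(famEval_eq_zero m).1 (h0 h)]; exact zero_mem _
    · refine ⟨(famEval m).symm x, mem_symChains_sphere.2 (by omega), ?_⟩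
      apply (famEval m).injective
      rw [famEval_tateD, AddEquiv.apply_symm_apply, hx, e, neg_smul, sub_eq_add_neg]

/-- Evaluation `Q^n(S^m A) ≅ H^{n-2r}(ℤ₂; A, (-1)^m)` at the generator, for `m + r = n`. -/
noncomputable def symSphereEquiv {n r m : ℤ} (hm : m + r = n) :
    QSym (sphere A m) n ≃+ Z2Coh A (sgn m) (n - 2 * r) :=
  AddEquiv.ofBijective _ (SubQuot.map_bijective (famEval m) (mem_symCycles_sphere hm)
    (mem_symBoundaries_sphere hm))

theorem symSphereEquiv_mk {n r m : ℤ} (hm : m + r = n) (φ : Fam (sphere A m))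
    (hφ : φ ∈ symCycles (sphere A m) n) :
    symSphereEquiv hm (SubQuot.mk _ φ hφ) =
      SubQuot.mk _ (famEval m φ) ((mem_symCycles_sphere hm φ).1 hφ) := rfl

/-! ### Chains of `B^t ⊗_A S^m A` as elements of `B` -/

variable {B C : ChainComplex (ModuleCat.{u} A) ℤ}

/-- The chain of `B^t ⊗_A S^m A` with a given value at the generator. -/
noncomputable def crossOf (m k : ℤ) (b : ∀ i, B.X i) : Cross B (sphere A m) k := fun t =>
  { toFun := fun x => star (x (sphereGen A m t.1.1)) • b t.1.2
    map_add' := fun x x' => by rw [StarDual.add_apply, star_add, add_smul]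
    map_smul' := fun c x => by
      rw [StarDual.smul_apply, star_mul, star_star, mul_smul, RingHom.id_apply] }

/-- Chains of `B^t ⊗_A S^m A` are determined by their value at the generator. -/
noncomputable def crossEval {m i k : ℤ} (h : m + i = k) : Cross B (sphere A m) k ≃+ B.X i where
  toFun f := f ⟨(m, i), h⟩ (sphereOne A m)
  invFun b := crossOf m k (Pi.single i b)
  left_inv f := by
    funext ⟨⟨p, j⟩, hpj⟩
    ext x
    change star (x (sphereGen A m p)) • (Pi.single i _ : ∀ i, B.X i) j = _
    by_cases hp : p = m
    · obtain rfl : m = p := hp.symm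
      obtain rfl : i = j := by dsimp only at hpj; omega
      conv_rhs => rw [co_sphere_eq_smul m x, map_smul]
      rw [Pi.single_eq_same]
    · rw [co_sphere_eq_zero hp x]; simp
  right_inv b := by
    change star (sphereOne A m (sphereGen A m m)) • (Pi.single i b : ∀ i, B.X i) i = b
    rw [sphereOne_sphereGen, star_one, one_smul, Pi.single_eq_same]
  map_add' _ _ := rfl

theorem crossEval_apply {m i k : ℤ} (h : m + i = k) (f : Cross B (sphere A m) k) :
    crossEval h f = f ⟨(m, i), h⟩ (sphereOne A m) := rfl

theorem crossD_apply' {k l : ℤ} (h : l + 1 = k) (f : Cross B C k) {p p' i i' : ℤ}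
    (hp : p + 1 = p') (hi : i + 1 = i') (hpi : p + i = l) (x : Co C p) :
    crossD h f ⟨(p, i), hpi⟩ x = f ⟨(p', i), by omega⟩ (dDual C p p' x) +
      sgn p • (B.d i' i).hom (f ⟨(p, i'), by omega⟩ x) := by
  subst hp hi
  exact crossD_apply h f p i hpi x

theorem crossEval_crossD {m i i' k l : ℤ} (h : l + 1 = k) (hi : i + 1 = i') (hl : m + i = l)
    (hk : m + i' = k) (f : Cross B (sphere A m) k) :
    crossEval hl (crossD h f) = sgn m • (B.d i' i).hom (crossEval hk f) := by
  rw [crossEval_apply, crossD_apply' h f rfl hi, dDual_sphere, map_zero, zero_add]; rfl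

theorem mem_crossCycles_sphere {n r m : ℤ} (hm : m + r = n) (f : Cross B (sphere A m) n) :
    f ∈ crossCycles B (sphere A m) n ↔ (B.d r (r - 1)).hom (crossEval hm f) = 0 := by
  have hr : m + (r - 1) = n - 1 := by omega
  change crossD (sub_add_cancel n 1) f = 0 ↔ _
  rw [← (crossEval hr).map_eq_zero_iff,
    crossEval_crossD (sub_add_cancel n 1) (sub_add_cancel r 1) hr hm]
  rcases sgn_cases m with h | h <;> simp [h]

theorem famEval_mu (β : Bundle B) {m i j k l : ℤ} (hk : m + i = k) (hl : m + j = l)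
    (u : Cross B (sphere A m) k) (v : Cross B (sphere A m) l) :
    famEval m (mu β u v) = sgn (k * m) • β.β i j (crossEval hk u) (crossEval hl v) :=
  mu_apply β u v m m i j hk hl _ _

/-! ### Values at the generator after pushforward -/

section PushEval

variable {C' : ChainComplex (ModuleCat.{u} A) ℤ}

theorem coMap_toSphere {m : ℤ} (z : cocycles C m) :
    coMap (toSphere z) m (sphereOne A m) = z.1 := by
  ext x
  rw [coMap_apply, toSphere, HomologicalComplex.mkHomToSingle_f]
  change ((HomologicalComplex.singleObjXSelf (ComplexShape.down ℤ) m (ModuleCat.of A A)).inv ≫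
    (HomologicalComplex.singleObjXSelf (ComplexShape.down ℤ) m (ModuleCat.of A A)).hom).hom
      (z.1 x) = _
  rw [Iso.inv_hom_id]; rfl

theorem famEval_pushFam_toSphere {m : ℤ} (z : cocycles C m) (θ : Fam C) :
    famEval m (pushFam (toSphere z) θ) = θ m m z z := by
  rw [famEval_apply, pushFam_apply, coMap_toSphere]

theorem crossEval_pushCross_toSphere {m i k : ℤ} (h : m + i = k) (z : cocycles C m)
    (f : Cross B C k) : crossEval h (pushCross (toSphere z) f) = f ⟨(m, i), h⟩ z :=
  congrArg (f ⟨(m, i), h⟩) (coMap_toSphere z)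

/-- Scalars act on the dual by right multiplication with their conjugates, so it is right
multiplication by `c̄` that induces `c` on the generator. -/
theorem coMap_sphereMul (m : ℤ) (c : A) :
    coMap (sphereMul m (star c)) m (sphereOne A m) = c • sphereOne A m := by
  ext x
  rw [coMap_apply, sphereMul, HomologicalComplex.single_map_f_self, StarDual.smul_apply]
  change ((HomologicalComplex.singleObjXSelf (ComplexShape.down ℤ) m (ModuleCat.of A A)).inv ≫
    (HomologicalComplex.singleObjXSelf (ComplexShape.down ℤ) m (ModuleCat.of A A)).hom).hom
      (sphereOne A m x * star c) = _
  rw [Iso.inv_hom_id]; rfl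

theorem famEval_pushFam_sphereMul {m : ℤ} (c : A) (θ : Fam (sphere A m)) :
    famEval m (pushFam (sphereMul m (star c)) θ) = c * famEval m θ * star c := by
  rw [famEval_apply, pushFam_apply, coMap_sphereMul, map_smul, map_smul, StarDual.smul_apply,
    smul_eq_mul, mul_assoc]; rfl

theorem crossEval_pushCross_sphereMul {m i k : ℤ} (h : m + i = k) (c : A)
    (f : Cross B (sphere A m) k) :
    crossEval h (pushCross (sphereMul m (star c)) f) = c • crossEval h f :=
  (congrArg (f ⟨(m, i), h⟩) (coMap_sphereMul m c)).trans (map_smul _ _ _)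

end PushEval

end SphereEval

/-! ### Homology of `B` in terms of elements -/

section Homology

variable {A : Type u} [Ring A] {B : ChainComplex (ModuleCat.{u} A) ℤ} {r : ℤ}

theorem iCycles_injective : Function.Injective (B.iCycles r).hom :=
  (ModuleCat.mono_iff_injective _).1 inferInstance

theorem exists_iCycles_eq {b : B.X r} (h : (B.d r (r - 1)).hom b = 0) :
    ∃ y : B.cycles r, (B.iCycles r).hom y = b := by
  have hr : (ComplexShape.down ℤ).next r = r - 1 :=
    (ComplexShape.down ℤ).next_eq' (sub_add_cancel r 1)
  -- The element is viewed as the morphism `1 ↦ b` out of `A`, to which the universal property of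
  -- the cycles applies.
  let k : ModuleCat.of A A ⟶ B.X r := ModuleCat.ofHom (LinearMap.toSpanSingleton A (B.X r) b)
  have hk : k ≫ B.d r (r - 1) = 0 := by
    ext
    change (B.d r (r - 1)).hom ((1 : A) • b) = 0
    rw [one_smul, h]
  refine ⟨(B.liftCycles k (r - 1) hr hk).hom (1 : A), ?_⟩
  have := congrArg (fun t => t.hom (1 : A)) (B.liftCycles_i k (r - 1) hr hk)
  refine this.trans ?_
  change (1 : A) • b = b
  rw [one_smul]

theorem d_iCycles (y : B.cycles r) : (B.d r (r - 1)).hom ((B.iCycles r).hom y) = 0 := by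
  rw [← LinearMap.comp_apply, ← ModuleCat.hom_comp, B.iCycles_d]; rfl

theorem homologyπ_surjective : Function.Surjective (B.homologyπ r).hom :=
  (ModuleCat.epi_iff_surjective _).1 inferInstance

theorem homologyπ_eq_zero_iff (y : B.cycles r) :
    (B.homologyπ r).hom y = 0 ↔ ∃ x, (B.d (r + 1) r).hom x = (B.iCycles r).hom y := by
  have hr : (ComplexShape.down ℤ).prev r = r + 1 := (ComplexShape.down ℤ).prev_eq' rfl
  have hi : ∀ x, (B.iCycles r).hom ((B.toCycles (r + 1) r).hom x) = (B.d (r + 1) r).hom x :=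
    fun x => by rw [← LinearMap.comp_apply, ← ModuleCat.hom_comp, B.toCycles_i]
  constructor
  · intro h
    have hex := ShortComplex.exact_of_g_is_cokernel
      (ShortComplex.mk _ _ (B.toCycles_comp_homologyπ (r + 1) r)) (B.homologyIsCokernel (r + 1) r hr)
    obtain ⟨x, hx⟩ := (ShortComplex.moduleCat_exact_iff _).1 hex y h
    exact ⟨x, by rw [← hi]; exact congrArg _ hx⟩
  · rintro ⟨x, hx⟩
    rw [← hi] at hx
    rw [← iCycles_injective hx, ← LinearMap.comp_apply, ← ModuleCat.hom_comp,
      B.toCycles_comp_homologyπ]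
    rfl

theorem homologyπ_eq_iff (y y' : B.cycles r) :
    (B.homologyπ r).hom y = (B.homologyπ r).hom y' ↔
      ∃ x, (B.d (r + 1) r).hom x = (B.iCycles r).hom y' - (B.iCycles r).hom y := by
  rw [← map_sub, ← homologyπ_eq_zero_iff, map_sub, sub_eq_zero, eq_comm]

end Homology

/-! ### Equivalence of structures on the sphere and equivalence of pairs -/

section SphereRelation

variable {A : Type u} [Ring A] [StarRing A]
variable {B C : ChainComplex (ModuleCat.{u} A) ℤ} {β : Bundle B} {n r m : ℤ}

/-- The change of the quadratic refinement along a homotopy `y` from `b` to `b'`. -/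
def Bundle.htpyTerm (β : Bundle B) (r : ℤ) (b b' : B.X r) (y : B.X (r + 1)) : A :=
  sgn r • β.β r (r + 1) b y + β.β (r + 1) r y b' + star (β.β (r + 1) (r + 1) y y)

/-- The bundle cycle condition at `(y, y)` expresses the conjugate of `β(y)(y)` through `β(y)(dy)`,
`β(dy)(y)` and `β(y)(y)`. With `dy = b' - b` this exchanges the roles of `b` and `b'` and gives the
form used in `SphereRel`. -/
theorem Bundle.htpyTerm_eq (β : Bundle B) {b b' : B.X r} {y : B.X (r + 1)}
    (h : b' - b = (B.d (r + 1) r).hom y) :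
    β.htpyTerm r b b' y = β.β (r + 1) r y b + sgn r • β.β r (r + 1) b' y -
      sgn r • β.β (r + 1) (r + 1) y y := by
  have hc := β.cycle' (i := r + 1) (j := r + 1) rfl rfl y y
  obtain rfl : b' = b + (B.d (r + 1) r).hom y := by rw [← h]; abel
  rw [sgn_mul_self_index, sgn_add_one, sgn_add_one, sgn_add_one, ← two_mul, sgn_two_mul] at hc
  rw [Bundle.htpyTerm]
  simp only [map_add, StarDual.add_apply, smul_add]
  generalize (β.β (r + 1) r) y ((B.d (r + 1) r).hom y) = c1 at hc ⊢
  generalize (β.β r (r + 1)) ((B.d (r + 1) r).hom y) y = c2 at hc ⊢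
  generalize (β.β (r + 1) (r + 1)) y y = c3 at hc ⊢
  rcases sgn_cases r with hr | hr
  · simp only [hr, one_smul, neg_smul, neg_neg] at hc ⊢
    rw [neg_eq_iff_eq_neg.1 hc]
    abel
  · simp only [hr, one_smul, neg_smul, neg_neg] at hc ⊢
    rw [hc]
    abel

theorem sphereRel_iff (w w' : SpherePair β n r) :
    SphereRel β n r w w' ↔ ∃ (x : A) (y : B.X (r + 1)),
      w'.1.1 - w.1.1 = x - sgn r • star x - β.htpyTerm r w.1.2 w'.1.2 y ∧
      w'.1.2 - w.1.2 = (B.d (r + 1) r).hom y := by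
  refine exists_congr fun x => exists_congr fun y => and_congr_left fun h => ?_
  rw [β.htpyTerm_eq h, sgn_add_one, neg_smul]
  constructor <;> intro h <;> rw [h] <;> abel

theorem famEval_pullHtpy (hm : m + r = n) (hg : m + (r + 1) = n + 1)
    (g : Cross B (sphere A m) (n + 1)) (f f' : Cross B (sphere A m) n) :
    sgn (n * m) • famEval m (pullHtpy β g f f') =
      β.htpyTerm r (crossEval hm f) (crossEval hm f') (sgn m • crossEval hg g) := by
  have e1 : sgn ((n + 1) * m) = sgn (n * m) * sgn m := by rw [add_mul, one_mul, sgn_add]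
  have e2 : sgn n = sgn m * sgn r := by rw [← hm, sgn_add]
  rw [pullHtpy, map_add, map_add, map_zsmul, famEval_transT, famEval_mu β hm hg,
    famEval_mu β hg hm, famEval_mu β hg hg, e1, e2, Bundle.htpyTerm]
  rcases sgn_cases m with h | h <;> rcases sgn_cases (n * m) with h' | h' <;>
    rcases sgn_cases r with h'' | h'' <;> simp [h, h', h'']

/-- This is the structure equation read at the generator; it shows that `φ` is determined by `θ` and
`f`. -/
theorem BStr.famEval_φ (hm : m + r = n) (σ : BStr β (sphere A m) n) :
    famEval m σ.φ = sgn (n * m) • β.β r r (crossEval hm σ.f) (crossEval hm σ.f) +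
      (famEval m σ.θ + sgn r • star (famEval m σ.θ)) := by
  have e : sgn (n + 1 + m) = - sgn r := by
    rw [← hm, sgn_add, sgn_add_one, sgn_add]
    rcases sgn_cases m with h | h <;> simp [h]
  have h := congrArg (famEval m) σ.hθ
  rw [map_sub, pull, famEval_mu β hm hm, famEval_tateD, e, neg_smul, sub_neg_eq_add] at h
  rw [← h]; abel

theorem BStr.famEval_φ_eq_zero (hm : m + r = n) (h : n < 2 * r) (σ : BStr β (sphere A m) n) :
    famEval m σ.φ = 0 := mem_symChains_sphere.1 σ.hφ.1 (by omega)

/-- The pair `((-1)^{nm} θ_{n-2r-1}(1)(1), f^*(1))` of a structure on `S^m A`. -/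
noncomputable def BStr.spherePair (hm : m + r = n) (σ : BStr β (sphere A m) n) :
    SpherePair β n r :=
  ⟨(sgn (n * m) • famEval m σ.θ, crossEval hm σ.f), (mem_crossCycles_sphere hm _).1 σ.hf, by
    intro h
    have h1 := σ.famEval_φ hm
    rw [σ.famEval_φ_eq_zero hm h] at h1
    dsimp only
    rw [star_zsmul]
    rcases sgn_cases (n * m) with h | h
    · simp only [h, one_smul] at h1 ⊢
      rw [h1]; abel
    · simp only [h, neg_smul, one_smul, smul_neg] at h1 ⊢
      rw [← neg_eq_zero, h1]; abel⟩

/-- The differential terms of the bundle condition vanish on cycles, leaving `(-1)^r`-symmetry. -/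
theorem Bundle.star_apply_cycle (β : Bundle B) {b b' : B.X r} (hb : (B.d r (r - 1)).hom b = 0)
    (hb' : (B.d r (r - 1)).hom b' = 0) : sgn r • star (β.β r r b' b) = β.β r r b b' := by
  have := β.cycle' (sub_add_cancel r 1) (sub_add_cancel r 1) b b'
  rw [hb, hb', sgn_mul_self_index, ← two_mul, sgn_two_mul] at this
  simpa using this

/-- The structure on `S^m A` with a given pair. -/
noncomputable def SpherePair.toBStr (hm : m + r = n) (h : n ≤ 2 * r) (w : SpherePair β n r) :
    BStr β (sphere A m) n where
  φ := (famEval m).symm (w.1.1 + sgn r • star w.1.1 + β.β r r w.1.2 w.1.2)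
  θ := (famEval m).symm (sgn (n * m) • w.1.1)
  f := (crossEval hm).symm w.1.2
  hφ := by
    rw [mem_symCycles_sphere hm, AddEquiv.apply_symm_apply]
    refine ⟨fun h => w.2.2 (by omega), ?_⟩
    have e : sgn (n - 2 * r) * sgn m = sgn r := by
      rw [sgn_sub, sgn_two_mul, mul_one, ← hm, sgn_add]
      rcases sgn_cases m with h | h <;> simp [h]
    have hb := β.star_apply_cycle w.2.1 w.2.1
    rw [e, star_add, star_add, smul_add, hb, smul_add, star_zsmul, sgn_smul_sgn_smul, star_star]
    abel
  hf := by rw [mem_crossCycles_sphere hm, AddEquiv.apply_symm_apply]; exact w.2.1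
  hθ := by
    apply (famEval m).injective
    have e : sgn (n + 1 + m) = - sgn r := by
      rw [← hm, sgn_add, sgn_add_one, sgn_add]
      rcases sgn_cases m with h | h <;> simp [h]
    rw [map_sub, pull, famEval_mu β hm hm, famEval_tateD, e, neg_smul, sub_neg_eq_add]
    simp only [AddEquiv.apply_symm_apply]
    -- The sign `(-1)^{nm}` was left out of `φ`. For `n < 2r` the value is `0` by the condition on
    -- the pair, and for `n = 2r` the sign is `1`.
    rcases h.lt_or_eq with h | h
    · have hw := w.2.2 h
      rw [hw, eq_neg_of_add_eq_zero_right hw, star_zsmul]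
      rcases sgn_cases (n * m) with h | h <;> simp [h]
    · have : sgn (n * m) = 1 := by rw [h, mul_assoc, sgn_two_mul]
      rw [this, one_smul, one_smul]; abel

theorem SpherePair.spherePair_toBStr (hm : m + r = n) (h : n ≤ 2 * r) (w : SpherePair β n r) :
    (w.toBStr hm h).spherePair hm = w := by
  refine Subtype.ext (Prod.ext ?_ ?_)
  · change sgn (n * m) • famEval m ((famEval m).symm (sgn (n * m) • w.1.1)) = _
    rw [AddEquiv.apply_symm_apply, sgn_smul_sgn_smul]
  · exact (crossEval hm).apply_symm_apply _

theorem famEval_tateD_add_two (hm : m + r = n) (η : Fam (sphere A m)) :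
    famEval m (tateD (n + 2) η) = famEval m η - sgn r • star (famEval m η) := by
  have e : sgn (n + 2 + m) = sgn r := by
    rw [← hm, sgn_add, sgn_add_two, sgn_add]
    rcases sgn_cases m with h | h <;> simp [h]
  rw [famEval_tateD, e]

theorem crossD_eq_iff (hm : m + r = n) (hg : m + (r + 1) = n + 1)
    (g : Cross B (sphere A m) (n + 1)) (f : Cross B (sphere A m) n) :
    crossD rfl g = f ↔ (B.d (r + 1) r).hom (sgn m • crossEval hg g) = crossEval hm f := by
  rw [← (crossEval hm).apply_eq_iff_eq, crossEval_crossD rfl rfl hm hg, map_zsmul]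

/-- For `n ≤ 2r` one has `2m < n + 1`, so `ξ` evaluates to `0`. The condition on `η` becomes the
relation on the first entries and the homotopy `g` the one on the second. -/
theorem BStr.rel_iff_sphereRel (hm : m + r = n) (h : n ≤ 2 * r) (a b : BStr β (sphere A m) n) :
    a.Rel b ↔ SphereRel β n r (a.spherePair hm) (b.spherePair hm) := by
  have hg : m + (r + 1) = n + 1 := by omega
  rw [sphereRel_iff]
  constructor
  · rintro ⟨ξ, η, g, hξ, -, h2, h3⟩
    refine ⟨-(sgn (n * m) • famEval m η), sgn m • crossEval hg g, ?_, ?_⟩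
    · have h4 := congrArg (famEval m) h3
      rw [map_add, map_sub, map_sub, mem_symChains_sphere.1 hξ (by omega),
        famEval_tateD_add_two hm] at h4
      change sgn (n * m) • famEval m b.θ - sgn (n * m) • famEval m a.θ =
        _ - _ - β.htpyTerm r (crossEval hm a.f) (crossEval hm b.f) _
      rw [← famEval_pullHtpy hm hg]
      have h5 : sgn (n * m) • famEval m b.θ - sgn (n * m) • famEval m a.θ =
          -(sgn (n * m) • (0 - famEval m (pullHtpy β g a.f b.f) - famEval m b.θ + famEval m a.θ)) -
            sgn (n * m) • famEval m (pullHtpy β g a.f b.f) := by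
        simp only [smul_add, smul_sub, smul_zero]; abel
      rw [h5, h4, star_neg, star_zsmul, smul_sub, smul_neg, smul_comm (sgn r) (sgn (n * m))]
      abel
    · exact ((crossD_eq_iff hm hg _ _).1 h2).symm
  · rintro ⟨x, y, h1, h2⟩
    -- The signs invert those of the forward direction: `x = -(-1)^{nm} η(1)(1)`, and `y = (-1)^m
    -- g^*(1)` because the differential of `B^t ⊗ S^m A` carries the sign `(-1)^m`.
    refine BStr.Rel.of_htpy (ξ := 0) (η := (famEval m).symm (-(sgn (n * m) • x)))
      (g := (crossEval hg).symm (sgn m • y)) (zero_mem _) ?_ ?_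
    · rw [crossD_eq_iff hm hg, AddEquiv.apply_symm_apply, sgn_smul_sgn_smul, ← h2]; rfl
    · apply (famEval m).injective
      have h5 := famEval_pullHtpy (β := β) hm hg ((crossEval hg).symm (sgn m • y)) a.f b.f
      rw [AddEquiv.apply_symm_apply, sgn_smul_sgn_smul] at h5
      change sgn (n * m) • famEval m b.θ - sgn (n * m) • famEval m a.θ =
        _ - _ - β.htpyTerm r (crossEval hm a.f) (crossEval hm b.f) y at h1
      rw [← h5] at h1
      rw [famEval_tateD_add_two hm, map_add, map_sub, map_sub, map_zero, AddEquiv.apply_symm_apply,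
        star_neg, star_zsmul, smul_neg, smul_comm (sgn r) (sgn (n * m))]
      have h6 := congrArg (fun t => -(sgn (n * m) • t)) h1
      simp only [smul_sub, sgn_smul_sgn_smul] at h6
      refine sub_eq_zero.1 (Eq.trans ?_ (sub_eq_zero.2 h6))
      abel

/-! ### The groups `Q⟨B, β⟩^n(S^m A)` -/

/-- Every pair is realized by a structure, so the properties are inherited from equivalence of
structures. -/
theorem sphereRel_equivalence (hm : m + r = n) (h : n ≤ 2 * r) :
    _root_.Equivalence (SphereRel β n r) := by
  have key : ∀ w w' : SpherePair β n r,
      SphereRel β n r w w' ↔ (w.toBStr hm h).Rel (w'.toBStr hm h) := fun w w' => by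
    rw [BStr.rel_iff_sphereRel hm h, SpherePair.spherePair_toBStr, SpherePair.spherePair_toBStr]
  exact ⟨fun w => (key w w).2 (BStr.Rel.refl _), fun h => (key _ _).2 ((key _ _).1 h).symm,
    fun h h' => (key _ _).2 (((key _ _).1 h).trans ((key _ _).1 h'))⟩

/-- The bijection of `Q⟨B, β⟩^n(S^m A)` with classes of pairs, for `2r ≥ n`. -/
noncomputable def QB.sphereEquivQuot (β : Bundle B) (hm : m + r = n) (h : n ≤ 2 * r) :
    QB β (sphere A m) n ≃ Quot (SphereRel β n r) where
  toFun := Quotient.lift (fun σ => Quot.mk _ (BStr.spherePair hm σ)) fun a b hab =>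
    Quot.sound ((BStr.rel_iff_sphereRel hm h a b).1 hab)
  invFun := Quot.lift (fun w => QB.mk (w.toBStr hm h)) fun w w' hw => QB.mk_eq_mk.2 (by
    rwa [BStr.rel_iff_sphereRel hm h, SpherePair.spherePair_toBStr, SpherePair.spherePair_toBStr])
  left_inv := by
    rintro ⟨σ⟩
    refine QB.mk_eq_mk.2 ?_
    rw [BStr.rel_iff_sphereRel hm h, SpherePair.spherePair_toBStr]
    exact (sphereRel_equivalence hm h).refl _
  right_inv := by
    rintro ⟨w⟩
    exact congrArg (Quot.mk _) (SpherePair.spherePair_toBStr hm h w)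

theorem QB.mk_eq_sphereEquivQuot_symm (hm : m + r = n) (h : n ≤ 2 * r)
    (σ : BStr β (sphere A m) n) :
    QB.mk σ = (QB.sphereEquivQuot β hm h).symm (Quot.mk _ (σ.spherePair hm)) := by
  rw [Equiv.eq_symm_apply]; rfl

/-- The correction in the sum of structures contains the conjugate of `β(b')(b)`; symmetry of `β` on
cycles turns it into `-β(b)(b')`. -/
theorem BStr.spherePair_add (hm : m + r = n) (σ τ : BStr β (sphere A m) n) :
    ((σ + τ).spherePair hm).1 = ((σ.spherePair hm).1.1 + (τ.spherePair hm).1.1 -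
      β.β r r (σ.spherePair hm).1.2 (τ.spherePair hm).1.2,
      (σ.spherePair hm).1.2 + (τ.spherePair hm).1.2) := by
  refine Prod.ext ?_ rfl
  change sgn (n * m) • famEval m (σ + τ).θ = sgn (n * m) • famEval m σ.θ +
    sgn (n * m) • famEval m τ.θ - β.β r r (crossEval hm σ.f) (crossEval hm τ.f)
  have e : sgn n = sgn m * sgn r := by rw [← hm, sgn_add]
  rw [BStr.add_θ, map_add, map_add, pullSum, map_neg, map_zsmul, famEval_transT,
    famEval_mu β hm hm, ← β.star_apply_cycle (b := crossEval hm σ.f) (b' := crossEval hm τ.f)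
      (σ.spherePair hm).2.1 (τ.spherePair hm).2.1, e]
  rcases sgn_cases m with h | h <;> rcases sgn_cases (n * m) with h' | h' <;>
    simp [h, h', sub_eq_add_neg]

theorem BStr.spherePair_push_sphereMul (hm : m + r = n) (c : A) (σ : BStr β (sphere A m) n) :
    ((σ.push (sphereMul m (star c))).spherePair hm).1 =
      (c * (σ.spherePair hm).1.1 * star c, c • (σ.spherePair hm).1.2) := by
  refine Prod.ext ?_ (crossEval_pushCross_sphereMul hm c σ.f)
  change sgn (n * m) • famEval m (pushFam _ σ.θ) = c * (sgn (n * m) • famEval m σ.θ) * star c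
  rw [famEval_pushFam_sphereMul, mul_smul_comm, smul_mul_assoc]

theorem BStr.spherePair_push_toSphere (hm : m + r = n) (σ : BStr β C n) (z : cocycles C m) :
    ((σ.push (toSphere z)).spherePair hm).1 =
      (sgn (n * m) • σ.θ m m z z, σ.f ⟨(m, r), hm⟩ z) := by
  refine Prod.ext ?_ (crossEval_pushCross_toSphere hm z σ.f)
  exact congrArg (sgn (n * m) • ·) (famEval_pushFam_toSphere z σ.θ)

theorem QB.toSym_sphere_eq_zero (hm : m + r = n) (h : n < 2 * r) :
    QB.toSym (sphere A m) β n = 0 := by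
  refine DFunLike.ext _ _ fun x => ?_
  obtain ⟨σ, rfl⟩ := QB.mk_surj x
  refine SubQuot.mk_eq_zero.2 ?_
  rw [(famEval_eq_zero m).1 (σ.famEval_φ_eq_zero hm h)]
  exact zero_mem _

/-- Now `2m ≥ n + 1`, so the support condition on `ξ` is empty and `ξ` can be chosen to make the `η`
equation hold with `η = 0`. Only the homology of the chain maps is left. -/
theorem BStr.rel_iff_of_lt (hm : m + r = n) (h : 2 * r < n) (a b : BStr β (sphere A m) n) :
    a.Rel b ↔ ∃ y, (B.d (r + 1) r).hom y = crossEval hm b.f - crossEval hm a.f := by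
  have hg : m + (r + 1) = n + 1 := by omega
  constructor
  · rintro ⟨-, -, g, -, -, h2, -⟩
    exact ⟨_, (crossD_eq_iff hm hg _ _).1 h2⟩
  · rintro ⟨y, hy⟩
    refine BStr.Rel.of_htpy (η := 0) (g := (crossEval hg).symm (sgn m • y))
      (ξ := pullHtpy β ((crossEval hg).symm (sgn m • y)) a.f b.f + b.θ - a.θ)
      (mem_symChains_sphere.2 (by omega)) ?_ ?_
    · rw [crossD_eq_iff hm hg, AddEquiv.apply_symm_apply, sgn_smul_sgn_smul, hy]; rfl
    · rw [map_zero]; abel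

theorem BStr.exists_iCycles (hm : m + r = n) (σ : BStr β (sphere A m) n) :
    ∃ y : B.cycles r, (B.iCycles r).hom y = crossEval hm σ.f :=
  exists_iCycles_eq ((mem_crossCycles_sphere hm _).1 σ.hf)

/-- The pulled back bundle is itself a symmetric cycle in this range, so `θ = 0` is allowed. -/
theorem BStr.exists_of_lt (β : Bundle B) (hm : m + r = n) (h : 2 * r < n) (y : B.cycles r) :
    ∃ σ : BStr β (sphere A m) n, crossEval hm σ.f = (B.iCycles r).hom y ∧ σ.φ = pull β σ.f := by
  have hf : (crossEval hm).symm ((B.iCycles r).hom y) ∈ crossCycles B (sphere A m) n := by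
    rw [mem_crossCycles_sphere hm, AddEquiv.apply_symm_apply, d_iCycles]
  exact ⟨⟨pull β _, 0, _, ⟨mem_symChains_sphere.2 (by omega), pull_mem β hf⟩, hf, by
    rw [sub_self, map_zero]⟩, AddEquiv.apply_symm_apply _ _, rfl⟩

/-- The isomorphism `Q⟨B, β⟩^n(S^m A) ≅ H_r(B)` for `2r < n`. -/
theorem QB.exists_sphereEquivHomology (β : Bundle B) (hm : m + r = n) (h : 2 * r < n) :
    ∃ e : QB β (sphere A m) n ≃+ B.homology r,
      ∀ (σ : BStr β (sphere A m) n) (y : B.cycles r),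
        (B.iCycles r).hom y = crossEval hm σ.f → e (QB.mk σ) = (B.homologyπ r).hom y := by
  -- Lifts to the cycle object are unique, so the choice affects neither additivity nor the final
  -- formula.
  choose c hc using fun σ : BStr β (sphere A m) n => σ.exists_iCycles hm
  have hrel : ∀ a b : BStr β (sphere A m) n,
      a.Rel b ↔ (B.homologyπ r).hom (c a) = (B.homologyπ r).hom (c b) := fun a b => by
    rw [BStr.rel_iff_of_lt hm h, homologyπ_eq_iff, hc, hc]
  let e₀ : QB β (sphere A m) n →+ B.homology r :=
    AddMonoidHom.mk' (Quotient.lift (fun σ => (B.homologyπ r).hom (c σ))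
      fun a b hab => (hrel a b).1 hab) (by
      rintro ⟨a⟩ ⟨b⟩
      change (B.homologyπ r).hom (c (a + b)) =
        (B.homologyπ r).hom (c a) + (B.homologyπ r).hom (c b)
      rw [← map_add]
      congr 1
      apply iCycles_injective
      rw [map_add, hc, hc, hc, BStr.add_f, map_add])
  have hbij : Function.Bijective e₀ := by
    constructor
    · rintro ⟨a⟩ ⟨b⟩ hab
      exact QB.mk_eq_mk.2 ((hrel a b).2 hab)
    · intro x
      obtain ⟨y, rfl⟩ := homologyπ_surjective x
      obtain ⟨σ, hσ, -⟩ := BStr.exists_of_lt β hm h y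
      refine ⟨QB.mk σ, congrArg (B.homologyπ r).hom (iCycles_injective ?_)⟩
      rw [hc, hσ]
  refine ⟨AddEquiv.ofBijective e₀ hbij, fun σ y hy => ?_⟩
  exact congrArg (B.homologyπ r).hom (iCycles_injective (by rw [hc, hy]))

/-! ### Wu classes -/

theorem BStr.hθ_apply (σ : BStr β C n) (p q : ℤ) (x : Co C p) (y : Co C q) :
    σ.φ p q x y - pull β σ.f p q x y =
      opE σ.θ p q x y + sgn n • transT σ.θ p q x y := by
  have h := σ.hθ
  rw [tateD_eq, sgn_add_one, neg_smul, sub_neg_eq_add] at h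
  exact DFunLike.congr_fun (DFunLike.congr_fun (congrFun (congrFun h p) q) x) y

end SphereRelation

/-! ### Invariance, additivity and equivariance of Wu classes -/

section Wu

variable {A : Type u} [Ring A] [StarRing A]
variable {B C : ChainComplex (ModuleCat.{u} A) ℤ} {β : Bundle B} {n r m : ℤ}

theorem opE_apply' (θ : Fam C) {p q p' q' : ℤ} (hp : p + 1 = p') (hq : q + 1 = q') (x : Co C p)
    (y : Co C q) : opE θ p q x y = θ p q' x (dDual C q q' y) +
      sgn q • θ p' q (dDual C p p' x) y + sgn (p + q) • θ p q x y := by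
  subst hp hq
  exact opE_apply θ p q x y

/-- The chain map condition at `w` turns the coboundary `dw` into a boundary in `B`. -/
theorem BStr.f_sub_eq (hm : m + r = n) (σ : BStr β C n)
    (z z' : cocycles C m) (w : Co C (m - 1)) (hz : z'.1 - z.1 = dDual C (m - 1) m w) :
    σ.f ⟨(m, r), hm⟩ z'.1 - σ.f ⟨(m, r), hm⟩ z.1 =
      (B.d (r + 1) r).hom (sgn m • σ.f ⟨(m - 1, r + 1), by omega⟩ w) := by
  have h0 : crossD (sub_add_cancel n 1) σ.f = 0 := σ.hf
  have h1 : crossD (sub_add_cancel n 1) σ.f ⟨(m - 1, r), by omega⟩ w = 0 := by rw [h0]; rfl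
  rw [crossD_apply' _ _ (sub_add_cancel m 1) rfl, ← hz, map_sub] at h1
  rw [map_zsmul, eq_neg_of_add_eq_zero_left h1, sgn_sub]
  simp [sgn_eq_ite]

/-- The hypotheses are the structure equation at `(w, z')`, `(z, w)` and `(w, w)`, with `e =
(-1)^{nm}`, `s = (-1)^m`, `t = (-1)^r`. In the combination with coefficients `es`, `e`, `es` the
mixed value `θ(z)(z')` cancels, and the values of `θ` involving `w` assemble into `x - t x̄`. -/
theorem wu_algebra {e s t : ℤ} (he : e = 1 ∨ e = -1) (hs : s = 1 ∨ s = -1) (ht : t = 1 ∨ t = -1)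
    {t11 t01 t00 a1 a0 c1 c0 v b1 b2 b3 : A}
    (E1 : 0 - e • b1 = 0 + s • (t11 - t01) + (-1 : ℤ) • a1 + (s * t) • (1 : ℤ) • star c1)
    (E2 : 0 - (e * (s * t)) • b2 = t01 - t00 + 0 + (-1 : ℤ) • c0 +
      (s * t) • (1 : ℤ) • star a0)
    (E3 : 0 - (e * (s * t)) • b3 = a1 - a0 + -s • (c1 - c0) + (1 : ℤ) • v +
      (s * t) • -s • star v) :
    e • t11 - e • t00 = e • (s • a0 + c1 - s • v) - t • b3 -
      t • star (e • (s • a0 + c1 - s • v) - t • b3) -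
      (t • s • b2 + s • b1 + star (s • s • b3)) := by
  have h : e • s • ((0 + s • (t11 - t01) + (-1 : ℤ) • a1 + (s * t) • (1 : ℤ) • star c1) -
        (0 - e • b1)) +
      e • ((t01 - t00 + 0 + (-1 : ℤ) • c0 + (s * t) • (1 : ℤ) • star a0) -
        (0 - (e * (s * t)) • b2)) +
      e • s • ((a1 - a0 + -s • (c1 - c0) + (1 : ℤ) • v + (s * t) • -s • star v) -
        (0 - (e * (s * t)) • b3)) = 0 := by
    rw [← E1, ← E2, ← E3]; simp
  refine sub_eq_zero.1 (Eq.trans ?_ h)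
  rcases he with rfl | rfl <;> rcases hs with rfl | rfl <;> rcases ht with rfl | rfl <;>
    simp only [one_smul, neg_smul, mul_one, mul_neg, star_add, star_sub, star_neg,
      neg_neg, zero_add, zero_sub] <;> abel

/-- The value of `v_r` does not change when a coboundary is added. -/
theorem BStr.spherePair_rel_add_dDual (hm : m + r = n) (h : n ≤ 2 * r) (σ : BStr β C n)
    (z z' : cocycles C m) (w : Co C (m - 1)) (hz : z'.1 - z.1 = dDual C (m - 1) m w) :
    SphereRel β n r ((σ.push (toSphere z)).spherePair hm)
      ((σ.push (toSphere z')).spherePair hm) := by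
  have hw : (m - 1) + (r + 1) = n := by omega
  have hm1 : m - 1 + 1 = m := by omega
  have hcoc : ∀ z : cocycles C m, dDual C m (m + 1) z.1 = 0 := fun z => z.2
  -- Since `2m ≤ n`, the three components used below have `p + q < 2m ≤ n`, so `φ` drops out of
  -- them.
  have hφ : ∀ p q, p + q < n → ∀ x y, σ.φ p q x y = 0 := fun p q hpq x y => by
    rw [σ.hφ.1 p q hpq]; rfl
  have hf := σ.f_sub_eq hm z z' w hz
  rw [sphereRel_iff, BStr.spherePair_push_toSphere, BStr.spherePair_push_toSphere]
  have s1 : sgn (m - 1) = -sgn m := by rw [sgn_sub]; simp [sgn_eq_ite]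
  have s2 : sgn (m - 1 + m) = -1 := by rw [sgn_add, s1, neg_mul, sgn_mul_self]
  have s3 : sgn (m + (m - 1)) = -1 := by rw [add_comm, s2]
  have s4 : sgn ((m - 1) * m) = 1 := by
    rw [sub_mul, one_mul, sgn_sub, sgn_mul_self_index, sgn_mul_self]
  have s5 : sgn (m * (m - 1)) = 1 := by rw [mul_comm, s4]
  have s6 : sgn (m - 1 + (m - 1)) = 1 := by rw [← two_mul, sgn_two_mul]
  have s7 : sgn ((m - 1) * (m - 1)) = -sgn m := by rw [sgn_mul_self_index, s1]
  have s8 : sgn (n * (m - 1)) = sgn (n * m) * sgn n := by rw [mul_sub, mul_one, sgn_sub]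
  have s9 : sgn n = sgn m * sgn r := by rw [← hm, sgn_add]
  have E1 := σ.hθ_apply (m - 1) m w z'.1
  rw [hφ _ _ (by omega), pull, mu_apply β _ _ _ _ _ _ hw hm, opE_apply' _ hm1 rfl, transT_apply,
    hcoc, map_zero, s2, s4, ← hz] at E1
  have E2 := σ.hθ_apply m (m - 1) z.1 w
  rw [hφ _ _ (by omega), pull, mu_apply β _ _ _ _ _ _ hm hw, opE_apply' _ rfl hm1, transT_apply,
    hcoc, map_zero, s3, s5, s8, ← hz] at E2
  have E3 := σ.hθ_apply (m - 1) (m - 1) w w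
  rw [hφ _ _ (by omega), pull, mu_apply β _ _ _ _ _ _ hw hw, opE_apply' _ hm1 hm1, transT_apply,
    s1, s6, s7, s8, ← hz] at E3
  simp only [map_sub, StarDual.sub_apply, StarDual.zero_apply, smul_zero, s9] at E1 E2 E3
  -- The final `β` term of `x` replaces the conjugate of `β(y)(y)` in the homotopy term by the
  -- unconjugated value occurring in the equation at `(w, w)`.
  refine ⟨sgn (n * m) • (sgn m • σ.θ (m - 1) m w z.1 + σ.θ m (m - 1) z'.1 w -
    sgn m • σ.θ (m - 1) (m - 1) w w) - sgn r •
      β.β (r + 1) (r + 1) (σ.f ⟨(m - 1, r + 1), hw⟩ w) (σ.f ⟨(m - 1, r + 1), hw⟩ w),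
    sgn m • σ.f ⟨(m - 1, r + 1), hw⟩ w, ?_, hf⟩
  rw [Bundle.htpyTerm]
  simp only [map_zsmul, StarDual.zsmul_apply]
  exact wu_algebra (sgn_cases _) (sgn_cases _) (sgn_cases _) E1 E2 E3

theorem BStr.wu_eq_of_sub_mem (hm : m + r = n) (σ : BStr β C n) (z z' : cocycles C m)
    (w : Co C (m - 1)) (hz : z'.1 - z.1 = dDual C (m - 1) m w) : σ.wu z = σ.wu z' := by
  refine QB.mk_eq_mk.2 ?_
  rcases lt_or_ge (2 * r) n with h | h
  · rw [BStr.rel_iff_of_lt hm h]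
    refine ⟨_, (σ.f_sub_eq hm z z' w hz).symm.trans ?_⟩
    change _ = crossEval hm (pushCross _ _) - crossEval hm (pushCross _ _)
    rw [crossEval_pushCross_toSphere, crossEval_pushCross_toSphere]
  · rw [BStr.rel_iff_sphereRel hm h]
    exact σ.spherePair_rel_add_dDual hm h z z' w hz

theorem SphereRel.of_sub {w w' : SpherePair β n r} (x : A)
    (h : w'.1.1 - w.1.1 = x - sgn r • star x) (h2 : w'.1.2 = w.1.2) : SphereRel β n r w w' := by
  refine (sphereRel_iff w w').2 ⟨x, 0, ?_, by rw [h2, sub_self, map_zero]⟩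
  rw [h, Bundle.htpyTerm]
  simp

/-- All terms of the structure equation with a dual differential vanish on cocycles. This is the
polarized form of `BStr.famEval_φ`. -/
theorem BStr.φ_apply_cocycles (hm : m + r = n) (σ : BStr β C n) (z z' : cocycles C m) :
    σ.φ m m z z' = sgn (n * m) • β.β r r (σ.f ⟨(m, r), hm⟩ z) (σ.f ⟨(m, r), hm⟩ z') +
      (σ.θ m m z z' + sgn r • star (σ.θ m m z' z)) := by
  have hcoc : ∀ z : cocycles C m, dDual C m (m + 1) z.1 = 0 := fun z => z.2
  have e : sgn n * sgn m = sgn r := by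
    rw [← hm, sgn_add]
    rcases sgn_cases m with h | h <;> simp [h]
  have E := σ.hθ_apply m m z.1 z'.1
  rw [pull, mu_apply β _ _ _ _ _ _ hm hm, opE_apply, transT_apply, hcoc, hcoc, map_zero, map_zero,
    ← two_mul, sgn_two_mul, sgn_mul_self_index, smul_smul, e] at E
  rw [sub_eq_iff_eq_add'.1 E]
  simp

/-- The failure of additivity of the Wu class, for `2r ≥ n`. -/
theorem BStr.spherePair_add_rel (hm : m + r = n) (σ : BStr β C n) (z z' : cocycles C m)
    {w : SpherePair β n r}
    (hw : w.1 = ((((σ.push (toSphere z)) + (σ.push (toSphere z'))).spherePair hm).1.1 +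
      sgn (n * m) • σ.φ m m z z',
      (((σ.push (toSphere z)) + (σ.push (toSphere z'))).spherePair hm).1.2)) :
    SphereRel β n r ((σ.push (toSphere (z + z'))).spherePair hm) w := by
  rw [BStr.spherePair_add, BStr.spherePair_push_toSphere, BStr.spherePair_push_toSphere] at hw
  -- The cross terms are `θ(z)(z') + θ(z')(z)`. Replacing the first through `φ(z)(z')` leaves `x -
  -- (-1)^r x̄` for this `x`.
  refine SphereRel.of_sub (-(sgn (n * m) • σ.θ m m z' z)) ?_ ?_
  · rw [hw, BStr.spherePair_push_toSphere, σ.φ_apply_cocycles hm, star_neg, star_zsmul]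
    change _ - sgn (n * m) • σ.θ m m (z.1 + z'.1) (z.1 + z'.1) = _
    simp only [map_add, StarDual.add_apply, smul_add, sgn_smul_sgn_smul]
    rw [smul_neg, smul_comm (sgn r) (sgn (n * m))]
    abel
  · rw [hw, BStr.spherePair_push_toSphere]
    exact (map_add _ _ _).symm

theorem BStr.wu_add_of_lt (hm : m + r = n) (h : 2 * r < n) (σ : BStr β C n)
    (z z' : cocycles C m) : σ.wu (z + z') = σ.wu z + σ.wu z' := by
  refine (QB.mk_eq_mk (b := σ.push (toSphere z) + σ.push (toSphere z'))).2
    ((BStr.rel_iff_of_lt hm h _ _).2 ⟨0, ?_⟩)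
  rw [map_zero, BStr.add_f, map_add]
  change _ = crossEval hm (pushCross _ _) + crossEval hm (pushCross _ _) -
    crossEval hm (pushCross _ _)
  rw [crossEval_pushCross_toSphere, crossEval_pushCross_toSphere, crossEval_pushCross_toSphere,
    eq_comm, sub_eq_zero]
  exact (map_add (σ.f ⟨(m, r), hm⟩) z.1 z'.1).symm

theorem BStr.wu_add_of_gt (hm : m + r = n) (h : n < 2 * r) (σ : BStr β C n)
    (z z' : cocycles C m) : σ.wu (z + z') = σ.wu z + σ.wu z' := by
  refine (QB.mk_eq_mk (b := σ.push (toSphere z) + σ.push (toSphere z'))).2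
    ((BStr.rel_iff_sphereRel hm h.le _ _).2 (σ.spherePair_add_rel hm z z' ?_))
  rw [σ.hφ.1 m m (by omega)]
  simp

theorem BStr.wu_add_of_eq (hm : m + r = n) (h : 2 * r = n) (σ : BStr β C n)
    (z z' : cocycles C m) (w : SpherePair β n r) (hw : w.1 = (σ.φ m m z z', 0)) :
    σ.wu (z + z') = σ.wu z + σ.wu z' +
      (QB.sphereEquivQuot β hm h.ge).symm (Quot.mk _ w) := by
  refine (QB.mk_eq_mk (b := σ.push (toSphere z) + σ.push (toSphere z') + w.toBStr hm h.ge)).2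
    ((BStr.rel_iff_sphereRel hm h.ge _ _).2 (σ.spherePair_add_rel hm z z' ?_))
  have e : sgn (n * m) = 1 := by rw [← h, mul_assoc, sgn_two_mul]
  rw [BStr.spherePair_add, SpherePair.spherePair_toBStr, hw, e]
  simp

/-- The cocycle `cz` is `z` followed by right multiplication by `c̄`, so the two pushed structures
are equal, not merely equivalent. -/
theorem BStr.wu_smul (σ : BStr β C n) (hm : m + r = n) (c : A) (z : cocycles C m) :
    σ.wu (c • z) = QB.push (sphereMul m (star c)) (σ.wu z) := by
  have hfam : ∀ θ : Fam C, pushFam (toSphere (c • z)) θ =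
      pushFam (sphereMul m (star c)) (pushFam (toSphere z) θ) := fun θ => by
    apply (famEval m).injective
    rw [famEval_pushFam_sphereMul, famEval_pushFam_toSphere, famEval_pushFam_toSphere]
    change θ m m (c • z.1) (c • z.1) = _
    rw [map_smul, map_smul, StarDual.smul_apply, smul_eq_mul, mul_assoc]
  refine congrArg QB.mk (BStr.ext (hfam σ.φ) (hfam σ.θ) ?_)
  apply (crossEval hm).injective
  change crossEval hm (pushCross _ _) = crossEval hm (pushCross _ (pushCross _ _))
  rw [crossEval_pushCross_sphereMul, crossEval_pushCross_toSphere, crossEval_pushCross_toSphere]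
  exact map_smul _ c z.1

/-- The Wu class as a map on cohomology. -/
noncomputable def BStr.wuClass (σ : BStr β C n) (m : ℤ) (ζ : Cohomology C m) :
    QB β (sphere A m) n :=
  σ.wu (Function.surjInv (Submodule.Quotient.mk_surjective _) ζ)

theorem BStr.wuClass_mk (hm : m + r = n) (σ : BStr β C n) (z : cocycles C m) :
    σ.wuClass m (Submodule.Quotient.mk z) = σ.wu z := by
  have h := Function.surjInv_eq (Submodule.Quotient.mk_surjective
    ((LinearMap.range (dDual C (m - 1) m)).comap (cocycles C m).subtype))
    (Submodule.Quotient.mk z)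
  obtain ⟨w, hw⟩ := (Submodule.Quotient.eq _).1 h.symm
  exact σ.wu_eq_of_sub_mem hm _ _ w hw.symm

theorem SubQuot.mk_congr {G : Type*} [AddCommGroup G] {Z D : AddSubgroup G} {z z' : G}
    (hz : z ∈ Z) (h : z = z') : ∃ h', SubQuot.mk D z hz = SubQuot.mk D z' h' := by
  subst h
  exact ⟨hz, rfl⟩

theorem BStr.symSphereEquiv_wu (hm : m + r = n) (σ : BStr β C n) (z : cocycles C m) :
    ∃ h, symSphereEquiv hm (QB.toSym _ β n (σ.wu z)) = SubQuot.mk _ (σ.φ m m z z) h :=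
  SubQuot.mk_congr _ (famEval_pushFam_toSphere z σ.φ)

/-- In positive degrees of `ℤ₂`-cohomology all signs are trivial. -/
theorem SubQuot.mk_sgn_smul {k e l : ℤ} (hk : 0 < k) {a : A}
    (ha : sgn l • a ∈ z2Cocycles A e k) :
    ∃ h, SubQuot.mk (z2Boundaries A e k) (sgn l • a) ha = SubQuot.mk _ a h := by
  have ha' : a ∈ z2Cocycles A e k := by
    have := zsmul_mem ha (sgn l)
    rwa [sgn_smul_sgn_smul] at this
  refine ⟨ha', SubQuot.mk_eq_mk.2 ?_⟩
  rcases sgn_cases l with h | h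
  · rw [h, one_smul, sub_self]; exact zero_mem _
  -- The difference is `2a`, and since `a` equals its own signed conjugate this is a norm.
  · refine ⟨fun h => by omega, a, ?_⟩
    rw [h, neg_smul, one_smul, sub_neg_eq_add, ← ha'.2]

end Wu

end ChainBundles

/-! ### The theorem -/

theorem mainTheorem6 {A : Type u} [Ring A] [StarRing A]
    (B : ChainComplex (ModuleCat.{u} A) ℤ) (β : Bundle B) :
    -- The commutative braid of exact sequences.
    (∀ C : ChainComplex (ModuleCat.{u} A) ℤ, FiniteDim C → ∀ n : ℤ,
      ((QB.toSym C β n).comp (QB.ofQuad C β n) = symmetrize C n ∧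
        (mapJ C n).comp (QB.toSym C β n) = (mapI C β n).comp (QB.toCross C β n) ∧
        (QB.toCross C β n).comp (PB.toQB C β n) = PB.toCross C β n ∧
        (PB.toQB C β n).comp (PB.ofTate C β n) = (QB.ofQuad C β n).comp (mapH C n)) ∧
      (Function.Exact (symmetrize C n) (mapJ C n) ∧
        Function.Exact (mapJ C (n + 1)) (mapH C n) ∧
        Function.Exact (mapH C n) (symmetrize C n)) ∧
      (Function.Exact (PB.toQB C β n) (QB.toSym C β n) ∧
        Function.Exact (QB.toSym C β (n + 1)) ((PB.ofTate C β n).comp (mapJ C (n + 1))) ∧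
        Function.Exact ((PB.ofTate C β n).comp (mapJ C (n + 1))) (PB.toQB C β n)) ∧
      (Function.Exact (QB.ofQuad C β n) (QB.toCross C β n) ∧
        Function.Exact (QB.toCross C β (n + 1)) ((mapH C n).comp (mapI C β (n + 1))) ∧
        Function.Exact ((mapH C n).comp (mapI C β (n + 1))) (QB.ofQuad C β n)) ∧
      (Function.Exact (PB.toCross C β n) (mapI C β n) ∧
        Function.Exact (mapI C β (n + 1)) (PB.ofTate C β n) ∧
        Function.Exact (PB.ofTate C β n) (PB.toCross C β n)) ∧
      -- The sequence `Q⟨B, β⟩^n(C) → Q^n(C) ⊕ H_n(B^t ⊗_A C) → Q̂^n(C) → Q⟨B, β⟩^{n-1}(C)`.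
      (Function.Exact ((QB.toSym C β n).prod (QB.toCross C β n))
          ((mapJ C n).coprod (-(mapI C β n))) ∧
        Function.Exact ((mapJ C (n + 1)).coprod (-(mapI C β (n + 1))))
          ((PB.toQB C β n).comp (PB.ofTate C β n)) ∧
        Function.Exact ((PB.toQB C β n).comp (PB.ofTate C β n))
          ((QB.toSym C β n).prod (QB.toCross C β n)))) ∧
    -- The universal bundle.
    (IsUniversal β → ∀ C : ChainComplex (ModuleCat.{u} A) ℤ, FiniteDim C → ∀ n : ℤ,
      Function.Bijective (QB.toSym C β n) ∧ Subsingleton (PB β C n)) ∧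
    -- The zero bundle.
    ((∀ i, Subsingleton (B.X i)) → ∀ C : ChainComplex (ModuleCat.{u} A) ℤ, FiniteDim C → ∀ n : ℤ,
      Function.Bijective (QB.ofQuad C β n) ∧ Function.Bijective (PB.ofTate C β n)) ∧
    -- The groups `Q⟨B, β⟩^n(S^{n-r} A)` and the Wu classes, with `m = n - r`.
    (∀ (n r m : ℤ) (hm : m + r = n),
      ∃ ι : QSym (sphere A m) n ≃+ Z2Coh A (sgn m) (n - 2 * r),
        (∀ (φ : Fam (sphere A m)) (hφ : φ ∈ symCycles (sphere A m) n),
          ∃ h, ι (SubQuot.mk _ φ hφ) = SubQuot.mk _ (φ m m (sphereOne A m) (sphereOne A m)) h) ∧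
        (∀ C : ChainComplex (ModuleCat.{u} A) ℤ, FiniteDim C → ∀ σ : BStr β C n,
          (∃ v : Cohomology C m → QB β (sphere A m) n,
            (∀ z : cocycles C m, v (Submodule.Quotient.mk z) = σ.wu z) ∧
            (∀ (c : A) (ζ : Cohomology C m), v (c • ζ) = QB.push (sphereMul m (star c)) (v ζ)) ∧
            (2 * r ≠ n → ∀ ζ ζ' : Cohomology C m, v (ζ + ζ') = v ζ + v ζ')) ∧
          (∀ z : cocycles C m,
            ∃ h, ι (QB.toSym _ β n (σ.wu z)) = SubQuot.mk _ (σ.φ m m z z) h)) ∧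
        (2 * r < n → ∃ e : QB β (sphere A m) n ≃+ B.homology r,
          (∀ (σ : BStr β (sphere A m) n) (y : B.cycles r),
            (B.iCycles r).hom y = σ.f ⟨(m, r), hm⟩ (sphereOne A m) →
              e (QB.mk σ) = (B.homologyπ r).hom y) ∧
          (∀ (c : A) (x : QB β (sphere A m) n),
            e (QB.push (sphereMul m (star c)) x) = c • e x) ∧
          (∀ y : B.cycles r, ∃ h,
            ι (QB.toSym _ β n (e.symm ((B.homologyπ r).hom y))) =
              SubQuot.mk _ (β.β r r ((B.iCycles r).hom y) ((B.iCycles r).hom y)) h) ∧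
          (∀ C : ChainComplex (ModuleCat.{u} A) ℤ, FiniteDim C → ∀ (σ : BStr β C n)
            (z : cocycles C m), ∃ y : B.cycles r,
              (B.iCycles r).hom y = σ.f ⟨(m, r), hm⟩ z ∧
              e (σ.wu z) = (B.homologyπ r).hom y)) ∧
        (n ≤ 2 * r → _root_.Equivalence (SphereRel β n r) ∧
          ∃ e : QB β (sphere A m) n ≃ Quot (SphereRel β n r),
          (∀ σ : BStr β (sphere A m) n, ∃ h,
            e (QB.mk σ) = Quot.mk _ ⟨(sgn (n * m) • σ.θ m m (sphereOne A m) (sphereOne A m),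
              σ.f ⟨(m, r), hm⟩ (sphereOne A m)), h⟩) ∧
          (∀ w w' : SpherePair β n r, ∃ h,
            e.symm (Quot.mk _ w) + e.symm (Quot.mk _ w') =
              e.symm (Quot.mk _ ⟨(w.1.1 + w'.1.1 - β.β r r w.1.2 w'.1.2, w.1.2 + w'.1.2), h⟩)) ∧
          (∀ (c : A) (w : SpherePair β n r), ∃ h,
            QB.push (sphereMul m (star c)) (e.symm (Quot.mk _ w)) =
              e.symm (Quot.mk _ ⟨(c * w.1.1 * star c, c • w.1.2), h⟩)) ∧
          (2 * r = n → ∀ w : SpherePair β n r, ∃ h,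
            ι (QB.toSym _ β n (e.symm (Quot.mk _ w))) =
              SubQuot.mk _ (w.1.1 + sgn r • star w.1.1 + β.β r r w.1.2 w.1.2) h) ∧
          (n < 2 * r → QB.toSym (sphere A m) β n = 0) ∧
          (∀ C : ChainComplex (ModuleCat.{u} A) ℤ, FiniteDim C → ∀ σ : BStr β C n,
            (∀ z : cocycles C m, ∃ h,
              e (σ.wu z) = Quot.mk _ ⟨(sgn (n * m) • σ.θ m m z z, σ.f ⟨(m, r), hm⟩ z), h⟩) ∧
            (2 * r = n → ∀ z z' : cocycles C m, ∃ h,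
              σ.wu (z + z') = σ.wu z + σ.wu z' +
                e.symm (Quot.mk _ ⟨(σ.φ m m z z', 0), h⟩))))) := by
  refine ⟨fun C _ n => ⟨⟨toSym_comp_ofQuad, mapJ_comp_toSym, toCross_comp_toQB, toQB_comp_ofTate⟩,
    ⟨exact_symmetrize_mapJ, exact_mapJ_mapH, exact_mapH_symmetrize⟩,
    ⟨exact_toQB_toSym, exact_toSym_ofTate_mapJ, exact_ofTate_mapJ_toQB⟩,
    ⟨exact_ofQuad_toCross, exact_toCross_mapH_mapI, exact_mapH_mapI_ofQuad⟩,
    ⟨exact_toCross_mapI, exact_mapI_ofTate, exact_ofTate_toCross⟩,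
    ⟨exact_prod_coprod, exact_coprod_toQB_ofTate, exact_toQB_ofTate_prod⟩⟩,
    fun hβ C hC n => ⟨hβ.bijective_toSym hC n, hβ.subsingleton_PB hC n⟩,
    fun hB C _ n => ⟨bijective_ofQuad hB n, bijective_ofTate hB n⟩, ?_⟩
  intro n r m hm
  refine ⟨symSphereEquiv hm, fun φ hφ => ⟨_, symSphereEquiv_mk hm φ hφ⟩, fun C _ σ =>
    ⟨⟨σ.wuClass m, σ.wuClass_mk hm, ?_, ?_⟩, σ.symSphereEquiv_wu hm⟩, fun h => ?_, fun h => ?_⟩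
  · intro c ζ
    obtain ⟨z, rfl⟩ := Submodule.Quotient.mk_surjective _ ζ
    rw [← Submodule.Quotient.mk_smul, σ.wuClass_mk hm, σ.wuClass_mk hm, σ.wu_smul hm]
  · intro h ζ ζ'
    obtain ⟨z, rfl⟩ := Submodule.Quotient.mk_surjective _ ζ
    obtain ⟨z', rfl⟩ := Submodule.Quotient.mk_surjective _ ζ'
    rw [← Submodule.Quotient.mk_add, σ.wuClass_mk hm, σ.wuClass_mk hm, σ.wuClass_mk hm]
    rcases h.lt_or_gt with h | h
    · exact σ.wu_add_of_lt hm h z z'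
    · exact σ.wu_add_of_gt hm h z z'
  · obtain ⟨e, he⟩ := QB.exists_sphereEquivHomology β hm h
    refine ⟨e, he, fun c x => ?_, fun y => ?_, fun C _ σ z => ?_⟩
    · obtain ⟨σ, rfl⟩ := QB.mk_surj x
      obtain ⟨y, hy⟩ := σ.exists_iCycles hm
      rw [he σ y hy, ← map_smul]
      refine he (σ.push _) (c • y) ?_
      rw [map_smul, hy]
      exact (crossEval_pushCross_sphereMul hm c σ.f).symm
    · obtain ⟨σ, hσ, hφ⟩ := BStr.exists_of_lt β hm h y
      rw [← he σ y hσ.symm, AddEquiv.symm_apply_apply]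
      -- The representative with `θ = 0` has `φ = fβf^*`, whose value carries `(-1)^{nm}`. As `n -
      -- 2r > 0`, this sign is invisible in `ℤ₂`-cohomology.
      have hv : famEval m σ.φ =
          sgn (n * m) • β.β r r ((B.iCycles r).hom y) ((B.iCycles r).hom y) := by
        rw [hφ, pull, famEval_mu β hm hm, hσ]
      obtain ⟨h1, e1⟩ := SubQuot.mk_congr (D := z2Boundaries A (sgn m) (n - 2 * r))
        ((mem_symCycles_sphere hm σ.φ).1 σ.hφ) hv
      obtain ⟨h2, e2⟩ := SubQuot.mk_sgn_smul (by omega) h1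
      exact ⟨h2, e1.trans e2⟩
    · obtain ⟨y, hy⟩ := (σ.push (toSphere z)).exists_iCycles hm
      exact ⟨y, hy.trans (crossEval_pushCross_toSphere hm z σ.f), he _ y hy⟩
  · refine ⟨sphereRel_equivalence hm h, QB.sphereEquivQuot β hm h,
      fun σ => ⟨(σ.spherePair hm).2, rfl⟩, fun w w' => ?_, fun c w => ?_, fun hr w => ?_,
      fun h => QB.toSym_sphere_eq_zero hm h, fun C _ σ => ⟨fun z => ?_, fun hr z z' => ?_⟩⟩
    · have key := BStr.spherePair_add hm (w.toBStr hm h) (w'.toBStr hm h)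
      rw [SpherePair.spherePair_toBStr, SpherePair.spherePair_toBStr] at key
      -- The side condition on the new pair is inherited from the structure that realizes it.
      refine ⟨key ▸ ((w.toBStr hm h + w'.toBStr hm h).spherePair hm).2, ?_⟩
      refine (QB.mk_eq_sphereEquivQuot_symm hm h (w.toBStr hm h + w'.toBStr hm h)).trans ?_
      exact congrArg _ (congrArg _ (Subtype.ext key))
    · have key := BStr.spherePair_push_sphereMul hm c (w.toBStr hm h)
      rw [SpherePair.spherePair_toBStr] at key
      refine ⟨key ▸ (((w.toBStr hm h).push (sphereMul m (star c))).spherePair hm).2, ?_⟩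
      refine (QB.mk_eq_sphereEquivQuot_symm hm h ((w.toBStr hm h).push _)).trans ?_
      exact congrArg _ (congrArg _ (Subtype.ext key))
    · exact SubQuot.mk_congr ((mem_symCycles_sphere hm _).1 (w.toBStr hm h).hφ)
        ((famEval m).apply_symm_apply _)
    · have key := σ.spherePair_push_toSphere hm z
      exact ⟨key ▸ ((σ.push (toSphere z)).spherePair hm).2,
        congrArg (Quot.mk _) (Subtype.ext key)⟩
    -- For `2r = n` the condition on the first entry is void, so `(φ_0(z)(z'), 0)` is an admissible
    -- pair.
    · exact ⟨⟨map_zero _, fun h => by omega⟩, σ.wu_add_of_eq hm hr z z' _ rfl⟩
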